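/- Let $T>0$, $\mathbb{T}=\mathbb{R}/T\mathbb{Z}$, $n\ge 1$, and $\mathbb{R}^n_+=\{x\in\mathbb{R}^n : x_n>0\}$; all functions are complex valued. For $m\ge 0$ and $s,r\ge 0$ let $H^{(s,r)}_\perp(\mathbb{T}\times\mathbb{R}^m)$ be the space of all $f\in L^2(\mathbb{T}\times\mathbb{R}^m)$ that are purely oscillatory, i.e. $\int_{\mathbb{T}}f(t,x)\,dt=0$ for a.e. $x$, and for which $$\|f\|_{(s,r)}=\big\|\mathcal{F}^{-1}\big[(1+|\tau|^2)^{s/2}(1+|\xi|^2)^{r/2}\,\mathcal{F}f\big]\big\|_{L^2(\mathbb{T}\times\mathbb{R}^m)}<\infty ,$$ where $\mathcal{F}$ is the Fourier transform on $\mathbb{T}\times\mathbb{R}^m$ and $(\tau,\xi)\in\frac{2\pi}{T}\mathbb{Z}\times\mathbb{R}^m$. Let $\overline{H}^{(s,r)}_\perp(\mathbb{T}\times\mathbb{R}^n_+)$ be the space of restrictions to $\mathbb{T}\times\mathbb{R}^n_+$ of elements of $H^{(s,r)}_\perp(\mathbb{T}\times\mathbb{R}^n)$, with the quotient norm, and $L^2_\perp(\mathbb{T}\times\mathbb{R}^n_+)=\overline{H}^{(0,0)}_\perp(\mathbb{T}\times\mathbb{R}^n_+)$.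 Intersections and products carry the sum of the norms. Put $\mathbb{E}=\mathbb{E}_1\times\mathbb{E}_2$, $\mathbb{F}=\mathbb{F}_1\times\mathbb{F}_2$, $\mathbb{G}=\mathbb{G}_1\times\mathbb{G}_2$ with $$\mathbb{E}_1=\overline{H}^{(1,1)}_\perp(\mathbb{T}\times\mathbb{R}^n_+)\cap\overline{H}^{(0,3)}_\perp(\mathbb{T}\times\mathbb{R}^n_+),\qquad \mathbb{E}_2=\overline{H}^{(0,2)}_\perp(\mathbb{T}\times\mathbb{R}^n_+),$$ $$\mathbb{F}_1=L^2_\perp(\mathbb{T}\times\mathbb{R}^n_+),\qquad \mathbb{F}_2=\overline{H}^{(0,1)}_\perp(\mathbb{T}\times\mathbb{R}^n_+),$$ $$\mathbb{G}_1=H^{(3/4,0)}_\perp(\mathbb{T}\times\mathbb{R}^{n-1})\cap H^{(0,3/2)}_\perp(\mathbb{T}\times\mathbb{R}^{n-1}),\qquad \mathbb{G}_2=H^{(0,1/2)}_\perp(\mathbb{T}\times\mathbb{R}^{n-1}).$$ Then for all $f=(f_1,f_2)\in\mathbb{F}$ and $g=(g_1,g_2)\in\mathbb{G}$ the time-periodic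 Cahn–Hilliard–Gurtin system $$\begin{cases}\partial_t u_1-\Delta u_2=f_1 & \text{in }\mathbb{T}\times\mathbb{R}^n_+,\\ \Delta u_1-\partial_t u_1+u_2=f_2 & \text{in }\mathbb{T}\times\mathbb{R}^n_+,\\ \partial_n u_1|_{x_n=0}=g_1 & \text{on }\mathbb{T}\times\mathbb{R}^{n-1},\\ \partial_n u_2|_{x_n=0}=g_2 & \text{on }\mathbb{T}\times\mathbb{R}^{n-1}\end{cases}$$ (the first two equations in the sense of distributions, the last two in the sense of traces, i.e. through the continuous extension of $\varphi\mapsto\partial_n\varphi|_{x_n=0}$ from smooth compactly supported functions) has a unique solution $u=(u_1,u_2)\in\mathbb{E}$, and $$\|u\|_{\mathbb{E}}\le C\,\big(\|f\|_{\mathbb{F}}+\|g\|_{\mathbb{G}}\big)$$ with a constant $C$ that depends only on $T$ and $n$. Moreover, the operator $$S(u_1,u_2)=\big(\partial_t u_1-\Delta u_2,\ \Delta u_1-\partial_t u_1+u_2,\ \partial_n u_1|_{x_n=0},\ \partial_n u_2|_{x_n=0}\big)$$ is a linear isomorphism from $\mathbb{E}$ onto $\mathbb{F}\times\mathbb{G}$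 that is bounded and has a bounded inverse. -/

import Mathlib

open MeasureTheory Filter Topology
open scoped ENNReal NNReal FourierTransform

noncomputable section

namespace CahnHilliardGurtin

/-- The group `𝕋 × ℝᵐ` with `𝕋 = ℝ / Tℤ`. It carries the product of Lebesgue measures. -/
abbrev Cyl (T : ℝ) (m : ℕ) : Type := AddCircle T × EuclideanSpace ℝ (Fin m)

/-- The open half space `𝕋 × ℝⁿ₊ = {(t, x) : xₙ > 0}` in dimension `n = d + 1`. -/
def upperHalf (T : ℝ) (d : ℕ) : Set (Cyl T (d + 1)) := {p | 0 < p.2 (Fin.last d)}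

/-- Complex valued `L²(𝕋 × ℝᵐ)`. -/
abbrev L2 (T : ℝ) [Fact (0 < T)] (m : ℕ) : Type := Lp ℂ 2 (volume : Measure (Cyl T m))

/-- Complex valued `L²(𝕋 × ℝⁿ₊)`, `n = d + 1`. -/
abbrev L2Half (T : ℝ) [Fact (0 < T)] (d : ℕ) : Type :=
  Lp ℂ 2 ((volume : Measure (Cyl T (d + 1))).restrict (upperHalf T d))

section FourierInTime

variable {T : ℝ} [Fact (0 < T)] {m : ℕ}

theorem memLp_haar_prod {f : Cyl T m → ℂ} (hf : MemLp f 2 volume) :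
    MemLp f 2 ((AddCircle.haarAddCircle (T := T)).prod
      (volume : Measure (EuclideanSpace ℝ (Fin m)))) := by
  have hT : (0 : ℝ) < T := Fact.out
  have h : (volume : Measure (Cyl T m)) = ENNReal.ofReal T •
      ((AddCircle.haarAddCircle (T := T)).prod
        (volume : Measure (EuclideanSpace ℝ (Fin m)))) := by
    rw [← Measure.prod_smul_left, ← AddCircle.volume_eq_smul_haarAddCircle]
    rfl
  rw [h] at hf
  refine hf.of_measure_le_smul (c := (ENNReal.ofReal T)⁻¹) ?_ ?_
  · simp [hT]
  · rw [smul_smul, ENNReal.inv_mul_cancel (by simp [hT]) (by simp), one_smul]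

theorem ae_slice {p : Cyl T m → Prop} (hp : ∀ᵐ q, p q) :
    ∀ᵐ x : EuclideanSpace ℝ (Fin m), ∀ᵐ t ∂(AddCircle.haarAddCircle (T := T)), p (t, x) := by
  have hT : (0 : ℝ) < T := Fact.out
  have h : (volume : Measure (Cyl T m)) = ENNReal.ofReal T •
      ((AddCircle.haarAddCircle (T := T)).prod
        (volume : Measure (EuclideanSpace ℝ (Fin m)))) := by
    rw [← Measure.prod_smul_left, ← AddCircle.volume_eq_smul_haarAddCircle]
    rfl
  rw [h, Measure.ae_ennreal_smul_measure_iff (by simp [hT])] at hp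
  exact Measure.ae_ae_of_ae_prod
    (Measure.measurePreserving_swap.quasiMeasurePreserving.ae hp)

theorem ae_memLp_slice {f : Cyl T m → ℂ} (hf : MemLp f 2 volume) :
    ∀ᵐ x : EuclideanSpace ℝ (Fin m),
      MemLp (fun t : AddCircle T => f (t, x)) 2 AddCircle.haarAddCircle := by
  have h := memLp_haar_prod hf
  have h2 := (memLp_two_iff_integrable_sq_norm h.1).1 h
  filter_upwards [h2.prod_left_ae, h.1.prodMk_right] with x hx hx'
  exact (memLp_two_iff_integrable_sq_norm hx').2 hx

/-- The function `x ↦ T⁻¹ ∫_𝕋 f(t, x) e^{-2πikt/T} dt` is square integrable if `f` is. -/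
theorem memLp_fourierCoeff {f : Cyl T m → ℂ} (hf : MemLp f 2 volume) (k : ℤ) :
    MemLp (fun x : EuclideanSpace ℝ (Fin m) =>
      fourierCoeff (fun t : AddCircle T => f (t, x)) k) 2 volume := by
  have h := memLp_haar_prod hf
  have hmeas : AEStronglyMeasurable (fun p : Cyl T m => fourier (-k) p.1 • f p)
      ((AddCircle.haarAddCircle (T := T)).prod
        (volume : Measure (EuclideanSpace ℝ (Fin m)))) :=
    ((fourier (T := T) (-k)).continuous.comp continuous_fst).aestronglyMeasurable.smul h.1
  refine ⟨hmeas.prod_swap.integral_prod_right', ?_⟩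
  rw [eLpNorm_lt_top_iff_lintegral_rpow_enorm_lt_top (by norm_num) (by norm_num)]
  have hfin := h.2
  rw [eLpNorm_lt_top_iff_lintegral_rpow_enorm_lt_top (by norm_num) (by norm_num)] at hfin
  rw [lintegral_prod_symm _ (h.1.enorm.pow_const _)] at hfin
  refine lt_of_le_of_lt (lintegral_mono_ae ?_) hfin
  filter_upwards [ae_memLp_slice hf] with x hx
  have h1 : ‖fourierCoeff (fun t : AddCircle T => f (t, x)) k‖ₑ
      ≤ eLpNorm (fun t : AddCircle T => f (t, x)) 2 AddCircle.haarAddCircle := by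
    refine le_trans ?_ (eLpNorm_le_eLpNorm_of_exponent_le (p := 1) (by norm_num) hx.1)
    rw [eLpNorm_one_eq_lintegral_enorm]
    refine (enorm_integral_le_lintegral_enorm _).trans (le_of_eq ?_)
    refine lintegral_congr fun t => ?_
    rw [enorm_smul]
    have : ‖fourier (T := T) (-k) t‖ₑ = 1 := by
      rw [← ofReal_norm, fourier_apply, Circle.norm_coe, ENNReal.ofReal_one]
    rw [this, one_mul]
  refine (ENNReal.rpow_le_rpow h1 (by norm_num)).trans (le_of_eq ?_)
  rw [eLpNorm_eq_lintegral_rpow_enorm_toReal (by norm_num) (by norm_num), ← ENNReal.rpow_mul]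
  norm_num

theorem integrable_fourier_smul {h : AddCircle T → ℂ} (hh : MemLp h 2 AddCircle.haarAddCircle)
    (k : ℤ) : Integrable (fun t => fourier (-k) t • h t) AddCircle.haarAddCircle := by
  have h1 : Integrable h AddCircle.haarAddCircle := hh.integrable (by norm_num)
  have h2 : AEStronglyMeasurable (fun t => fourier (T := T) (-k) t) AddCircle.haarAddCircle :=
    (fourier (T := T) (-k)).continuous.aestronglyMeasurable
  refine h1.bdd_smul (φ := fun t => fourier (T := T) (-k) t) 1 h2 (ae_of_all _ fun t => ?_)
  rw [fourier_apply, Circle.norm_coe]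

/-- The `k`-th Fourier coefficient in time, `x ↦ T⁻¹ ∫_𝕋 f(t, x) e^{-2πikt/T} dt`, as a linear
map `L²(𝕋 × ℝᵐ) → L²(ℝᵐ)`. -/
def timeCoeff (k : ℤ) :
    L2 T m →ₗ[ℂ] Lp ℂ 2 (volume : Measure (EuclideanSpace ℝ (Fin m))) where
  toFun f := (memLp_fourierCoeff (Lp.memLp f) k).toLp _
  map_add' f g := by
    rw [← MemLp.toLp_add]
    refine MemLp.toLp_congr _ _ ?_
    filter_upwards [ae_slice (Lp.coeFn_add f g), ae_memLp_slice (Lp.memLp f),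
      ae_memLp_slice (Lp.memLp g)] with x hx hf hg
    simp only [Pi.add_apply, fourierCoeff]
    rw [← integral_add (integrable_fourier_smul hf k) (integrable_fourier_smul hg k)]
    refine integral_congr_ae ?_
    filter_upwards [hx] with t ht
    rw [ht, Pi.add_apply, smul_add]
  map_smul' c f := by
    rw [RingHom.id_apply, ← MemLp.toLp_const_smul]
    refine MemLp.toLp_congr _ _ ?_
    filter_upwards [ae_slice (Lp.coeFn_smul c f)] with x hx
    simp only [Pi.smul_apply, fourierCoeff]
    rw [← integral_smul]
    refine integral_congr_ae ?_
    filter_upwards [hx] with t ht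
    rw [ht, Pi.smul_apply, smul_comm]

end FourierInTime

section SobolevSpaces

variable {T : ℝ} [Fact (0 < T)] {m : ℕ}

/-- The symbol `⟨τ⟩ˢ ⟨ξ⟩ʳ` with `⟨y⟩ = (1 + |y|²)^{1/2}`. For `s, r ≥ 0` it is comparable, with
absolute constants, to the sum of `⟨τ⟩ᵃ ⟨ξ⟩ᵇ` over the vertices `(b, a) ≠ (0, 0)` of the rectangle
with corners `(0, 0)` and `(r, s)`. -/
def weight (s r τ : ℝ) (ξ : EuclideanSpace ℝ (Fin m)) : ℝ :=
  (1 + τ ^ 2) ^ (s / 2) * (1 + ‖ξ‖ ^ 2) ^ (r / 2)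

/-- The square of the norm of `H^{(s,r)}(𝕋 × ℝᵐ)`, namely `T ∑ₖ ∫ |w f̂|²`. Here `f̂` is the Fourier
transform in time and space; since `𝓕` has the kernel `e^{-2πi x·ξ}`, the angular frequency that
belongs to `(k, ξ)` is `(2πk/T, 2πξ)`. -/
def sobolevNormSq (s r : ℝ) (f : L2 T m) : ℝ≥0∞ :=
  ENNReal.ofReal T * ∑' k : ℤ, ∫⁻ ξ : EuclideanSpace ℝ (Fin m),
    (ENNReal.ofReal (weight s r (2 * Real.pi * k / T) ((2 * Real.pi) • ξ)) *
      ‖(𝓕 (timeCoeff k f) : Lp ℂ 2 (volume : Measure (EuclideanSpace ℝ (Fin m)))) ξ‖ₑ) ^ 2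

/-- The norm `‖f‖ = ‖op[w] f‖_{L²(𝕋 × ℝᵐ)}` of `H^{(s,r)}(𝕋 × ℝᵐ)` for `s, r ≥ 0`; it is infinite
if `f ∈ L²` is not in this space. -/
def sobolevNorm (s r : ℝ) (f : L2 T m) : ℝ≥0∞ := sobolevNormSq s r f ^ (1 / 2 : ℝ)

theorem sobolevNorm_lt_top_iff {s r : ℝ} {f : L2 T m} :
    sobolevNorm s r f < ⊤ ↔ sobolevNormSq s r f < ⊤ :=
  ENNReal.rpow_lt_top_iff_of_pos (by norm_num)

theorem sobolevNormSq_zero (s r : ℝ) : sobolevNormSq s r (0 : L2 T m) = 0 := by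
  unfold sobolevNormSq
  simp only [map_zero]
  have h0 : (𝓕 (0 : Lp ℂ 2 (volume : Measure (EuclideanSpace ℝ (Fin m)))) :
      Lp ℂ 2 (volume : Measure (EuclideanSpace ℝ (Fin m)))) = 0 :=
    (Lp.fourierTransformₗᵢ (EuclideanSpace ℝ (Fin m)) ℂ).map_zero
  rw [h0]
  simp only [mul_eq_zero, ENNReal.tsum_eq_zero]
  refine Or.inr fun k => ?_
  rw [← lintegral_zero (μ := (volume : Measure (EuclideanSpace ℝ (Fin m))))]
  refine lintegral_congr_ae ?_
  filter_upwards [Lp.coeFn_zero ℂ 2 (volume : Measure (EuclideanSpace ℝ (Fin m)))] with ξ hξ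
  rw [hξ]
  simp

theorem sobolevNormSq_add_le (s r : ℝ) (f g : L2 T m) :
    sobolevNormSq s r (f + g) ≤ 2 * (sobolevNormSq s r f + sobolevNormSq s r g) := by
  unfold sobolevNormSq
  rw [← mul_add, ← ENNReal.tsum_add, mul_left_comm 2, ← ENNReal.tsum_mul_left (a := 2)]
  refine mul_le_mul_right (ENNReal.tsum_le_tsum fun k => ?_) _
  have hw : Measurable fun ξ : EuclideanSpace ℝ (Fin m) =>
      ENNReal.ofReal (weight s r (2 * Real.pi * k / T) ((2 * Real.pi) • ξ)) := by
    unfold weight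
    fun_prop
  have hF : ∀ h : L2 T m, AEMeasurable (fun ξ : EuclideanSpace ℝ (Fin m) =>
      (ENNReal.ofReal (weight s r (2 * Real.pi * k / T) ((2 * Real.pi) • ξ)) *
      ‖(𝓕 (timeCoeff k h) : Lp ℂ 2 (volume : Measure (EuclideanSpace ℝ (Fin m)))) ξ‖ₑ) ^ 2) :=
    fun h => (hw.aemeasurable.mul (Lp.aestronglyMeasurable _).enorm).pow_const 2
  rw [← lintegral_add_left' (hF f), ← lintegral_const_mul' _ _ (by norm_num)]
  refine lintegral_mono_ae ?_
  rw [map_add, FourierTransform.fourier_add]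
  filter_upwards [Lp.coeFn_add (𝓕 (timeCoeff k f)) (𝓕 (timeCoeff k g))] with ξ hξ
  rw [hξ, Pi.add_apply]
  have hsq : ∀ a b : ℝ≥0∞, (a + b) ^ 2 ≤ 2 * (a ^ 2 + b ^ 2) := fun a b => by
    have := ENNReal.rpow_add_le_mul_rpow_add_rpow a b (p := 2) (by norm_num)
    norm_num at this
    exact_mod_cast this
  refine le_trans ?_ (hsq _ _)
  rw [← mul_add]
  gcongr
  exact enorm_add_le _ _

theorem sobolevNormSq_smul (s r : ℝ) (c : ℂ) (f : L2 T m) :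
    sobolevNormSq s r (c • f) = ‖c‖ₑ ^ 2 * sobolevNormSq s r f := by
  unfold sobolevNormSq
  rw [mul_left_comm, ← ENNReal.tsum_mul_left (a := ‖c‖ₑ ^ 2)]
  congr 1
  refine tsum_congr fun k => ?_
  rw [← lintegral_const_mul' (‖c‖ₑ ^ 2) _ (ENNReal.pow_ne_top enorm_ne_top)]
  refine lintegral_congr_ae ?_
  rw [map_smul, FourierTransform.fourier_smul]
  filter_upwards [Lp.coeFn_smul c (𝓕 (timeCoeff k f))] with ξ hξ
  rw [hξ, Pi.smul_apply, enorm_smul, ← mul_pow, mul_left_comm]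

/-- The space `H^{(s,r)}_⊥(𝕋 × ℝᵐ)`, `s, r ≥ 0`, of the purely oscillatory functions (those with
vanishing time average) in `H^{(s,r)}(𝕋 × ℝᵐ)`. -/
def sobolevPerp (T : ℝ) [Fact (0 < T)] (m : ℕ) (s r : ℝ) : Submodule ℂ (L2 T m) where
  carrier := {f | timeCoeff 0 f = 0 ∧ sobolevNorm s r f < ⊤}
  zero_mem' := by
    refine ⟨map_zero _, ?_⟩
    rw [sobolevNorm_lt_top_iff, sobolevNormSq_zero]
    exact ENNReal.zero_lt_top
  add_mem' := by
    rintro f g ⟨hf, hf'⟩ ⟨hg, hg'⟩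
    refine ⟨by rw [map_add, hf, hg, add_zero], ?_⟩
    rw [sobolevNorm_lt_top_iff] at *
    exact (sobolevNormSq_add_le s r f g).trans_lt
      (ENNReal.mul_lt_top (by norm_num) (ENNReal.add_lt_top.2 ⟨hf', hg'⟩))
  smul_mem' := by
    rintro c f ⟨hf, hf'⟩
    refine ⟨by rw [map_smul, hf, smul_zero], ?_⟩
    rw [sobolevNorm_lt_top_iff] at *
    rw [sobolevNormSq_smul]
    exact ENNReal.mul_lt_top (ENNReal.pow_lt_top enorm_lt_top) hf'

end SobolevSpaces

section HalfSpace

variable (T : ℝ) [Fact (0 < T)] (d : ℕ)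

/-- The restriction `r⁺ : L²(𝕋 × ℝⁿ) → L²(𝕋 × ℝⁿ₊)`. -/
def restrictHalf : L2 T (d + 1) →ₗ[ℂ] L2Half T d :=
  (LpToLpRestrictCLM (Cyl T (d + 1)) ℂ ℂ volume 2 (upperHalf T d)).toLinearMap

/-- The restricted space on the half space, that is the image of `H^{(s,r)}_⊥(𝕋 × ℝⁿ)` under
`r⁺`. -/
def halfSobolevPerp (s r : ℝ) : Submodule ℂ (L2Half T d) :=
  (sobolevPerp T (d + 1) s r).map (restrictHalf T d)

variable {T d}

/-- The quotient norm of the restricted space; it is infinite outside this space. -/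
def halfSobolevNorm (s r : ℝ) (f : L2Half T d) : ℝ≥0∞ :=
  ⨅ F ∈ {F : L2 T (d + 1) | F ∈ sobolevPerp T (d + 1) s r ∧ restrictHalf T d F = f},
    sobolevNorm s r F

end HalfSpace

section TestFunctions

variable {T : ℝ} {m d : ℕ}

/-- Membership in `C_c^∞(𝕋 × ℝᵐ)`. -/
structure IsTestFunction (φ : Cyl T m → ℂ) : Prop where
  smooth : ContDiff ℝ (⊤ : ℕ∞)
    (fun p : ℝ × EuclideanSpace ℝ (Fin m) => φ ((p.1 : AddCircle T), p.2))
  hasCompactSupport : HasCompactSupport φ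

/-- Membership in `C_c^∞(𝕋 × ℝⁿ₊)` (extended by zero). -/
structure IsHalfTestFunction (φ : Cyl T (d + 1) → ℂ) : Prop extends IsTestFunction φ where
  tsupport_subset : tsupport φ ⊆ upperHalf T d

/-- The time derivative of a smooth function. -/
def timeDeriv (φ : Cyl T m → ℂ) (p : Cyl T m) : ℂ :=
  deriv (fun s : ℝ => φ (p.1 + (s : AddCircle T), p.2)) 0

/-- The Laplacian in space of a smooth function. -/
def spaceLaplacian (φ : Cyl T m → ℂ) (p : Cyl T m) : ℂ :=
  Laplacian.laplacian (fun y => φ (p.1, y)) p.2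

/-- The derivative in direction `xₙ` of a smooth function. -/
def normalDeriv (φ : Cyl T (d + 1) → ℂ) (p : Cyl T (d + 1)) : ℂ :=
  lineDeriv ℝ (fun y => φ (p.1, y)) p.2 (EuclideanSpace.single (Fin.last d) 1)

/-- The embedding `(t, x') ↦ (t, x', 0)` of the boundary. -/
def boundaryPoint (q : Cyl T d) : Cyl T (d + 1) :=
  (q.1, WithLp.toLp 2 (Fin.snoc (α := fun _ => ℝ) q.2 0))

end TestFunctions

section System

variable {T : ℝ} [Fact (0 < T)] {d : ℕ}

/-- `g` is the Neumann trace `∂ₙ v|_{xₙ = 0}`: the graph of this operator is the closure of the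
graph of `φ ↦ ∂ₙ φ|_{xₙ = 0}`, defined on the restrictions to `𝕋 × ℝⁿ₊` of functions in
`C_c^∞(𝕋 × ℝⁿ)`, with respect to the norm of the restricted space of order `(0,2)` and the norm
of `L²(𝕋 × ℝⁿ⁻¹)`. -/
def HasNeumannTrace (v : L2Half T d) (g : L2 T d) : Prop :=
  ∃ (φ : ℕ → Cyl T (d + 1) → ℂ) (Φ : ℕ → L2Half T d),
    (∀ j, IsTestFunction (φ j)) ∧
    (∀ j, Φ j =ᵐ[volume.restrict (upperHalf T d)] φ j) ∧
    Tendsto (fun j => halfSobolevNorm 0 2 (v - Φ j)) atTop (𝓝 0) ∧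
    Tendsto (fun j => eLpNorm (fun q => g q - normalDeriv (φ j) (boundaryPoint q)) 2 volume)
      atTop (𝓝 0)

/-- `u = (u₁, u₂)` solves `∂ₜ u₁ - Δ u₂ = f₁` and `Δ u₁ - ∂ₜ u₁ + u₂ = f₂` in the sense of
distributions on `𝕋 × ℝⁿ₊`, with `∂ₙ u₁ = g₁` and `∂ₙ u₂ = g₂` on the boundary in the sense of
traces. -/
structure IsSolution (u f : L2Half T d × L2Half T d) (g : L2 T d × L2 T d) : Prop where
  eq_one : ∀ φ : Cyl T (d + 1) → ℂ, IsHalfTestFunction φ →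
    ∫ p in upperHalf T d, (-(u.1 p * timeDeriv φ p) - u.2 p * spaceLaplacian φ p) =
      ∫ p in upperHalf T d, f.1 p * φ p
  eq_two : ∀ φ : Cyl T (d + 1) → ℂ, IsHalfTestFunction φ →
    ∫ p in upperHalf T d,
        (u.1 p * spaceLaplacian φ p + u.1 p * timeDeriv φ p + u.2 p * φ p) =
      ∫ p in upperHalf T d, f.2 p * φ p
  trace_one : HasNeumannTrace u.1 g.1
  trace_two : HasNeumannTrace u.2 g.2

variable (T d)

/-- The solution space `𝔼 = 𝔼₁ × 𝔼₂`. -/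
def solutionSpace : Submodule ℂ (L2Half T d × L2Half T d) :=
  (halfSobolevPerp T d 1 1 ⊓ halfSobolevPerp T d 0 3).prod (halfSobolevPerp T d 0 2)

/-- The space `𝔽 = 𝔽₁ × 𝔽₂` of right-hand sides. The first factor is `L²_⊥`. -/
def dataSpace : Submodule ℂ (L2Half T d × L2Half T d) :=
  (halfSobolevPerp T d 0 0).prod (halfSobolevPerp T d 0 1)

/-- The space `𝔾 = 𝔾₁ × 𝔾₂` of boundary data. -/
def traceSpace : Submodule ℂ (L2 T d × L2 T d) :=
  (sobolevPerp T d (3 / 4) 0 ⊓ sobolevPerp T d 0 (3 / 2)).prod (sobolevPerp T d 0 (1 / 2))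

variable {T d}

/-- The norm of `𝔼`. -/
def solutionNorm (u : L2Half T d × L2Half T d) : ℝ≥0∞ :=
  halfSobolevNorm 1 1 u.1 + halfSobolevNorm 0 3 u.1 + halfSobolevNorm 0 2 u.2

/-- The norm of `𝔽`. -/
def dataNorm (f : L2Half T d × L2Half T d) : ℝ≥0∞ :=
  halfSobolevNorm 0 0 f.1 + halfSobolevNorm 0 1 f.2

/-- The norm of `𝔾`. -/
def traceNorm (g : L2 T d × L2 T d) : ℝ≥0∞ :=
  sobolevNorm (3 / 4) 0 g.1 + sobolevNorm 0 (3 / 2) g.1 + sobolevNorm 0 (1 / 2) g.2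

end System

end CahnHilliardGurtin

end

open CahnHilliardGurtin

/-! The time-periodic Cahn–Hilliard–Gurtin system on the half space is solved frequency by
frequency. Fourier series in time, with Parseval's identity (`enorm_sq_eq_tsum_timeCoeff`) and its
converse (`exists_timeCoeff_eq`), turn the system into a family of resolvent problems `SolvesMode`
for the time coefficients (`isSolution_iff`). The purely oscillatory condition removes the
frequency zero, so that every frequency `τ` that occurs has `|τ| ≥ 2π/T`; all constants below are
uniform in such `τ`, which is what makes the summation over the frequencies possible.

For one frequency, the Neumann data are lifted to the half space (`exists_neumannLift`), which
reduces the problem to vanishing Neumann data. Functions with vanishing normal derivative on the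
boundary are exactly those whose even reflection `fold` has no singular part in its Laplacian
(`isMul_lap_fold`), so the reduced problem becomes a constant coefficient system on the whole space.
With `z = |ξ|²`, the determinant of its symbol is `chgDet`, namely `z² + iτ(1 + z)`. It does not
vanish for `τ ≠ 0`, and the lower bounds for `|τ| ≥ τ₀ > 0` (`norm_solve_le`) show that the inverse
symbol has exactly the mapping properties that the anisotropic spaces ask for
(`exists_wholeSpace_solution`). Reflecting a solution of the homogeneous problem evenly and dividing
by the determinant gives uniqueness (`SolvesMode.eq_zero`).

For the isomorphism the data of a given element of the solution space have to be estimated too.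
The trace theorem handles the spatial regularity, while the `3/4` derivatives in time of the
Neumann trace of the first component come from the interpolation between its normal derivatives of
low and high order (`norm_trace_pow_four_le`, `sobSq_trace_normalDeriv_le`); this is
`exists_data_of_mode`. Summing over the frequencies yields `exists_solution_bounded` and
`exists_data_bounded`, the two halves of the isomorphism. -/

noncomputable section

namespace CahnHilliardGurtin

/-! ### Square integrable functions -/

/-- The spatial factor `ℝᵐ`. -/
abbrev Eu (m : ℕ) : Type := EuclideanSpace ℝ (Fin m)

/-- Complex valued `L²(ℝᵐ)`. -/
abbrev SpaceL2 (m : ℕ) : Type := Lp ℂ 2 (volume : Measure (Eu m))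

theorem enorm_sq_eq_lintegral {α : Type*} [MeasurableSpace α] {μ : Measure α} (f : Lp ℂ 2 μ) :
    ‖f‖ₑ ^ 2 = ∫⁻ x, ‖f x‖ₑ ^ 2 ∂μ := by
  have h : ‖f‖ₑ = eLpNorm f 2 μ := by
    rw [Lp.enorm_def]
  rw [h, eLpNorm_eq_lintegral_rpow_enorm_toReal (by norm_num) (by norm_num), ← ENNReal.rpow_natCast,
    ← ENNReal.rpow_mul]
  norm_num

theorem memLp_two_iff_lintegral {α : Type*} [MeasurableSpace α] {μ : Measure α} {f : α → ℂ}
    (hf : AEStronglyMeasurable f μ) : MemLp f 2 μ ↔ ∫⁻ x, ‖f x‖ₑ ^ 2 ∂μ < ⊤ := by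
  have : ∫⁻ x, ‖f x‖ₑ ^ 2 ∂μ = ∫⁻ x, ‖f x‖ₑ ^ ((2 : ℝ≥0∞).toReal) ∂μ := by
    refine lintegral_congr fun x => ?_
    rw [← ENNReal.rpow_natCast]
    norm_num
  rw [this, ← eLpNorm_lt_top_iff_lintegral_rpow_enorm_lt_top (by norm_num) (by norm_num)]
  exact ⟨fun h => h.2, fun h => ⟨hf, h⟩⟩

theorem enorm_toLp_sq {α : Type*} [MeasurableSpace α] {μ : Measure α} {f : α → ℂ}
    (hf : MemLp f 2 μ) : ‖hf.toLp f‖ₑ ^ 2 = ∫⁻ x, ‖f x‖ₑ ^ 2 ∂μ := by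
  rw [enorm_sq_eq_lintegral]
  refine lintegral_congr_ae ?_
  filter_upwards [hf.coeFn_toLp] with x hx
  rw [hx]

/-! ### Fourier series in time -/

section TimeSeries

variable {T : ℝ} [Fact (0 < T)] {m : ℕ}

theorem volume_cyl_eq : (volume : Measure (Cyl T m)) = ENNReal.ofReal T •
    ((AddCircle.haarAddCircle (T := T)).prod (volume : Measure (Eu m))) := by
  rw [← Measure.prod_smul_left, ← AddCircle.volume_eq_smul_haarAddCircle]
  rfl

theorem lintegral_cyl {F : Cyl T m → ℝ≥0∞} (hF : AEMeasurable F) :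
    ∫⁻ p, F p = ENNReal.ofReal T *
      ∫⁻ x : Eu m, ∫⁻ t, F (t, x) ∂(AddCircle.haarAddCircle (T := T)) := by
  have hT : (0 : ℝ) < T := Fact.out
  rw [volume_cyl_eq, lintegral_smul_measure, smul_eq_mul, lintegral_prod_symm]
  rw [volume_cyl_eq] at hF
  refine hF.mono_ac (Measure.absolutelyContinuous_smul ?_)
  simp [hT]

theorem integral_cyl {F : Cyl T m → ℂ} (hF : Integrable F) :
    ∫ p, F p = T * ∫ x : Eu m, ∫ t, F (t, x) ∂(AddCircle.haarAddCircle (T := T)) := by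
  have hT : (0 : ℝ) < T := Fact.out
  rw [volume_cyl_eq] at hF ⊢
  have hF' : Integrable F ((AddCircle.haarAddCircle (T := T)).prod (volume : Measure (Eu m))) := by
    rwa [integrable_smul_measure (by simp [hT]) (by simp)] at hF
  rw [integral_smul_measure, integral_prod_symm _ hF', ENNReal.toReal_ofReal hT.le]
  simp [Complex.real_smul]

theorem lintegral_sq_eq_tsum_fourierCoeff {h : AddCircle T → ℂ}
    (hh : MemLp h 2 AddCircle.haarAddCircle) :
    ∫⁻ t, ‖h t‖ₑ ^ 2 ∂AddCircle.haarAddCircle = ∑' k : ℤ, ‖fourierCoeff h k‖ₑ ^ 2 := by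
  have h1 := hasSum_sq_fourierCoeff (hh.toLp h)
  have hc : ∀ k, fourierCoeff (hh.toLp h) k = fourierCoeff h k := fun k => by
    rw [fourierCoeff_congr_ae hh.coeFn_toLp]
  simp only [hc] at h1
  have h2 : ∫ t : AddCircle T, ‖(hh.toLp h) t‖ ^ 2 ∂AddCircle.haarAddCircle =
      ∫ t : AddCircle T, ‖h t‖ ^ 2 ∂AddCircle.haarAddCircle :=
    integral_congr_ae (by filter_upwards [hh.coeFn_toLp] with t ht; rw [ht])
  rw [h2] at h1
  have h3 := ofReal_integral_eq_lintegral_ofReal ((memLp_two_iff_integrable_sq_norm hh.1).1 hh)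
    (ae_of_all _ fun t => by positivity)
  have hsq : ∀ z : ℂ, ENNReal.ofReal (‖z‖ ^ 2) = ‖z‖ₑ ^ 2 := fun z => by
    rw [ENNReal.ofReal_pow (norm_nonneg _), ofReal_norm]
  simp only [hsq] at h3
  rw [← h3, ← h1.tsum_eq, ENNReal.ofReal_tsum_of_nonneg (fun _ => by positivity) h1.summable]
  simp only [hsq]

theorem coeFn_timeCoeff (k : ℤ) (f : L2 T m) :
    timeCoeff k f =ᵐ[volume] fun x => fourierCoeff (fun t : AddCircle T => f (t, x)) k :=
  (memLp_fourierCoeff (Lp.memLp f) k).coeFn_toLp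

/-- Parseval's identity in time. -/
theorem enorm_sq_eq_tsum_timeCoeff (f : L2 T m) :
    ‖f‖ₑ ^ 2 = ENNReal.ofReal T * ∑' k : ℤ, ‖timeCoeff k f‖ₑ ^ 2 := by
  rw [enorm_sq_eq_lintegral, lintegral_cyl ((Lp.aestronglyMeasurable f).enorm.pow_const 2)]
  congr 1
  simp only [enorm_sq_eq_lintegral]
  rw [← lintegral_tsum fun k => (Lp.aestronglyMeasurable _).enorm.pow_const 2]
  refine lintegral_congr_ae ?_
  filter_upwards [ae_memLp_slice (Lp.memLp f), ae_all_iff.2 fun k => coeFn_timeCoeff k f]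
    with x hx hk
  rw [lintegral_sq_eq_tsum_fourierCoeff hx]
  simp only [hk]

theorem timeCoeff_injective {f g : L2 T m} (h : ∀ k, timeCoeff k f = timeCoeff k g) : f = g := by
  have h1 := enorm_sq_eq_tsum_timeCoeff (f - g)
  simp only [map_sub, h, sub_self] at h1
  simpa [sub_eq_zero] using h1

theorem enorm_timeCoeff_sq_le (k : ℤ) (f : L2 T m) :
    ENNReal.ofReal T * ‖timeCoeff k f‖ₑ ^ 2 ≤ ‖f‖ₑ ^ 2 := by
  rw [enorm_sq_eq_tsum_timeCoeff]
  gcongr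
  exact ENNReal.le_tsum (f := fun k => ‖timeCoeff k f‖ₑ ^ 2) k

theorem continuous_timeCoeff (k : ℤ) : Continuous (timeCoeff k : L2 T m → SpaceL2 m) := by
  have hT : (0 : ℝ) < T := Fact.out
  have hs : 0 < Real.sqrt T := Real.sqrt_pos.2 hT
  refine AddMonoidHomClass.continuous_of_bound (timeCoeff k : L2 T m →ₗ[ℂ] SpaceL2 m)
    (Real.sqrt T)⁻¹ fun f => ?_
  have h := enorm_timeCoeff_sq_le k f
  rw [← ofReal_norm, ← ofReal_norm, ← ENNReal.ofReal_pow (norm_nonneg _),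
    ← ENNReal.ofReal_pow (norm_nonneg _), ← ENNReal.ofReal_mul hT.le,
    ENNReal.ofReal_le_ofReal_iff (by positivity)] at h
  rw [inv_mul_eq_div, le_div_iff₀ hs]
  refine le_of_sq_le_sq ?_ (norm_nonneg _)
  rw [mul_pow, Real.sq_sqrt hT.le]
  linarith

theorem memLp_mode (k : ℤ) (h : SpaceL2 m) :
    MemLp (fun p : Cyl T m => fourier k p.1 * h p.2) 2 volume := by
  have hm : AEStronglyMeasurable (fun p : Cyl T m => fourier k p.1 * h p.2) volume :=
    ((fourier (T := T) k).continuous.comp continuous_fst).aestronglyMeasurable.mul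
      (Lp.aestronglyMeasurable h).comp_snd
  rw [memLp_two_iff_lintegral hm, lintegral_cyl (hm.enorm.pow_const 2)]
  have h1 : ∀ (t : AddCircle T) (x : Eu m), ‖fourier k t * h x‖ₑ ^ 2 = ‖h x‖ₑ ^ 2 := fun t x => by
    rw [enorm_mul, ← ofReal_norm, fourier_apply, Circle.norm_coe, ENNReal.ofReal_one, one_mul]
  simp only [h1, lintegral_const, measure_univ, mul_one]
  rw [← enorm_sq_eq_lintegral]
  exact ENNReal.mul_lt_top (by simp) (ENNReal.pow_lt_top enorm_lt_top)

/-- The function `(t, x) ↦ e^{2πikt/T} h(x)`, as a linear map `L²(ℝᵐ) → L²(𝕋 × ℝᵐ)`. -/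
def mode (k : ℤ) : SpaceL2 m →ₗ[ℂ] L2 T m where
  toFun h := (memLp_mode k h).toLp _
  map_add' a b := by
    rw [← MemLp.toLp_add]
    refine MemLp.toLp_congr _ _ ?_
    have := (Measure.quasiMeasurePreserving_snd (μ := (volume : Measure (AddCircle T)))
      (ν := (volume : Measure (Eu m)))).ae (Lp.coeFn_add a b)
    filter_upwards [this] with p hp
    rw [Pi.add_apply, hp, Pi.add_apply, mul_add]
  map_smul' c a := by
    rw [RingHom.id_apply, ← MemLp.toLp_const_smul]
    refine MemLp.toLp_congr _ _ ?_
    have := (Measure.quasiMeasurePreserving_snd (μ := (volume : Measure (AddCircle T)))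
      (ν := (volume : Measure (Eu m)))).ae (Lp.coeFn_smul c a)
    filter_upwards [this] with p hp
    rw [Pi.smul_apply, hp, Pi.smul_apply, smul_eq_mul, smul_eq_mul]
    ring

theorem coeFn_mode (k : ℤ) (h : SpaceL2 m) :
    mode (T := T) k h =ᵐ[volume] fun p : Cyl T m => fourier k p.1 * h p.2 :=
  (memLp_mode k h).coeFn_toLp

theorem timeCoeff_mode (j k : ℤ) (h : SpaceL2 m) :
    timeCoeff j (mode (T := T) k h) = if j = k then h else 0 := by
  refine Lp.ext ?_
  have h1 : ∀ᵐ x, timeCoeff j (mode (T := T) k h) x = (if j = k then (1 : ℂ) else 0) * h x := by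
    filter_upwards [coeFn_timeCoeff j (mode (T := T) k h), ae_slice (coeFn_mode (T := T) k h)]
      with x hx hx'
    rw [hx, fourierCoeff_congr_ae hx']
    have : (fun t : AddCircle T => fourier k t * h x) = fun t => (fourier k t : ℂ) * h x := rfl
    have h2 : fourierCoeff (fun t : AddCircle T => fourier k t * h x) j =
        fourierCoeff (fourier k : AddCircle T → ℂ) j * h x := by
      rw [mul_comm, ← smul_eq_mul, ← fourierCoeff.const_smul]
      congr 1
      ext t
      simp [mul_comm]
    rw [h2, fourierCoeff_fourier]
    simp [Pi.single_apply]
  filter_upwards [h1, Lp.coeFn_zero ℂ 2 (volume : Measure (Eu m))] with x hx h0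
  rw [hx]
  split_ifs
  · simp
  · rw [h0]; simp

theorem enorm_mode_sq (k : ℤ) (h : SpaceL2 m) :
    ‖mode (T := T) k h‖ₑ ^ 2 = ENNReal.ofReal T * ‖h‖ₑ ^ 2 := by
  rw [enorm_sq_eq_tsum_timeCoeff, tsum_eq_single k]
  · simp [timeCoeff_mode]
  · intro j hj
    simp [timeCoeff_mode, hj]

theorem norm_mode (k : ℤ) (h : SpaceL2 m) : ‖mode (T := T) k h‖ = Real.sqrt T * ‖h‖ := by
  have hT : (0 : ℝ) < T := Fact.out
  have h1 := enorm_mode_sq (T := T) k h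
  rw [← ofReal_norm, ← ofReal_norm, ← ENNReal.ofReal_pow (norm_nonneg _),
    ← ENNReal.ofReal_pow (norm_nonneg _), ← ENNReal.ofReal_mul hT.le,
    ENNReal.ofReal_eq_ofReal_iff (by positivity) (by positivity)] at h1
  rw [← sq_eq_sq₀ (norm_nonneg _) (by positivity), mul_pow, Real.sq_sqrt hT.le, h1]

theorem inner_mode_of_ne {j k : ℤ} (hjk : j ≠ k) (a b : SpaceL2 m) :
    inner ℂ (mode (T := T) j a) (mode (T := T) k b) = 0 := by
  -- Pythagoras for `mode j a + c • mode k b` with `c = 1, i`, both sides by Parseval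
  have key : ∀ a b : SpaceL2 m, RCLike.re (inner ℂ (mode (T := T) j a) (mode (T := T) k b)) = 0 := by
    intro a b
    have hT : (0 : ℝ) < T := Fact.out
    have h1 : ‖mode (T := T) j a + mode (T := T) k b‖ₑ ^ 2
        = ENNReal.ofReal T * (‖a‖ₑ ^ 2 + ‖b‖ₑ ^ 2) := by
      rw [enorm_sq_eq_tsum_timeCoeff, tsum_eq_sum (s := {j, k})]
      · rw [Finset.sum_pair hjk]
        simp [timeCoeff_mode, hjk, hjk.symm]
      · intro l hl
        simp only [Finset.mem_insert, Finset.mem_singleton, not_or] at hl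
        simp [timeCoeff_mode, hl.1, hl.2]
    rw [← ofReal_norm, ← ofReal_norm, ← ofReal_norm, ← ENNReal.ofReal_pow (norm_nonneg _),
      ← ENNReal.ofReal_pow (norm_nonneg _), ← ENNReal.ofReal_pow (norm_nonneg _),
      ← ENNReal.ofReal_add (by positivity) (by positivity), ← ENNReal.ofReal_mul hT.le,
      ENNReal.ofReal_eq_ofReal_iff (by positivity) (by positivity),
      @norm_add_sq ℂ, norm_mode, norm_mode, mul_pow, mul_pow, Real.sq_sqrt hT.le] at h1
    linarith
  have h1 := key a b
  have h2 := key a (Complex.I • b)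
  rw [map_smul, inner_smul_right] at h2
  apply Complex.ext
  · simpa using h1
  · simpa using h2

/-- The Riesz–Fischer theorem in time: every square summable sequence in `L²(ℝᵐ)` is the sequence
of Fourier coefficients of a function in `L²(𝕋 × ℝᵐ)`. -/
theorem exists_timeCoeff_eq (h : ℤ → SpaceL2 m) (hs : ∑' k, ‖h k‖ₑ ^ 2 ≠ ⊤) :
    ∃ f : L2 T m, (∀ k, timeCoeff k f = h k) ∧ HasSum (fun k => mode k (h k)) f := by
  have hT : (0 : ℝ) < T := Fact.out
  have hs0 : 0 < Real.sqrt T := Real.sqrt_pos.2 hT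
  -- the modes, normalized, are isometries with mutually orthogonal ranges
  let V : ∀ _ : ℤ, SpaceL2 m →ₗᵢ[ℂ] L2 T m := fun k =>
    { toLinearMap := ((Real.sqrt T : ℂ)⁻¹) • mode k
      norm_map' := fun a => by
        rw [LinearMap.smul_apply, norm_smul, norm_mode, norm_inv, Complex.norm_real,
          Real.norm_of_nonneg hs0.le, inv_mul_cancel_left₀ hs0.ne'] }
  have hV : OrthogonalFamily ℂ (fun _ : ℤ => SpaceL2 m) V := by
    intro j k hjk a b
    change inner ℂ (((Real.sqrt T : ℂ)⁻¹) • mode j a) (((Real.sqrt T : ℂ)⁻¹) • mode k b) = 0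
    rw [inner_smul_left, inner_smul_right, inner_mode_of_ne hjk]
    simp
  have hsum : Summable fun k => ‖h k‖ ^ 2 := by
    have : ∀ k, ‖h k‖ₑ ^ 2 = ENNReal.ofReal (‖h k‖ ^ 2) := fun k => by
      rw [ENNReal.ofReal_pow (norm_nonneg _), ofReal_norm]
    simp only [this] at hs
    have h2 := ENNReal.summable_toReal hs
    simpa [ENNReal.toReal_ofReal, sq_nonneg] using h2
  have hsum2 : Summable fun k => mode (T := T) k (h k) := by
    have h1 := ((hV.summable_iff_norm_sq_summable h).2 hsum).const_smul (Real.sqrt T : ℂ)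
    refine h1.congr fun k => ?_
    change (Real.sqrt T : ℂ) • ((Real.sqrt T : ℂ)⁻¹ • mode k (h k)) = _
    rw [smul_inv_smul₀]
    exact_mod_cast hs0.ne'
  refine ⟨∑' k, mode k (h k), fun k => ?_, hsum2.hasSum⟩
  have h1 := hsum2.hasSum.map (timeCoeff (T := T) k) (continuous_timeCoeff k)
  refine h1.unique ?_
  have : (fun j => timeCoeff (T := T) k (mode j (h j))) = fun j => if j = k then h k else 0 := by
    ext1 j
    rw [timeCoeff_mode]
    by_cases hjk : j = k
    · simp [hjk]
    · simp [hjk, Ne.symm hjk]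
  change HasSum (fun j => timeCoeff (T := T) k (mode j (h j))) (h k)
  rw [this]
  exact hasSum_ite_eq k (h k)

theorem hasSum_mode_timeCoeff (f : L2 T m) : HasSum (fun k => mode k (timeCoeff k f)) f := by
  have hT : (0 : ℝ) < T := Fact.out
  have hs : ∑' k, ‖timeCoeff k f‖ₑ ^ 2 ≠ ⊤ := by
    intro h
    have h1 := enorm_sq_eq_tsum_timeCoeff f
    rw [h, ENNReal.mul_top (by simp [hT])] at h1
    exact (ENNReal.pow_lt_top enorm_lt_top).ne h1
  obtain ⟨g, hg, hsum⟩ := exists_timeCoeff_eq (T := T) (fun k => timeCoeff k f) hs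
  rwa [timeCoeff_injective hg] at hsum

end TimeSeries

open scoped SchwartzMap LineDeriv Laplacian
open SchwartzMap

/-! ### Fourier multipliers and Sobolev norms in space -/

section Multipliers

variable {m : ℕ}

/-- The weight `1 + |2πξ|²`; the variable `ξ` of `𝓕` belongs to the angular frequency `2πξ`. -/
def jap (ξ : Eu m) : ℝ := 1 + ‖(2 * Real.pi) • ξ‖ ^ 2

theorem one_le_jap (ξ : Eu m) : 1 ≤ jap ξ := by
  unfold jap
  have := sq_nonneg ‖(2 * Real.pi) • ξ‖
  linarith

theorem jap_pos (ξ : Eu m) : 0 < jap ξ := one_pos.trans_le (one_le_jap ξ)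

@[fun_prop]
theorem continuous_jap : Continuous (jap : Eu m → ℝ) := by
  unfold jap
  fun_prop

@[fun_prop]
theorem measurable_jap : Measurable (jap : Eu m → ℝ) := continuous_jap.measurable

/-- The square of the norm of `Hʳ(ℝᵐ)`. -/
def sobSq (r : ℝ) (a : SpaceL2 m) : ℝ≥0∞ :=
  ∫⁻ ξ : Eu m, ENNReal.ofReal (jap ξ ^ r) * ‖(𝓕 a : SpaceL2 m) ξ‖ₑ ^ 2

theorem sobSq_zero_order (a : SpaceL2 m) : sobSq 0 a = ‖a‖ₑ ^ 2 := by
  have : ‖a‖ₑ = ‖(𝓕 a : SpaceL2 m)‖ₑ := by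
    rw [← ofReal_norm, ← ofReal_norm, Lp.norm_fourier_eq]
  rw [this, enorm_sq_eq_lintegral]
  unfold sobSq
  simp

theorem sobSq_mono {r s : ℝ} (h : r ≤ s) (a : SpaceL2 m) : sobSq r a ≤ sobSq s a := by
  unfold sobSq
  gcongr with ξ
  exact one_le_jap ξ

theorem enorm_sq_le_sobSq {r : ℝ} (h : 0 ≤ r) (a : SpaceL2 m) : ‖a‖ₑ ^ 2 ≤ sobSq r a :=
  (sobSq_zero_order a).symm.le.trans (sobSq_mono h a)

/-- `b` is the image of `a` under the Fourier multiplier with symbol `μ`. -/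
def IsMul (μ : Eu m → ℂ) (a b : SpaceL2 m) : Prop :=
  (𝓕 b : SpaceL2 m) =ᵐ[volume] fun ξ => μ ξ * (𝓕 a : SpaceL2 m) ξ

theorem fourier_injective {a b : SpaceL2 m} (h : (𝓕 a : SpaceL2 m) = 𝓕 b) : a = b :=
  (Lp.fourierTransformₗᵢ (Eu m) ℂ).injective h

theorem coeFn_fourier_add (a b : SpaceL2 m) :
    (𝓕 (a + b) : SpaceL2 m) =ᵐ[volume] fun ξ => (𝓕 a : SpaceL2 m) ξ + (𝓕 b : SpaceL2 m) ξ := by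
  rw [FourierTransform.fourier_add]
  exact Lp.coeFn_add _ _

theorem coeFn_fourier_smul (c : ℂ) (a : SpaceL2 m) :
    (𝓕 (c • a) : SpaceL2 m) =ᵐ[volume] fun ξ => c * (𝓕 a : SpaceL2 m) ξ := by
  rw [FourierTransform.fourier_smul]
  exact Lp.coeFn_smul _ _

theorem coeFn_fourier_sub (a b : SpaceL2 m) :
    (𝓕 (a - b) : SpaceL2 m) =ᵐ[volume] fun ξ => (𝓕 a : SpaceL2 m) ξ - (𝓕 b : SpaceL2 m) ξ := by
  have : (𝓕 (a - b) : SpaceL2 m) = 𝓕 a - 𝓕 b := (Lp.fourierTransformₗᵢ (Eu m) ℂ).map_sub a b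
  rw [this]
  exact Lp.coeFn_sub _ _

theorem coeFn_fourier_zero : (𝓕 (0 : SpaceL2 m) : SpaceL2 m) =ᵐ[volume] fun _ => 0 := by
  have : (𝓕 (0 : SpaceL2 m) : SpaceL2 m) = 0 := (Lp.fourierTransformₗᵢ (Eu m) ℂ).map_zero
  rw [this]
  exact Lp.coeFn_zero _ _ _

/-- Every square integrable function is a Fourier transform. -/
theorem exists_fourier_ae_eq {H : Eu m → ℂ} (hH : AEStronglyMeasurable H)
    (h : ∫⁻ ξ, ‖H ξ‖ₑ ^ 2 < ⊤) : ∃ b : SpaceL2 m, (𝓕 b : SpaceL2 m) =ᵐ[volume] H := by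
  have hm := (memLp_two_iff_lintegral hH).2 h
  refine ⟨(Lp.fourierTransformₗᵢ (Eu m) ℂ).symm (hm.toLp H), ?_⟩
  have : (𝓕 ((Lp.fourierTransformₗᵢ (Eu m) ℂ).symm (hm.toLp H)) : SpaceL2 m) = hm.toLp H :=
    (Lp.fourierTransformₗᵢ (Eu m) ℂ).apply_symm_apply _
  rw [this]
  exact hm.coeFn_toLp

namespace IsMul

variable {μ ν : Eu m → ℂ} {a b c a' b' : SpaceL2 m}

theorem unique (h : IsMul μ a b) (h' : IsMul μ a b') : b = b' :=
  fourier_injective (Lp.ext (h.trans h'.symm))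

theorem add (h : IsMul μ a b) (h' : IsMul μ a' b') : IsMul μ (a + a') (b + b') := by
  unfold IsMul at *
  filter_upwards [h, h', coeFn_fourier_add a a', coeFn_fourier_add b b'] with ξ h1 h2 h3 h4
  rw [h3, h4, h1, h2]
  ring

theorem sub (h : IsMul μ a b) (h' : IsMul μ a' b') : IsMul μ (a - a') (b - b') := by
  unfold IsMul at *
  filter_upwards [h, h', coeFn_fourier_sub a a', coeFn_fourier_sub b b'] with ξ h1 h2 h3 h4
  rw [h3, h4, h1, h2]
  ring

theorem smul (z : ℂ) (h : IsMul μ a b) : IsMul μ (z • a) (z • b) := by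
  unfold IsMul at *
  filter_upwards [h, coeFn_fourier_smul z a, coeFn_fourier_smul z b] with ξ h1 h2 h3
  rw [h2, h3, h1]
  ring

theorem zero : IsMul μ (0 : SpaceL2 m) 0 := by
  unfold IsMul
  filter_upwards [coeFn_fourier_zero (m := m)] with ξ h
  rw [h, mul_zero]

theorem comp (h : IsMul μ a b) (h' : IsMul ν b c) : IsMul (fun ξ => ν ξ * μ ξ) a c := by
  unfold IsMul at *
  filter_upwards [h, h'] with ξ h1 h2
  rw [h2, h1, mul_assoc]

/-- A multiplier whose symbol is dominated by `J^{(r-s)/2}` maps `Hʳ` to `Hˢ`. -/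
theorem sobSq_le {r s C : ℝ} (hC : 0 ≤ C) (h : IsMul μ a b)
    (hμ : ∀ ξ, jap ξ ^ s * ‖μ ξ‖ ^ 2 ≤ C * jap ξ ^ r) :
    sobSq s b ≤ ENNReal.ofReal C * sobSq r a := by
  unfold sobSq
  rw [← lintegral_const_mul' _ _ ENNReal.ofReal_ne_top]
  refine lintegral_mono_ae ?_
  filter_upwards [h] with ξ hξ
  rw [hξ, enorm_mul, mul_pow, ← mul_assoc, ← mul_assoc]
  gcongr ?_ * _
  rw [← ofReal_norm (μ ξ), ← ENNReal.ofReal_pow (norm_nonneg _),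
    ← ENNReal.ofReal_mul (Real.rpow_nonneg (jap_pos ξ).le _), ← ENNReal.ofReal_mul hC]
  exact ENNReal.ofReal_le_ofReal (hμ ξ)

end IsMul

theorem exists_isMul {μ : Eu m → ℂ} (hm : Measurable μ) {r C : ℝ} (hC : 0 ≤ C) {a : SpaceL2 m}
    (hμ : ∀ ξ, ‖μ ξ‖ ^ 2 ≤ C * jap ξ ^ r) (ha : sobSq r a < ⊤) : ∃ b, IsMul μ a b := by
  refine exists_fourier_ae_eq (hm.aestronglyMeasurable.mul (Lp.aestronglyMeasurable _)) ?_
  have : ∫⁻ ξ, ‖μ ξ * (𝓕 a : SpaceL2 m) ξ‖ₑ ^ 2 ≤ ENNReal.ofReal C * sobSq r a := by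
    unfold sobSq
    rw [← lintegral_const_mul' _ _ ENNReal.ofReal_ne_top]
    refine lintegral_mono fun ξ => ?_
    rw [enorm_mul, mul_pow, ← mul_assoc]
    gcongr
    rw [← ofReal_norm (μ ξ), ← ENNReal.ofReal_pow (norm_nonneg _), ← ENNReal.ofReal_mul hC]
    exact ENNReal.ofReal_le_ofReal (hμ ξ)
  exact this.trans_lt (ENNReal.mul_lt_top ENNReal.ofReal_lt_top ha)

theorem sobSq_add_le (r : ℝ) (a b : SpaceL2 m) :
    sobSq r (a + b) ≤ 2 * (sobSq r a + sobSq r b) := by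
  unfold sobSq
  have hF : ∀ h : SpaceL2 m, AEMeasurable (fun ξ : Eu m =>
      ENNReal.ofReal (jap ξ ^ r) * ‖(𝓕 h : SpaceL2 m) ξ‖ₑ ^ 2) := fun h =>
    (by fun_prop : Measurable fun ξ : Eu m => ENNReal.ofReal (jap ξ ^ r)).aemeasurable.mul
      ((Lp.aestronglyMeasurable _).enorm.pow_const 2)
  rw [← lintegral_add_left' (hF a), ← lintegral_const_mul' _ _ (by norm_num)]
  refine lintegral_mono_ae ?_
  filter_upwards [coeFn_fourier_add a b] with ξ hξ
  rw [hξ, ← mul_add, mul_left_comm]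
  gcongr
  have hsq : ∀ a b : ℝ≥0∞, (a + b) ^ 2 ≤ 2 * (a ^ 2 + b ^ 2) := fun a b => by
    have := ENNReal.rpow_add_le_mul_rpow_add_rpow a b (p := 2) (by norm_num)
    norm_num at this
    exact_mod_cast this
  refine le_trans ?_ (hsq _ _)
  gcongr
  exact enorm_add_le _ _

theorem sobSq_smul (r : ℝ) (c : ℂ) (a : SpaceL2 m) : sobSq r (c • a) = ‖c‖ₑ ^ 2 * sobSq r a := by
  unfold sobSq
  rw [← lintegral_const_mul' _ _ (ENNReal.pow_ne_top enorm_ne_top)]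
  refine lintegral_congr_ae ?_
  filter_upwards [coeFn_fourier_smul c a] with ξ hξ
  rw [hξ, enorm_mul, mul_pow, mul_left_comm]

theorem sobSq_sub_le (r : ℝ) (a b : SpaceL2 m) :
    sobSq r (a - b) ≤ 2 * (sobSq r a + sobSq r b) := by
  have h := sobSq_add_le r a ((-1 : ℂ) • b)
  rwa [sobSq_smul, neg_one_smul, ← sub_eq_add_neg, enorm_neg, enorm_one, one_pow, one_mul] at h

theorem sobSq_zero (r : ℝ) : sobSq r (0 : SpaceL2 m) = 0 := by
  have := sobSq_smul r 0 (0 : SpaceL2 m)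
  simpa using this

end Multipliers

/-! ### Multipliers as weak derivatives -/

section WeakDerivatives

variable {m : ℕ}

/-- A Schwartz function as an element of `L²(ℝᵐ)`. -/
abbrev toL2 (φ : 𝓢(Eu m, ℂ)) : SpaceL2 m := φ.toLp 2

theorem coeFn_toL2 (φ : 𝓢(Eu m, ℂ)) : toL2 φ =ᵐ[volume] φ := φ.coeFn_toLp 2

theorem toL2_sub (φ ψ : 𝓢(Eu m, ℂ)) : toL2 (φ - ψ) = toL2 φ - toL2 ψ :=
  (SchwartzMap.toLpCLM ℂ ℂ 2 (volume : Measure (Eu m))).map_sub φ ψ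

theorem fourier_toL2 (φ : 𝓢(Eu m, ℂ)) : (𝓕 (toL2 φ) : SpaceL2 m) = toL2 (𝓕 φ) :=
  SchwartzMap.toLp_fourier_eq φ

/-- The symbol of the derivative in direction `v`. -/
def derivSymbol (v ξ : Eu m) : ℂ := 2 * Real.pi * Complex.I * (inner ℝ ξ v : ℝ)

/-- The symbol of the Laplacian. -/
def lapSymbol (ξ : Eu m) : ℂ := -((‖(2 * Real.pi) • ξ‖ ^ 2 : ℝ) : ℂ)

theorem derivSymbol_hasTemperateGrowth (v : Eu m) : (derivSymbol v).HasTemperateGrowth := by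
  unfold derivSymbol
  fun_prop

theorem lapSymbol_hasTemperateGrowth : (lapSymbol (m := m)).HasTemperateGrowth := by
  unfold lapSymbol
  simp only [norm_smul, mul_pow, Complex.ofReal_mul]
  fun_prop

theorem fourierInv_lineDeriv_apply (φ : 𝓢(Eu m, ℂ)) (v ξ : Eu m) :
    (𝓕⁻ (∂_{v} φ) : 𝓢(Eu m, ℂ)) ξ = -derivSymbol v ξ * (𝓕⁻ φ : 𝓢(Eu m, ℂ)) ξ := by
  have : (inner ℝ · v).HasTemperateGrowth := ((innerSL ℝ (E := Eu m)).flip v).hasTemperateGrowth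
  rw [fourierInv_lineDerivOp_eq, derivSymbol]
  simp [this]
  ring

theorem fourier_lineDeriv_apply (φ : 𝓢(Eu m, ℂ)) (v ξ : Eu m) :
    (𝓕 (∂_{v} φ) : 𝓢(Eu m, ℂ)) ξ = derivSymbol v ξ * (𝓕 φ : 𝓢(Eu m, ℂ)) ξ := by
  have : (inner ℝ · v).HasTemperateGrowth := ((innerSL ℝ (E := Eu m)).flip v).hasTemperateGrowth
  rw [fourier_lineDerivOp_eq, derivSymbol]
  simp [this]
  ring

/-- The Laplacian is the sum of the second partial derivatives, on the level of symbols. -/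
theorem sum_derivSymbol_sq (ξ : Eu m) :
    ∑ i, derivSymbol (EuclideanSpace.single i 1) ξ ^ 2 = lapSymbol ξ := by
  have h1 : ∀ i, derivSymbol (EuclideanSpace.single i 1) ξ ^ 2
      = -((2 * Real.pi) ^ 2 * (ξ i) ^ 2 : ℝ) := fun i => by
    rw [derivSymbol, EuclideanSpace.inner_single_right, mul_pow, mul_pow, Complex.I_sq]
    push_cast
    simp
  simp only [h1]
  rw [lapSymbol, norm_smul, mul_pow (‖2 * Real.pi‖), EuclideanSpace.norm_sq_eq]
  simp only [Finset.sum_neg_distrib, Real.norm_eq_abs, sq_abs]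
  rw [Finset.mul_sum]
  push_cast
  rfl

theorem laplacian_eq_sum_single (φ : 𝓢(Eu m, ℂ)) :
    Δ φ = ∑ i, ∂_{(EuclideanSpace.single i 1 : Eu m)} (∂_{(EuclideanSpace.single i 1 : Eu m)} φ) := by
  rw [SchwartzMap.laplacian_eq_sum (EuclideanSpace.basisFun (Fin m) ℝ)]
  simp

theorem fourierInv_laplacian_apply (φ : 𝓢(Eu m, ℂ)) (ξ : Eu m) :
    (𝓕⁻ (Δ φ) : 𝓢(Eu m, ℂ)) ξ = lapSymbol ξ * (𝓕⁻ φ : 𝓢(Eu m, ℂ)) ξ := by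
  have h : ((𝓕⁻ (Δ φ) : 𝓢(Eu m, ℂ))) = ∑ i, (𝓕⁻ (∂_{(EuclideanSpace.single i 1 : Eu m)}
      (∂_{(EuclideanSpace.single i 1 : Eu m)} φ)) : 𝓢(Eu m, ℂ)) := by
    rw [laplacian_eq_sum_single]
    exact map_sum (FourierTransform.fourierInvCLM ℂ 𝓢(Eu m, ℂ)) _ _
  rw [h, ← sum_derivSymbol_sq, Finset.sum_mul, _root_.sum_apply]
  refine Finset.sum_congr rfl fun i _ => ?_
  rw [fourierInv_lineDeriv_apply, fourierInv_lineDeriv_apply]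
  ring

/-- The transposition rule of the Fourier transform for `a ∈ L²`. -/
theorem integral_mul_fourier (a : SpaceL2 m) (φ : 𝓢(Eu m, ℂ)) :
    ∫ ξ, φ ξ * (𝓕 a : SpaceL2 m) ξ = ∫ x, (𝓕 φ : 𝓢(Eu m, ℂ)) x * a x := by
  have h := congrArg (fun S : 𝓢'(Eu m, ℂ) => S φ) (Lp.fourier_toTemperedDistribution_eq a)
  simp only [TemperedDistribution.fourier_apply, Lp.toTemperedDistribution_apply] at h
  simpa using h.symm

theorem integrable_schwartz_mul (φ : 𝓢(Eu m, ℂ)) (a : SpaceL2 m) :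
    Integrable fun x => φ x * a x :=
  (φ.memLp 2).integrable_mul (Lp.memLp a)

/-- Multipliers with a symbol of temperate growth in terms of test functions: `Q` is the transposed
operator. -/
theorem IsMul.integral_eq {p : Eu m → ℂ} {Q : 𝓢(Eu m, ℂ) → 𝓢(Eu m, ℂ)}
    (hQ : ∀ φ ξ, (𝓕⁻ (Q φ) : 𝓢(Eu m, ℂ)) ξ = p ξ * (𝓕⁻ φ : 𝓢(Eu m, ℂ)) ξ)
    {a b : SpaceL2 m} (h : IsMul p a b) (φ : 𝓢(Eu m, ℂ)) :
    ∫ x, φ x * b x = ∫ x, Q φ x * a x := by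
  have h1 : φ = 𝓕 (𝓕⁻ φ) := (FourierTransform.fourier_fourierInv_eq φ).symm
  have h2 : Q φ = 𝓕 (𝓕⁻ (Q φ)) := (FourierTransform.fourier_fourierInv_eq _).symm
  rw [h2]
  conv_lhs => rw [h1]
  rw [← integral_mul_fourier, ← integral_mul_fourier]
  refine integral_congr_ae ?_
  filter_upwards [h] with ξ hξ
  rw [hξ, hQ]
  ring

theorem IsMul.of_integral_eq {p : Eu m → ℂ} (hp : p.HasTemperateGrowth)
    {Q : 𝓢(Eu m, ℂ) → 𝓢(Eu m, ℂ)}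
    (hQ : ∀ φ ξ, (𝓕⁻ (Q φ) : 𝓢(Eu m, ℂ)) ξ = p ξ * (𝓕⁻ φ : 𝓢(Eu m, ℂ)) ξ)
    {a b : SpaceL2 m} (h : ∀ φ : 𝓢(Eu m, ℂ), ∫ x, φ x * b x = ∫ x, Q φ x * a x) :
    IsMul p a b := by
  have hloc : LocallyIntegrable (fun ξ => (𝓕 b : SpaceL2 m) ξ - p ξ * (𝓕 a : SpaceL2 m) ξ) := by
    have hb := (Lp.memLp (𝓕 b : SpaceL2 m)).locallyIntegrable (by norm_num)
    have ha := (Lp.memLp (𝓕 a : SpaceL2 m)).locallyIntegrable (by norm_num)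
    refine hb.sub ?_
    have := locallyIntegrableOn_univ.2 ha
    have h2 := this.continuousOn_mul (hp.1.continuous.continuousOn) isOpen_univ.isLocallyClosed
    exact locallyIntegrableOn_univ.1 h2
  -- test the hypothesis with the Fourier transform of `g ∈ C_c^∞`
  have h0 := ae_eq_zero_of_integral_contDiff_smul_eq_zero hloc fun g hg hgs => ?_
  · filter_upwards [h0] with ξ hξ
    exact sub_eq_zero.1 hξ
  · let ψ : 𝓢(Eu m, ℂ) := HasCompactSupport.toSchwartzMap (f := fun x => (g x : ℂ))
      (hgs.comp_left (g := fun y : ℝ => (y : ℂ)) rfl) (Complex.ofRealCLM.contDiff.comp hg)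
    have hψ : ∀ ξ, ψ ξ = g ξ := fun ξ => rfl
    have h1 := h (𝓕 ψ)
    rw [← integral_mul_fourier] at h1
    have h2 : Q (𝓕 ψ) = 𝓕 (𝓕⁻ (Q (𝓕 ψ))) := (FourierTransform.fourier_fourierInv_eq _).symm
    rw [h2, ← integral_mul_fourier] at h1
    simp only [hQ, FourierTransform.fourierInv_fourier_eq] at h1
    have h3 : ∀ ξ, g ξ • ((𝓕 b : SpaceL2 m) ξ - p ξ * (𝓕 a : SpaceL2 m) ξ) =
        ψ ξ * (𝓕 b : SpaceL2 m) ξ - p ξ * ψ ξ * (𝓕 a : SpaceL2 m) ξ := fun ξ => by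
      rw [hψ, Complex.real_smul]
      ring
    simp only [h3]
    have hi : Integrable fun ξ => p ξ * ψ ξ * (𝓕 a : SpaceL2 m) ξ := by
      refine (integrable_schwartz_mul (smulLeftCLM ℂ p ψ) (𝓕 a)).congr (ae_of_all _ fun ξ => ?_)
      simp [smulLeftCLM_apply_apply hp]
    rw [integral_sub (integrable_schwartz_mul ψ _) hi, h1, sub_self]

/-- `b` is the derivative of `a` in direction `v`, in the sense of distributions. -/
theorem isMul_derivSymbol_iff {a b : SpaceL2 m} {v : Eu m} : IsMul (derivSymbol v) a b ↔
    ∀ φ : 𝓢(Eu m, ℂ), ∫ x, φ x * b x = -∫ x, (∂_{v} φ) x * a x := by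
  have hQ : ∀ (φ : 𝓢(Eu m, ℂ)) (ξ : Eu m), (𝓕⁻ (-∂_{v} φ) : 𝓢(Eu m, ℂ)) ξ =
      derivSymbol v ξ * (𝓕⁻ φ : 𝓢(Eu m, ℂ)) ξ := fun φ ξ => by
    have : (𝓕⁻ (-∂_{v} φ) : 𝓢(Eu m, ℂ)) = -𝓕⁻ (∂_{v} φ) :=
      map_neg (FourierTransform.fourierInvCLM ℂ 𝓢(Eu m, ℂ)) _
    rw [this, _root_.neg_apply, fourierInv_lineDeriv_apply]
    ring
  have h1 : ∀ φ : 𝓢(Eu m, ℂ), -∫ x, (∂_{v} φ) x * a x = ∫ x, (-∂_{v} φ) x * a x := fun φ => by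
    simp [integral_neg]
  simp only [h1]
  exact ⟨fun h φ => h.integral_eq hQ φ,
    IsMul.of_integral_eq (derivSymbol_hasTemperateGrowth v) hQ⟩

/-- `b` is the Laplacian of `a`, in the sense of distributions. -/
theorem isMul_lapSymbol_iff {a b : SpaceL2 m} : IsMul lapSymbol a b ↔
    ∀ φ : 𝓢(Eu m, ℂ), ∫ x, φ x * b x = ∫ x, (Δ φ) x * a x :=
  ⟨fun h φ => h.integral_eq fourierInv_laplacian_apply φ,
    IsMul.of_integral_eq lapSymbol_hasTemperateGrowth fourierInv_laplacian_apply⟩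

theorem isMul_lineDeriv (φ : 𝓢(Eu m, ℂ)) (v : Eu m) :
    IsMul (derivSymbol v) (toL2 φ) (toL2 (∂_{v} φ)) := by
  unfold IsMul
  rw [fourier_toL2, fourier_toL2]
  filter_upwards [coeFn_toL2 (𝓕 φ), coeFn_toL2 (𝓕 (∂_{v} φ))]
    with ξ h1 h2
  rw [h1, h2, fourier_lineDeriv_apply]

end WeakDerivatives

/-! ### Density of test functions -/

section Density

variable {m : ℕ}

/-- Test functions are sequentially dense in the Schwartz space. -/
theorem exists_hasCompactSupport_tendsto (φ : 𝓢(Eu m, ℂ)) :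
    ∃ u : ℕ → 𝓢(Eu m, ℂ), (∀ j, HasCompactSupport (u j)) ∧ Tendsto u atTop (𝓝 φ) := by
  -- Multiply by the cut-off `c(e x)`, `e → 0`. The derivatives of `g = 1 - c` vanish on the unit
  -- ball, so each of them is bounded by `C ‖x‖`; this gains a factor `e` at the price of one more
  -- power of `‖x‖` in the seminorm of `φ`.
  let χ : ContDiffBump (0 : Eu m) := ⟨1, 2, one_pos, one_lt_two⟩
  let c : Eu m → ℂ := fun x => (χ x : ℂ)
  have hc : ContDiff ℝ (⊤ : ℕ∞) c := Complex.ofRealCLM.contDiff.comp χ.contDiff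
  have hcs : HasCompactSupport c := χ.hasCompactSupport.comp_left (g := fun y : ℝ => (y : ℂ)) rfl
  let g : Eu m → ℂ := fun x => 1 - c x
  have hg : ContDiff ℝ (⊤ : ℕ∞) g := contDiff_const.sub hc
  have hgs : tsupport g ⊆ {x | 1 ≤ ‖x‖} := by
    refine closure_minimal (fun x hx => ?_) (isClosed_le continuous_const continuous_norm)
    by_contra h
    simp only [Set.mem_ofPred_eq, not_le] at h
    refine hx ?_
    have : χ x = 1 := χ.one_of_mem_closedBall (by simpa [χ] using h.le)
    simp [g, c, this]
  have hbd : ∀ i : ℕ, ∃ C, 0 ≤ C ∧ ∀ x, ‖iteratedFDeriv ℝ i g x‖ ≤ C := by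
    intro i
    obtain ⟨C, hC⟩ := (hcs.iteratedFDeriv (𝕜 := ℝ) i).exists_bound_of_continuous
      ((hc.of_le (mod_cast le_top)).continuous_iteratedFDeriv')
    refine ⟨1 + C, ?_, fun x => ?_⟩
    · have := (norm_nonneg _).trans (hC 0)
      linarith
    · have h1 : iteratedFDeriv ℝ i g x =
          iteratedFDeriv ℝ i (fun _ : Eu m => (1 : ℂ)) x - iteratedFDeriv ℝ i c x :=
        iteratedFDeriv_sub_apply contDiff_const.contDiffAt
          (hc.of_le (mod_cast le_top)).contDiffAt
      rw [h1]
      refine (norm_sub_le _ _).trans (add_le_add ?_ (hC x))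
      cases i with
      | zero => simp
      | succ i => simp [iteratedFDeriv_succ_const]
  have hbd2 : ∀ i : ℕ, ∃ C, 0 ≤ C ∧ ∀ x, ‖iteratedFDeriv ℝ i g x‖ ≤ C * ‖x‖ := by
    intro i
    obtain ⟨C, hC0, hC⟩ := hbd i
    refine ⟨C, hC0, fun x => ?_⟩
    by_cases hx : 1 ≤ ‖x‖
    · exact (hC x).trans (le_mul_of_one_le_right hC0 hx)
    · have : iteratedFDeriv ℝ i g x = 0 := by
        by_contra h
        exact hx (hgs (support_iteratedFDeriv_subset i h))
      rw [this, norm_zero]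
      positivity
  choose C hC0 hC using hbd2
  let e : ℕ → ℝ := fun j => 1 / ((j : ℝ) + 1)
  have he0 : ∀ j, 0 < e j := fun j => by positivity
  have he1 : ∀ j, e j ≤ 1 := fun j => by
    rw [div_le_one (by positivity)]
    linarith [(Nat.cast_nonneg j : (0 : ℝ) ≤ j)]
  have hcomp : ∀ j, HasCompactSupport fun x : Eu m => c (e j • x) := fun j =>
    hcs.comp_homeomorph (Homeomorph.smulOfNeZero (e j) (he0 j).ne')
  have htemp : ∀ j, (fun x : Eu m => c (e j • x)).HasTemperateGrowth := fun j =>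
    (hcomp j).hasTemperateGrowth (hc.comp (contDiff_const_smul _))
  refine ⟨fun j => smulLeftCLM ℂ (fun x : Eu m => c (e j • x)) φ, fun j => ?_, ?_⟩
  · have : (smulLeftCLM ℂ (fun x : Eu m => c (e j • x)) φ : Eu m → ℂ) =
        fun x => c (e j • x) * φ x := by
      ext x
      rw [smulLeftCLM_apply_apply (htemp j), smul_eq_mul]
    rw [this]
    exact (hcomp j).mul_right
  rw [(schwartz_withSeminorms ℝ (Eu m) ℂ).tendsto_nhds]
  rintro ⟨k, n⟩ ε hε
  let K : ℝ := ∑ i ∈ Finset.range (n + 1),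
    (n.choose i : ℝ) * C i * SchwartzMap.seminorm ℝ (k + 1) (n - i) φ
  have hK : 0 ≤ K := Finset.sum_nonneg fun i _ =>
    mul_nonneg (mul_nonneg (Nat.cast_nonneg _) (hC0 i)) (apply_nonneg _ _)
  have hbound : ∀ j, SchwartzMap.seminorm ℝ k n
      (smulLeftCLM ℂ (fun x : Eu m => c (e j • x)) φ - φ) ≤ e j * K := by
    intro j
    refine SchwartzMap.seminorm_le_bound ℝ k n _ (mul_nonneg (he0 j).le hK) fun x => ?_
    have hgj : ContDiff ℝ (⊤ : ℕ∞) fun x : Eu m => g (e j • x) := hg.comp (contDiff_const_smul _)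
    have h1 : (⇑(smulLeftCLM ℂ (fun x : Eu m => c (e j • x)) φ - φ) : Eu m → ℂ) =
        -(fun x => g (e j • x) * φ x) := by
      ext x
      simp [smulLeftCLM_apply_apply (htemp j), g]
      ring
    rw [h1, iteratedFDeriv_neg_apply, norm_neg]
    have h2 := norm_iteratedFDeriv_mul_le (n := n) (N := n) (hgj.of_le (mod_cast le_top))
      (φ.smooth n) x le_rfl
    refine (mul_le_mul_of_nonneg_left h2 (by positivity)).trans ?_
    rw [Finset.mul_sum, Finset.mul_sum]
    refine Finset.sum_le_sum fun i _ => ?_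
    have h3 : ‖iteratedFDeriv ℝ i (fun x : Eu m => g (e j • x)) x‖ ≤ e j * (C i * ‖x‖) := by
      rw [iteratedFDeriv_comp_const_smul _ (hg.of_le (mod_cast le_top)), norm_smul, norm_pow,
        Real.norm_of_nonneg (he0 j).le]
      have h4 := hC i (e j • x)
      rw [norm_smul, Real.norm_of_nonneg (he0 j).le] at h4
      calc e j ^ i * ‖iteratedFDeriv ℝ i g (e j • x)‖ ≤ 1 * (C i * (e j * ‖x‖)) := by
            gcongr
            exact pow_le_one₀ (he0 j).le (he1 j)
        _ = e j * (C i * ‖x‖) := by ring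
    have h5 := φ.le_seminorm ℝ (k + 1) (n - i) x
    calc ‖x‖ ^ k * ((n.choose i : ℝ) * ‖iteratedFDeriv ℝ i (fun x : Eu m => g (e j • x)) x‖ *
          ‖iteratedFDeriv ℝ (n - i) φ x‖)
        ≤ ‖x‖ ^ k * ((n.choose i : ℝ) * (e j * (C i * ‖x‖)) * ‖iteratedFDeriv ℝ (n - i) φ x‖) := by
          gcongr
      _ = e j * ((n.choose i : ℝ) * C i) * (‖x‖ ^ (k + 1) * ‖iteratedFDeriv ℝ (n - i) φ x‖) := by
          ring
      _ ≤ e j * ((n.choose i : ℝ) * C i) * SchwartzMap.seminorm ℝ (k + 1) (n - i) φ := by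
          gcongr
          exact mul_nonneg (he0 j).le (mul_nonneg (Nat.cast_nonneg _) (hC0 i))
      _ = _ := by ring
  have hlim : Tendsto (fun j => e j * K) atTop (𝓝 0) := by
    have := (tendsto_one_div_add_atTop_nhds_zero_nat (𝕜 := ℝ)).mul_const K
    rwa [zero_mul] at this
  filter_upwards [hlim.eventually_lt_const hε] with j hj
  exact (hbound j).trans_lt hj

theorem jap_hasTemperateGrowth : (fun ξ : Eu m => (jap ξ : ℂ)).HasTemperateGrowth := by
  unfold jap
  simp only [norm_smul, mul_pow, Complex.ofReal_mul, Complex.ofReal_add]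
  fun_prop

theorem contDiff_jap : ContDiff ℝ (⊤ : ℕ∞) (jap : Eu m → ℝ) := by
  unfold jap
  exact contDiff_const.add ((contDiff_const_smul _).norm_sq ℝ)

/-- The map `φ ↦ ‖(1 - Δ)² φ‖` controls the norms of `Hʳ` for `r ≤ 4`; it is continuous on the
Schwartz space. -/
theorem tendsto_sobSq_toLp {r : ℝ} (hr : r ≤ 4) {u : ℕ → 𝓢(Eu m, ℂ)} {φ : 𝓢(Eu m, ℂ)}
    (hu : Tendsto u atTop (𝓝 φ)) :
    Tendsto (fun j => sobSq r (toL2 φ - toL2 (u j))) atTop (𝓝 0) := by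
  let J : Eu m → ℂ := fun ξ => (jap ξ : ℂ) * (jap ξ : ℂ)
  have hJ : J.HasTemperateGrowth := jap_hasTemperateGrowth.mul jap_hasTemperateGrowth
  let L : 𝓢(Eu m, ℂ) → SpaceL2 m := fun φ => toL2 (smulLeftCLM ℂ J (𝓕 φ))
  have hL : Continuous L :=
    SchwartzMap.continuous_toLp.comp ((smulLeftCLM ℂ J).continuous.comp
      (FourierTransform.fourierCLM ℂ 𝓢(Eu m, ℂ)).continuous)
  have h1 : ∀ ψ : 𝓢(Eu m, ℂ), sobSq r (toL2 ψ) ≤ ‖L ψ‖ₑ ^ 2 := by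
    intro ψ
    refine (sobSq_mono hr _).trans (le_of_eq ?_)
    rw [enorm_sq_eq_lintegral]
    unfold sobSq
    rw [fourier_toL2]
    refine lintegral_congr_ae ?_
    filter_upwards [coeFn_toL2 (𝓕 ψ), coeFn_toL2 (smulLeftCLM ℂ J (𝓕 ψ))]
      with ξ h1 h2
    simp only [L]
    rw [h1, h2, smulLeftCLM_apply_apply hJ, smul_eq_mul, enorm_mul, mul_pow]
    congr 1
    rw [← ofReal_norm (J ξ), ← ENNReal.ofReal_pow (norm_nonneg _), norm_mul, Complex.norm_real,
      Real.norm_of_nonneg (jap_pos ξ).le]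
    congr 1
    norm_cast
    ring
  have h2 : Tendsto (fun j => ‖L (φ - u j)‖ₑ ^ 2) atTop (𝓝 0) := by
    have h3 : Tendsto (fun j => L (φ - u j)) atTop (𝓝 (L (φ - φ))) :=
      (hL.tendsto _).comp (tendsto_const_nhds.sub hu)
    have h4 : L (φ - φ) = 0 := by
      have := (((SchwartzMap.toLpCLM ℂ ℂ 2 (volume : Measure (Eu m))).comp
        ((smulLeftCLM ℂ J).comp (FourierTransform.fourierCLM ℂ 𝓢(Eu m, ℂ))))).map_zero
      rw [sub_self]
      exact this
    rw [h4] at h3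
    have h5 := ENNReal.Tendsto.pow (n := 2) h3.enorm
    simpa using h5
  refine tendsto_of_tendsto_of_tendsto_of_le_of_le tendsto_const_nhds h2 (fun _ => zero_le) ?_
  intro j
  have h6 : toL2 φ - toL2 (u j) = toL2 (φ - u j) :=
    (toL2_sub φ (u j)).symm
  simp only [h6]
  exact h1 _

theorem exists_schwartz_approx {r : ℝ} {a : SpaceL2 m} (ha : sobSq r a < ⊤)
    {ε : ℝ≥0∞} (hε : ε ≠ 0) : ∃ φ : 𝓢(Eu m, ℂ), sobSq r (a - toL2 φ) < ε := by
  -- approximate `J^{r/2} 𝓕 a` by a test function and divide by `J^{r/2}`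
  let H : Eu m → ℂ := fun ξ => ((jap ξ ^ (r / 2) : ℝ) : ℂ) * (𝓕 a : SpaceL2 m) ξ
  have hJs : ∀ ξ : Eu m, ‖((jap ξ ^ (r / 2) : ℝ) : ℂ)‖ₑ ^ 2 = ENNReal.ofReal (jap ξ ^ r) := by
    intro ξ
    rw [← ofReal_norm, ← ENNReal.ofReal_pow (norm_nonneg _), Complex.norm_real, Real.norm_eq_abs,
      sq_abs, ← Real.rpow_natCast, ← Real.rpow_mul (jap_pos ξ).le]
    norm_num
  have hHm : AEStronglyMeasurable H :=
    (by fun_prop : Measurable fun ξ : Eu m => ((jap ξ ^ (r / 2) : ℝ) : ℂ)).aestronglyMeasurable.mul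
      (Lp.aestronglyMeasurable _)
  have hH : MemLp H 2 := by
    rw [memLp_two_iff_lintegral hHm]
    refine lt_of_eq_of_lt (lintegral_congr fun ξ => ?_) ha
    rw [enorm_mul, mul_pow, hJs]
  obtain ⟨δ, hδ0, hδ⟩ : ∃ δ : ℝ, 0 < δ ∧ ENNReal.ofReal δ ^ 2 < ε := by
    obtain ⟨δ, hδ0, hδ⟩ := ENNReal.lt_iff_exists_nnreal_btwn.1 (pos_iff_ne_zero.2 hε)
    refine ⟨Real.sqrt δ, Real.sqrt_pos.2 (by exact_mod_cast hδ0), ?_⟩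
    rw [← ENNReal.ofReal_pow (Real.sqrt_nonneg _), Real.sq_sqrt (NNReal.coe_nonneg δ), ENNReal.ofReal_coe_nnreal]
    exact hδ
  obtain ⟨g, hgs, hg, hga⟩ := MemLp.exist_eLpNorm_sub_le (by norm_num) (by norm_num) hH hδ0
  have hJc : ContDiff ℝ (⊤ : ℕ∞) fun ξ : Eu m => ((jap ξ ^ (-(r / 2)) : ℝ) : ℂ) :=
    Complex.ofRealCLM.contDiff.comp
      (contDiff_jap.rpow_const_of_ne fun ξ => (jap_pos ξ).ne')
  let ψ : 𝓢(Eu m, ℂ) := HasCompactSupport.toSchwartzMap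
    (f := fun ξ => ((jap ξ ^ (-(r / 2)) : ℝ) : ℂ) * g ξ) hgs.mul_left (hJc.mul hg)
  refine ⟨𝓕⁻ ψ, lt_of_le_of_lt ?_ hδ⟩
  have h1 : sobSq r (a - toL2 (𝓕⁻ ψ)) = eLpNorm (H - g) 2 volume ^ 2 := by
    rw [eLpNorm_eq_lintegral_rpow_enorm_toReal (by norm_num) (by norm_num), ← ENNReal.rpow_natCast,
      ← ENNReal.rpow_mul]
    norm_num only [ENNReal.toReal_ofNat]
    rw [ENNReal.rpow_one]
    unfold sobSq
    refine lintegral_congr_ae ?_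
    have h2 : (𝓕 (toL2 (𝓕⁻ ψ)) : SpaceL2 m) = toL2 ψ := by
      rw [fourier_toL2, FourierTransform.fourier_fourierInv_eq]
    filter_upwards [coeFn_fourier_sub a (toL2 (𝓕⁻ ψ)), coeFn_toL2 ψ]
      with ξ h3 h4
    rw [h3, h2, h4, ← hJs, ← mul_pow, ← enorm_mul, mul_sub]
    have h5 : ((jap ξ ^ (r / 2) : ℝ) : ℂ) * ψ ξ = g ξ := by
      change _ * (((jap ξ ^ (-(r / 2)) : ℝ) : ℂ) * g ξ) = g ξ
      rw [← mul_assoc, ← Complex.ofReal_mul, ← Real.rpow_add (jap_pos ξ)]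
      simp
    rw [h5, Pi.sub_apply, ENNReal.rpow_ofNat]
  rw [h1]
  gcongr

/-- Test functions are dense in `Hʳ(ℝᵐ)`. -/
theorem exists_testFunction_approx {r : ℝ} (hr : r ≤ 4) {a : SpaceL2 m} (ha : sobSq r a < ⊤)
    {ε : ℝ≥0∞} (hε : ε ≠ 0) :
    ∃ φ : 𝓢(Eu m, ℂ), HasCompactSupport φ ∧ sobSq r (a - toL2 φ) < ε := by
  have hε4 : ε / 4 ≠ 0 := (ENNReal.div_pos hε (by norm_num)).ne'
  obtain ⟨φ, hφ⟩ := exists_schwartz_approx ha hε4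
  obtain ⟨u, hus, hu⟩ := exists_hasCompactSupport_tendsto φ
  obtain ⟨j, hj⟩ := ((tendsto_sobSq_toLp hr hu).eventually_lt_const
    (pos_iff_ne_zero.2 hε4)).exists
  refine ⟨u j, hus j, ?_⟩
  have h1 := sobSq_add_le r (a - toL2 φ) (toL2 φ - toL2 (u j))
  rw [sub_add_sub_cancel] at h1
  refine h1.trans_lt ?_
  calc 2 * (sobSq r (a - toL2 φ) + sobSq r (toL2 φ - toL2 (u j)))
      < 2 * (ε / 4 + ε / 4) := by
        refine ENNReal.mul_lt_mul_right (by norm_num) (by norm_num) (ENNReal.add_lt_add hφ hj)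
    _ = ε := by
        rw [← two_mul, ← mul_assoc, ENNReal.div_eq_inv_mul, ← mul_assoc]
        norm_num
        rw [ENNReal.mul_inv_cancel (by norm_num) (by norm_num), one_mul]

end Density

/-! ### Coordinates adapted to the half space -/

section Coordinates

variable {d : ℕ}

/-- The splitting `(x', xₙ) ↦ (x', xₙ)` of `ℝⁿ`, `n = d + 1`, as a continuous linear equivalence. -/
def glue (d : ℕ) : (Eu d × ℝ) ≃L[ℝ] Eu (d + 1) :=
  LinearEquiv.toContinuousLinearEquiv
    { toFun := fun p => WithLp.toLp 2 (Fin.snoc (α := fun _ => ℝ) p.1 p.2)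
      invFun := fun x => (WithLp.toLp 2 fun i => x i.castSucc, x (Fin.last d))
      map_add' := fun p q => by
        ext i
        refine Fin.lastCases ?_ (fun i => ?_) i <;> simp
      map_smul' := fun c p => by
        ext i
        refine Fin.lastCases ?_ (fun i => ?_) i <;> simp
      left_inv := fun p => by ext <;> simp
      right_inv := fun x => by
        ext i
        refine Fin.lastCases ?_ (fun i => ?_) i <;> simp }

theorem glue_apply (p : Eu d × ℝ) :
    glue d p = WithLp.toLp 2 (Fin.snoc (α := fun _ => ℝ) p.1 p.2) := rfl

@[simp] theorem glue_last (p : Eu d × ℝ) : glue d p (Fin.last d) = p.2 := by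
  simp [glue_apply]

@[simp] theorem glue_castSucc (p : Eu d × ℝ) (i : Fin d) : glue d p i.castSucc = p.1 i := by
  simp [glue_apply]

theorem inner_glue (p q : Eu d × ℝ) :
    inner ℝ (glue d p) (glue d q) = inner ℝ p.1 q.1 + p.2 * q.2 := by
  simp only [PiLp.inner_apply, Fin.sum_univ_castSucc, glue_last, glue_castSucc]
  simp [mul_comm]

theorem norm_sq_glue (p : Eu d × ℝ) : ‖glue d p‖ ^ 2 = ‖p.1‖ ^ 2 + p.2 ^ 2 := by
  rw [← real_inner_self_eq_norm_sq, inner_glue, real_inner_self_eq_norm_sq, sq p.2]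

theorem jap_glue (p : Eu d × ℝ) : jap (glue d p) = jap p.1 + (2 * Real.pi * p.2) ^ 2 := by
  unfold jap
  rw [norm_smul, mul_pow, norm_sq_glue, norm_smul, mul_pow, Real.norm_eq_abs, sq_abs]
  ring

/-- The inner unit normal of the half space. -/
abbrev normal (d : ℕ) : Eu (d + 1) := EuclideanSpace.single (Fin.last d) 1

theorem glue_zero_one : glue d (0, 1) = normal d := by
  ext i
  refine Fin.lastCases ?_ (fun i => ?_) i
  · simp
  · simp [Fin.castSucc_ne_last]

theorem inner_normal (x : Eu (d + 1)) : inner ℝ x (normal d) = x (Fin.last d) := by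
  simp [EuclideanSpace.inner_single_right]

theorem measurePreserving_glue : MeasurePreserving (glue d) volume volume := by
  have h1 := (volume_preserving_piFinSuccAbove (fun _ : Fin (d + 1) => ℝ) (Fin.last d)).symm
  have h2 := PiLp.volume_preserving_toLp (Fin (d + 1))
  have h3 := PiLp.volume_preserving_ofLp (Fin d)
  have h4 : MeasurePreserving (fun p : Eu d × ℝ => (p.2, WithLp.ofLp p.1)) volume volume :=
    (Measure.measurePreserving_swap (μ := (volume : Measure (Fin d → ℝ)))
      (ν := (volume : Measure ℝ))).comp (h3.prod (MeasurePreserving.id volume))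
  have h5 := h2.comp (h1.comp h4)
  have h6 : (glue d : Eu d × ℝ → Eu (d + 1)) = WithLp.toLp 2 ∘
      (MeasurableEquiv.piFinSuccAbove (fun _ : Fin (d + 1) => ℝ) (Fin.last d)).symm ∘
        fun p => (p.2, p.1.ofLp) := by
    ext1 p
    rw [glue_apply]
    simp only [Function.comp]
    congr 1
    change _ = Fin.insertNth (α := fun _ => ℝ) (Fin.last d) p.2 _
    rw [Fin.insertNth_last']
  rw [h6]
  exact h5

theorem measurableEmbedding_glue : MeasurableEmbedding (glue d) :=
  (glue d).toHomeomorph.measurableEmbedding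

/-- The open half space `{xₙ > 0}` of `ℝⁿ`, `n = d + 1`. -/
def halfE (d : ℕ) : Set (Eu (d + 1)) := {x | 0 < x (Fin.last d)}

theorem isOpen_halfE : IsOpen (halfE d) :=
  isOpen_lt continuous_const (by fun_prop)

theorem measurableSet_halfE : MeasurableSet (halfE d) := isOpen_halfE.measurableSet

theorem glue_preimage_halfE : glue d ⁻¹' halfE d = Set.univ ×ˢ Set.Ioi 0 := by
  ext p
  simp [halfE]

theorem lintegral_glue {f : Eu (d + 1) → ℝ≥0∞} (hf : AEMeasurable f) :
    ∫⁻ x, f x = ∫⁻ x : Eu d, ∫⁻ s : ℝ, f (glue d (x, s)) := by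
  rw [← measurePreserving_glue.lintegral_comp_emb measurableEmbedding_glue, Measure.volume_eq_prod,
    lintegral_prod]
  exact hf.comp_quasiMeasurePreserving measurePreserving_glue.quasiMeasurePreserving

theorem integral_glue {f : Eu (d + 1) → ℂ} (hf : Integrable f) :
    ∫ x, f x = ∫ x : Eu d, ∫ s : ℝ, f (glue d (x, s)) := by
  rw [← measurePreserving_glue.integral_comp measurableEmbedding_glue, Measure.volume_eq_prod,
    integral_prod]
  exact (measurePreserving_glue.integrable_comp_emb measurableEmbedding_glue).2 hf

theorem measurePreserving_glue_half : MeasurePreserving (glue d)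
    ((volume : Measure (Eu d)).prod ((volume : Measure ℝ).restrict (Set.Ioi 0)))
    (volume.restrict (halfE d)) := by
  have h := measurePreserving_glue.restrict_preimage (measurableSet_halfE (d := d))
  rwa [glue_preimage_halfE, Measure.volume_eq_prod, ← Measure.prod_restrict,
    Measure.restrict_univ] at h

theorem setIntegral_halfE {f : Eu (d + 1) → ℂ} (hf : IntegrableOn f (halfE d)) :
    ∫ x in halfE d, f x = ∫ x : Eu d, ∫ s in Set.Ioi (0 : ℝ), f (glue d (x, s)) := by
  rw [← measurePreserving_glue_half.integral_comp measurableEmbedding_glue, integral_prod]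
  exact (measurePreserving_glue_half.integrable_comp_emb measurableEmbedding_glue).2 hf

theorem setIntegral_halfE_symm {f : Eu (d + 1) → ℂ} (hf : IntegrableOn f (halfE d)) :
    ∫ x in halfE d, f x = ∫ s in Set.Ioi (0 : ℝ), ∫ x : Eu d, f (glue d (x, s)) := by
  rw [← measurePreserving_glue_half.integral_comp measurableEmbedding_glue, integral_prod_symm]
  exact (measurePreserving_glue_half.integrable_comp_emb measurableEmbedding_glue).2 hf

theorem ae_glue {p : Eu (d + 1) → Prop} (hp : ∀ᵐ x, p x) :
    ∀ᵐ x : Eu d, ∀ᵐ s : ℝ, p (glue d (x, s)) := by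
  have h := measurePreserving_glue.quasiMeasurePreserving.ae hp
  rw [Measure.volume_eq_prod] at h
  exact Measure.ae_ae_of_ae_prod h

end Coordinates

/-! ### Restriction of Schwartz functions to hyperplanes -/

section Slices

variable {d : ℕ}

theorem slice_hasTemperateGrowth (s : ℝ) :
    (fun x : Eu d => glue d (x, s)).HasTemperateGrowth := by
  have h : (fun x : Eu d => glue d (x, s)) =
      fun x => (((glue d : (Eu d × ℝ) →L[ℝ] Eu (d + 1)).comp
        (ContinuousLinearMap.inl ℝ (Eu d) ℝ)) x) + glue d (0, s) := by
    ext1 x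
    simp [← map_add]
  rw [h]
  exact (ContinuousLinearMap.hasTemperateGrowth _).add (Function.HasTemperateGrowth.const _)

theorem isometry_slice (s : ℝ) : Isometry fun x : Eu d => glue d (x, s) := by
  refine Isometry.of_dist_eq fun x y => ?_
  rw [dist_eq_norm, dist_eq_norm, ← map_sub, ← sq_eq_sq₀ (norm_nonneg _) (norm_nonneg _),
    norm_sq_glue]
  simp

/-- The restriction of a Schwartz function to the hyperplane `{xₙ = s}`. -/
def slice (s : ℝ) : 𝓢(Eu (d + 1), ℂ) →L[ℂ] 𝓢(Eu d, ℂ) :=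
  compCLMOfAntilipschitz ℂ (slice_hasTemperateGrowth s) (isometry_slice s).antilipschitz

theorem slice_apply (s : ℝ) (φ : 𝓢(Eu (d + 1), ℂ)) (x : Eu d) :
    slice s φ x = φ (glue d (x, s)) := rfl

theorem integral_lineDeriv_eq_zero {m : ℕ} (φ : 𝓢(Eu m, ℂ)) (v : Eu m) :
    ∫ x, (∂_{v} φ : 𝓢(Eu m, ℂ)) x = 0 := by
  have h := fourier_lineDeriv_apply φ v 0
  rw [derivSymbol, inner_zero_left, Complex.ofReal_zero, mul_zero, zero_mul,
    SchwartzMap.fourier_coe, Real.fourier_eq] at h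
  simpa using h

theorem slice_lineDeriv (s : ℝ) (φ : 𝓢(Eu (d + 1), ℂ)) (v : Eu d) :
    slice s (∂_{glue d (v, 0)} φ) = ∂_{v} (slice s φ) := by
  ext x
  rw [slice_apply, SchwartzMap.lineDerivOp_apply, SchwartzMap.lineDerivOp_apply]
  unfold lineDeriv
  congr 1
  ext t
  rw [slice_apply, ← map_smul, ← map_add]
  simp

theorem hasDerivAt_glue (φ : 𝓢(Eu (d + 1), ℂ)) (x : Eu d) (s : ℝ) :
    HasDerivAt (fun s => φ (glue d (x, s))) ((∂_{normal d} φ : 𝓢(Eu (d + 1), ℂ)) (glue d (x, s)))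
      s := by
  rw [SchwartzMap.lineDerivOp_apply_eq_fderiv]
  have h1 : HasDerivAt (fun s : ℝ => glue d (x, s)) (normal d) s := by
    have h2 : HasDerivAt (fun s : ℝ => (x, s)) ((0, 1) : Eu d × ℝ) s :=
      (hasDerivAt_const s x).prodMk (hasDerivAt_id s)
    have h3 := (glue d).hasFDerivAt.comp_hasDerivAt s h2
    rw [ContinuousLinearEquiv.coe_coe, glue_zero_one] at h3
    exact h3
  exact (φ.hasFDerivAt _).comp_hasDerivAt s h1

theorem tendsto_glue_cocompact (x : Eu d) :
    Tendsto (fun s : ℝ => glue d (x, s)) atTop (cocompact (Eu (d + 1))) := by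
  refine tendsto_cocompact_of_tendsto_dist_comp_atTop 0 ?_
  refine tendsto_atTop_mono (fun s => ?_) tendsto_id
  rw [dist_zero_right, id]
  refine (le_abs_self s).trans ?_
  rw [← sq_le_sq₀ (abs_nonneg _) (norm_nonneg _), norm_sq_glue, sq_abs]
  have := sq_nonneg ‖x‖
  simp only
  linarith

/-- The divergence theorem on the half space. -/
theorem setIntegral_halfE_lineDeriv (φ : 𝓢(Eu (d + 1), ℂ)) (v : Eu (d + 1)) :
    ∫ x in halfE d, (∂_{v} φ : 𝓢(Eu (d + 1), ℂ)) x =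
      -(v (Fin.last d) : ℂ) * ∫ x : Eu d, φ (glue d (x, 0)) := by
  -- the tangential part of `v` contributes nothing, the normal part is handled on each normal line
  obtain ⟨⟨v', c⟩, rfl⟩ := (glue d).surjective v
  have hv : glue d (v', c) = glue d (v', 0) + c • normal d := by
    rw [← glue_zero_one, ← map_smul, ← map_add]
    simp
  have h1 : (∂_{glue d (v', c)} φ : 𝓢(Eu (d + 1), ℂ)) =
      ∂_{glue d (v', 0)} φ + c • ∂_{normal d} φ := by
    rw [hv, LineDeriv.lineDerivOp_left_add, LineDeriv.lineDerivOp_left_smul]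
  have hi : ∀ w : Eu (d + 1), IntegrableOn (∂_{w} φ : 𝓢(Eu (d + 1), ℂ)) (halfE d) := fun w =>
    (SchwartzMap.integrable _).integrableOn
  have h2 : ∫ x in halfE d, (∂_{glue d (v', 0)} φ : 𝓢(Eu (d + 1), ℂ)) x = 0 := by
    rw [setIntegral_halfE_symm (hi _)]
    refine (setIntegral_congr_fun measurableSet_Ioi fun s _ => ?_).trans (integral_zero _ _)
    have := integral_lineDeriv_eq_zero (slice s φ) v'
    rwa [← slice_lineDeriv] at this
  have h3 : ∫ x in halfE d, (∂_{normal d} φ : 𝓢(Eu (d + 1), ℂ)) x =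
      -∫ x : Eu d, φ (glue d (x, 0)) := by
    rw [setIntegral_halfE (hi _), ← integral_neg]
    have hint := ((measurePreserving_glue_half (d := d)).integrable_comp_emb
      measurableEmbedding_glue).2 (hi (normal d))
    refine integral_congr_ae ?_
    filter_upwards [hint.prod_right_ae] with x hx
    have h4 := integral_Ioi_of_hasDerivAt_of_tendsto' (a := 0) (m := 0)
      (fun s _ => hasDerivAt_glue φ x s) hx
      ((SchwartzMap.tendsto_cocompact φ).comp (tendsto_glue_cocompact x))
    rw [h4, zero_sub]
  have h5 : ∀ x, (∂_{glue d (v', c)} φ : 𝓢(Eu (d + 1), ℂ)) x =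
      (∂_{glue d (v', 0)} φ : 𝓢(Eu (d + 1), ℂ)) x +
        (c : ℂ) * (∂_{normal d} φ : 𝓢(Eu (d + 1), ℂ)) x := fun x => by
    rw [h1]
    simp
  simp only [h5]
  rw [integral_add (hi _) ((hi _).const_mul _), integral_const_mul, h2, h3, glue_last]
  ring

/-- The product `φ̄ ψ` as a Schwartz function. -/
def conjMul (φ ψ : 𝓢(Eu d, ℂ)) : 𝓢(Eu d, ℂ) :=
  SchwartzMap.pairing (ContinuousLinearMap.mul ℝ ℂ)
    (SchwartzMap.postcompCLM (𝕜 := ℝ) (Complex.conjCLE : ℂ →L[ℝ] ℂ) φ) ψ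

theorem lineDeriv_conjMul (φ ψ : 𝓢(Eu d, ℂ)) (v x : Eu d) :
    (∂_{v} (conjMul φ ψ) : 𝓢(Eu d, ℂ)) x =
      (starRingEnd ℂ) ((∂_{v} φ : 𝓢(Eu d, ℂ)) x) * ψ x +
        (starRingEnd ℂ) (φ x) * (∂_{v} ψ : 𝓢(Eu d, ℂ)) x := by
  simp only [SchwartzMap.lineDerivOp_apply_eq_fderiv]
  have h1 : HasFDerivAt (fun x => (starRingEnd ℂ) (φ x))
      ((Complex.conjCLE : ℂ →L[ℝ] ℂ).comp (fderiv ℝ φ x)) x :=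
    (Complex.conjCLE : ℂ →L[ℝ] ℂ).hasFDerivAt.comp x (φ.hasFDerivAt x)
  have h2 : HasFDerivAt (conjMul φ ψ) _ x := h1.mul (ψ.hasFDerivAt x)
  rw [h2.fderiv]
  simp
  ring

end Slices

/-! ### Integrals in the normal frequency -/

section OneDimensionalIntegrals

theorem integrable_inv_add_sq {A : ℝ} (hA : 0 < A) :
    Integrable fun s : ℝ => (A + (2 * Real.pi * s) ^ 2)⁻¹ := by
  have h0 : 2 * Real.pi / Real.sqrt A ≠ 0 := by positivity
  have h := (integrable_inv_one_add_sq.comp_mul_left' h0).const_mul A⁻¹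
  refine h.congr (ae_of_all _ fun s => ?_)
  simp only
  rw [← mul_inv]
  congr 1
  have : Real.sqrt A ^ 2 = A := Real.sq_sqrt hA.le
  field_simp
  rw [this]

theorem integral_inv_add_sq {A : ℝ} (hA : 0 < A) :
    ∫ s : ℝ, (A + (2 * Real.pi * s) ^ 2)⁻¹ = (2 * Real.sqrt A)⁻¹ := by
  have hs : 0 < Real.sqrt A := Real.sqrt_pos.2 hA
  have hsq : Real.sqrt A ^ 2 = A := Real.sq_sqrt hA.le
  have h := Measure.integral_comp_mul_left (fun t : ℝ => (1 + t ^ 2)⁻¹) (2 * Real.pi / Real.sqrt A)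
  rw [integral_univ_inv_one_add_sq] at h
  have h1 : ∀ s : ℝ, (A + (2 * Real.pi * s) ^ 2)⁻¹ =
      A⁻¹ * (1 + (2 * Real.pi / Real.sqrt A * s) ^ 2)⁻¹ := fun s => by
    rw [← mul_inv]
    congr 1
    field_simp
    rw [hsq]
    field_simp
  simp only [h1]
  rw [integral_const_mul, h, abs_of_pos (by positivity), smul_eq_mul]
  rw [inv_div]
  field_simp
  rw [hsq]

theorem lintegral_inv_add_sq {A : ℝ} (hA : 0 < A) :
    ∫⁻ s : ℝ, ENNReal.ofReal (A + (2 * Real.pi * s) ^ 2)⁻¹ =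
      ENNReal.ofReal (2 * Real.sqrt A)⁻¹ := by
  rw [← integral_inv_add_sq hA, ofReal_integral_eq_lintegral_ofReal (integrable_inv_add_sq hA)]
  exact ae_of_all _ fun s => by positivity

/-- For `p ≥ 1` the integral of `(A + σ²)^{-p}` over `ℝ` decays like `A^{1/2-p}`. -/
theorem lintegral_rpow_neg_add_sq_le {A p : ℝ} (hA : 0 < A) (hp : 1 ≤ p) :
    ∫⁻ s : ℝ, ENNReal.ofReal ((A + (2 * Real.pi * s) ^ 2) ^ (-p)) ≤
      ENNReal.ofReal (A ^ (1 / 2 - p)) := by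
  have h1 : ∀ s : ℝ, ENNReal.ofReal ((A + (2 * Real.pi * s) ^ 2) ^ (-p)) ≤
      ENNReal.ofReal (A ^ (1 - p)) * ENNReal.ofReal (A + (2 * Real.pi * s) ^ 2)⁻¹ := by
    intro s
    rw [← ENNReal.ofReal_mul (by positivity)]
    refine ENNReal.ofReal_le_ofReal ?_
    have h2 : (0 : ℝ) < A + (2 * Real.pi * s) ^ 2 := by positivity
    have h3 : (A + (2 * Real.pi * s) ^ 2) ^ (-p) =
        (A + (2 * Real.pi * s) ^ 2) ^ (1 - p) * (A + (2 * Real.pi * s) ^ 2)⁻¹ := by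
      rw [← Real.rpow_neg_one (A + _), ← Real.rpow_add h2]
      congr 1
      ring
    rw [h3]
    gcongr ?_ * _
    refine Real.rpow_le_rpow_of_nonpos hA ?_ (by linarith)
    have := sq_nonneg (2 * Real.pi * s)
    linarith
  refine (lintegral_mono h1).trans ?_
  rw [lintegral_const_mul' _ _ ENNReal.ofReal_ne_top, lintegral_inv_add_sq hA,
    ← ENNReal.ofReal_mul (by positivity)]
  refine ENNReal.ofReal_le_ofReal ?_
  have h4 : A ^ (1 / 2 - p) = A ^ (1 - p) * (Real.sqrt A)⁻¹ := by
    rw [Real.sqrt_eq_rpow, ← Real.rpow_neg hA.le, ← Real.rpow_add hA]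
    congr 1
    ring
  rw [h4]
  gcongr
  have := Real.sqrt_nonneg A
  linarith

/-- The Cauchy–Schwarz inequality with a weight. -/
theorem lintegral_sq_le_weight {α : Type*} [MeasurableSpace α] {μ : Measure α} {w f : α → ℝ≥0∞}
    (hw : AEMeasurable w μ) (hw0 : ∀ x, w x ≠ 0) (hw1 : ∀ x, w x ≠ ⊤) (hf : AEMeasurable f μ) :
    (∫⁻ x, f x ∂μ) ^ 2 ≤ (∫⁻ x, (w x)⁻¹ ∂μ) * ∫⁻ x, w x * f x ^ 2 ∂μ := by
  have h := ENNReal.lintegral_mul_le_Lp_mul_Lq μ (p := 2) (q := 2)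
    (by constructor <;> norm_num) (f := fun x => (w x)⁻¹ ^ (1 / 2 : ℝ))
    (g := fun x => (w x) ^ (1 / 2 : ℝ) * f x) (hw.inv.pow_const _) ((hw.pow_const _).mul hf)
  have h1 : ∀ x, ((fun x => (w x)⁻¹ ^ (1 / 2 : ℝ)) * fun x => (w x) ^ (1 / 2 : ℝ) * f x) x =
      f x := fun x => by
    simp only [Pi.mul_apply]
    rw [← mul_assoc, ← ENNReal.mul_rpow_of_nonneg _ _ (by norm_num),
      ENNReal.inv_mul_cancel (hw0 x) (hw1 x), ENNReal.one_rpow, one_mul]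
  simp only [h1] at h
  have hsq : ∀ y : ℝ≥0∞, (y ^ (1 / 2 : ℝ)) ^ (2 : ℝ) = y := fun y => by
    rw [← ENNReal.rpow_mul]
    norm_num
  have h2 := pow_le_pow_left₀ (zero_le) h 2
  refine h2.trans (le_of_eq ?_)
  rw [← ENNReal.rpow_natCast, Nat.cast_ofNat, ENNReal.mul_rpow_of_nonneg _ _ (by norm_num), hsq,
    hsq]
  congr 1
  · refine lintegral_congr fun x => ?_
    rw [hsq]
  · refine lintegral_congr fun x => ?_
    rw [ENNReal.mul_rpow_of_nonneg _ _ (by norm_num), hsq, ENNReal.rpow_ofNat]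

end OneDimensionalIntegrals

/-! ### Traces on the hyperplane -/

section Traces

variable {d : ℕ}

/-- `g` is the trace `a|_{xₙ = 0}`: on the Fourier side, restriction to the hyperplane is
integration in the normal frequency. This is meaningful for `a ∈ H¹`, see
`ae_integrable_fourier_glue`. -/
def IsTrace (a : SpaceL2 (d + 1)) (g : SpaceL2 d) : Prop :=
  (𝓕 g : SpaceL2 d) =ᵐ[volume] fun x => ∫ s : ℝ, (𝓕 a : SpaceL2 (d + 1)) (glue d (x, s))

theorem aestronglyMeasurable_comp_glue {f : Eu (d + 1) → ℂ} (hf : AEStronglyMeasurable f) :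
    AEStronglyMeasurable (fun p : Eu d × ℝ => f (glue d p))
      ((volume : Measure (Eu d)).prod (volume : Measure ℝ)) :=
  hf.comp_quasiMeasurePreserving measurePreserving_glue.quasiMeasurePreserving

theorem sobSq_eq_glue (r : ℝ) (a : SpaceL2 (d + 1)) :
    sobSq r a = ∫⁻ x : Eu d, ∫⁻ s : ℝ, ENNReal.ofReal (jap (glue d (x, s)) ^ r) *
      ‖(𝓕 a : SpaceL2 (d + 1)) (glue d (x, s))‖ₑ ^ 2 :=
  lintegral_glue ((by fun_prop : Measurable fun ξ : Eu (d + 1) =>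
    ENNReal.ofReal (jap ξ ^ r)).aemeasurable.mul ((Lp.aestronglyMeasurable _).enorm.pow_const 2))

/-- The inequality behind the trace theorem: Cauchy–Schwarz in the normal frequency. -/
theorem lintegral_slice_sq_le {r : ℝ} (hr : 1 ≤ r) (a : SpaceL2 (d + 1)) :
    ∀ᵐ x : Eu d, (∫⁻ s : ℝ, ‖(𝓕 a : SpaceL2 (d + 1)) (glue d (x, s))‖ₑ) ^ 2 ≤
      ENNReal.ofReal (jap x ^ (1 / 2 - r)) *
        ∫⁻ s : ℝ, ENNReal.ofReal (jap (glue d (x, s)) ^ r) *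
          ‖(𝓕 a : SpaceL2 (d + 1)) (glue d (x, s))‖ₑ ^ 2 := by
  have hm := aestronglyMeasurable_comp_glue
    (Lp.aestronglyMeasurable (𝓕 a : SpaceL2 (d + 1)))
  filter_upwards [hm.prodMk_left] with x hx
  have hw : Measurable fun s : ℝ => ENNReal.ofReal (jap (glue d (x, s)) ^ r) := by fun_prop
  have h1 := lintegral_sq_le_weight (μ := (volume : Measure ℝ)) hw.aemeasurable
    (fun s => (ENNReal.ofReal_pos.2 (Real.rpow_pos_of_pos (jap_pos _) r)).ne')
    (fun s => ENNReal.ofReal_ne_top) hx.enorm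
  refine h1.trans ?_
  gcongr
  have h2 : ∀ s : ℝ, (ENNReal.ofReal (jap (glue d (x, s)) ^ r))⁻¹ =
      ENNReal.ofReal ((jap x + (2 * Real.pi * s) ^ 2) ^ (-r)) := fun s => by
    rw [← ENNReal.ofReal_inv_of_pos (Real.rpow_pos_of_pos (jap_pos _) r),
      ← Real.rpow_neg (jap_pos _).le, jap_glue]
  simp only [h2]
  exact lintegral_rpow_neg_add_sq_le (jap_pos x) hr

theorem ae_slice_sobSq_lt_top {r : ℝ} {a : SpaceL2 (d + 1)} (ha : sobSq r a < ⊤) :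
    ∀ᵐ x : Eu d, ∫⁻ s : ℝ, ENNReal.ofReal (jap (glue d (x, s)) ^ r) *
      ‖(𝓕 a : SpaceL2 (d + 1)) (glue d (x, s))‖ₑ ^ 2 < ⊤ := by
  rw [sobSq_eq_glue] at ha
  refine ae_lt_top' ?_ ha.ne
  have hm := aestronglyMeasurable_comp_glue
    (Lp.aestronglyMeasurable (𝓕 a : SpaceL2 (d + 1)))
  have h1 : Measurable fun p : Eu d × ℝ => ENNReal.ofReal (jap (glue d p) ^ r) := by fun_prop
  exact (h1.aemeasurable.mul (hm.enorm.pow_const 2)).lintegral_prod_right'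

theorem ae_integrable_fourier_glue {a : SpaceL2 (d + 1)} (ha : sobSq 1 a < ⊤) :
    ∀ᵐ x : Eu d, Integrable fun s : ℝ => (𝓕 a : SpaceL2 (d + 1)) (glue d (x, s)) := by
  have hm := aestronglyMeasurable_comp_glue
    (Lp.aestronglyMeasurable (𝓕 a : SpaceL2 (d + 1)))
  filter_upwards [hm.prodMk_left, lintegral_slice_sq_le le_rfl a, ae_slice_sobSq_lt_top ha]
    with x h1 h2 h3
  refine ⟨h1, ?_⟩
  have h4 := h2.trans_lt (ENNReal.mul_lt_top ENNReal.ofReal_lt_top h3)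
  exact (ENNReal.pow_lt_top_iff.1 h4).resolve_right (by norm_num)

theorem lintegral_trace_le {r : ℝ} (hr : 1 ≤ r) (a : SpaceL2 (d + 1)) :
    ∫⁻ x : Eu d, ENNReal.ofReal (jap x ^ (r - 1 / 2)) *
      ‖∫ s : ℝ, (𝓕 a : SpaceL2 (d + 1)) (glue d (x, s))‖ₑ ^ 2 ≤ sobSq r a := by
  rw [sobSq_eq_glue]
  refine lintegral_mono_ae ?_
  filter_upwards [lintegral_slice_sq_le hr a] with x hx
  have h1 := pow_le_pow_left₀ zero_le (enorm_integral_le_lintegral_enorm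
    (μ := (volume : Measure ℝ)) (fun s : ℝ => (𝓕 a : SpaceL2 (d + 1)) (glue d (x, s)))) 2
  refine (mul_le_mul_right (h1.trans hx) _).trans ?_
  rw [← mul_assoc, ← ENNReal.ofReal_mul (Real.rpow_nonneg (jap_pos x).le _),
    ← Real.rpow_add (jap_pos x)]
  simp

theorem exists_isTrace {a : SpaceL2 (d + 1)} (ha : sobSq 1 a < ⊤) : ∃ g, IsTrace a g := by
  refine exists_fourier_ae_eq
    (aestronglyMeasurable_comp_glue (Lp.aestronglyMeasurable _)).integral_prod_right' ?_
  refine lt_of_le_of_lt (lintegral_mono fun x => ?_)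
    ((lintegral_trace_le (d := d) le_rfl a).trans_lt ha)
  refine le_mul_of_one_le_left zero_le ?_
  rw [← ENNReal.ofReal_one]
  exact ENNReal.ofReal_le_ofReal (Real.one_le_rpow (one_le_jap x) (by norm_num))

namespace IsTrace

variable {a b : SpaceL2 (d + 1)} {g h : SpaceL2 d}

/-- The trace loses half a derivative. -/
theorem sobSq_le {r : ℝ} (hr : 1 ≤ r) (H : IsTrace a g) : sobSq (r - 1 / 2) g ≤ sobSq r a := by
  refine le_trans (le_of_eq ?_) (lintegral_trace_le hr a)
  unfold sobSq
  refine lintegral_congr_ae ?_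
  filter_upwards [H] with x hx
  rw [hx]

theorem unique (H : IsTrace a g) (H' : IsTrace a h) : g = h :=
  fourier_injective (Lp.ext (H.trans H'.symm))

theorem sub (ha : sobSq 1 a < ⊤) (hb : sobSq 1 b < ⊤) (H : IsTrace a g) (H' : IsTrace b h) :
    IsTrace (a - b) (g - h) := by
  unfold IsTrace at *
  filter_upwards [H, H', coeFn_fourier_sub g h, ae_glue (coeFn_fourier_sub a b),
    ae_integrable_fourier_glue ha, ae_integrable_fourier_glue hb] with x h1 h2 h3 h4 h5 h6
  rw [h3, h1, h2, ← integral_sub h5 h6]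
  exact (integral_congr_ae h4).symm

theorem add (ha : sobSq 1 a < ⊤) (hb : sobSq 1 b < ⊤) (H : IsTrace a g) (H' : IsTrace b h) :
    IsTrace (a + b) (g + h) := by
  unfold IsTrace at *
  filter_upwards [H, H', coeFn_fourier_add g h, ae_glue (coeFn_fourier_add a b),
    ae_integrable_fourier_glue ha, ae_integrable_fourier_glue hb] with x h1 h2 h3 h4 h5 h6
  rw [h3, h1, h2, ← integral_add h5 h6]
  exact (integral_congr_ae h4).symm

theorem smul (c : ℂ) (H : IsTrace a g) : IsTrace (c • a) (c • g) := by
  unfold IsTrace at *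
  filter_upwards [H, coeFn_fourier_smul c g, ae_glue (coeFn_fourier_smul c a)] with x h1 h2 h3
  rw [h2, h1, ← integral_const_mul]
  exact (integral_congr_ae h3).symm

end IsTrace

theorem schwartz_norm_le_inv (φ : 𝓢(Eu (d + 1), ℂ)) :
    ∃ C : ℝ, ∀ (x : Eu d) (s : ℝ), ‖φ (glue d (x, s))‖ ≤ C * (1 + s ^ 2)⁻¹ := by
  refine ⟨SchwartzMap.seminorm ℝ 0 0 φ + SchwartzMap.seminorm ℝ 2 0 φ, fun x s => ?_⟩
  rw [← div_eq_mul_inv, le_div_iff₀ (by positivity), mul_add, mul_one]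
  refine add_le_add (φ.norm_le_seminorm ℝ _) ?_
  refine le_trans ?_ (φ.norm_pow_mul_le_seminorm ℝ 2 (glue d (x, s)))
  rw [mul_comm, norm_sq_glue]
  gcongr
  have := sq_nonneg ‖x‖
  simp only
  linarith

/-- For Schwartz functions the trace is the restriction: integrate the Fourier inversion formula
over the normal frequency. -/
theorem fourier_slice_zero (φ : 𝓢(Eu (d + 1), ℂ)) (ξ : Eu d) :
    (𝓕 (slice 0 φ) : 𝓢(Eu d, ℂ)) ξ = ∫ s : ℝ, (𝓕 φ : 𝓢(Eu (d + 1), ℂ)) (glue d (ξ, s)) := by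
  set ψ : 𝓢(Eu (d + 1), ℂ) := 𝓕 φ with hψ
  have hφ : φ = 𝓕⁻ ψ := (FourierTransform.fourierInv_fourier_eq φ).symm
  let H : Eu d → ℂ := fun ξ => ∫ s : ℝ, ψ (glue d (ξ, s))
  have hint : Integrable (fun p : Eu d × ℝ => ψ (glue d p))
      ((volume : Measure (Eu d)).prod (volume : Measure ℝ)) :=
    (measurePreserving_glue.integrable_comp_emb measurableEmbedding_glue).2 ψ.integrable
  have hHint : Integrable H := hint.integral_prod_left
  have hHc : Continuous H := by
    obtain ⟨C, hC⟩ := schwartz_norm_le_inv ψ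
    refine continuous_of_dominated (fun x => ?_) (fun x => ae_of_all _ fun s => hC x s)
      (integrable_inv_one_add_sq.const_mul C) (ae_of_all _ fun s => ?_)
    · exact (ψ.continuous.comp ((glue d).continuous.comp (by fun_prop))).aestronglyMeasurable
    · exact ψ.continuous.comp ((glue d).continuous.comp (by fun_prop))
  have hinv : (slice 0 φ : Eu d → ℂ) = 𝓕⁻ H := by
    ext x
    rw [slice_apply, hφ, SchwartzMap.fourierInv_coe, Real.fourierInv_eq', Real.fourierInv_eq',
      integral_glue]
    · refine integral_congr_ae (ae_of_all _ fun ξ => ?_)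
      simp only [inner_glue, mul_zero, add_zero, H]
      exact integral_smul _ _
    · refine ψ.integrable.bdd_smul (φ := fun v : Eu (d + 1) =>
        Complex.exp ((2 * Real.pi * inner ℝ v (glue d (x, 0)) : ℝ) * Complex.I)) 1 ?_ ?_
      · exact Continuous.aestronglyMeasurable (by fun_prop)
      · exact ae_of_all _ fun v => (Complex.norm_exp_ofReal_mul_I _).le
  have hFint : Integrable (𝓕 H) := by
    have h1 : 𝓕 H = fun x => (slice 0 φ : Eu d → ℂ) (-x) := by
      ext x
      rw [hinv, Real.fourierInv_eq_fourier_neg, neg_neg]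
    rw [h1]
    exact (slice 0 φ).integrable.comp_neg
  have h2 := hHc.fourier_fourierInv_eq hHint hFint
  rw [SchwartzMap.fourier_coe, hinv, h2]

theorem isTrace_toL2 (φ : 𝓢(Eu (d + 1), ℂ)) : IsTrace (toL2 φ) (toL2 (slice 0 φ)) := by
  unfold IsTrace
  rw [fourier_toL2, fourier_toL2]
  filter_upwards [coeFn_toL2 (𝓕 (slice 0 φ)), ae_glue (coeFn_toL2 (𝓕 φ))] with x h1 h2
  rw [h1, fourier_slice_zero]
  exact (integral_congr_ae h2).symm

end Traces

/-! ### Bounds for derivatives -/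

section DerivativeBounds

variable {m : ℕ}

theorem norm_derivSymbol_sq_le (v ξ : Eu m) : ‖derivSymbol v ξ‖ ^ 2 ≤ ‖v‖ ^ 2 * jap ξ := by
  unfold derivSymbol jap
  rw [norm_mul, norm_mul, norm_mul, Complex.norm_I, Complex.norm_real, Complex.norm_real,
    mul_one, norm_smul]
  have h := abs_real_inner_le_norm ξ v
  rw [Complex.norm_ofNat, mul_pow, norm_mul, Real.norm_ofNat]
  have h2 : ‖(inner ℝ ξ v : ℝ)‖ ^ 2 ≤ (‖ξ‖ * ‖v‖) ^ 2 := by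
    gcongr
    exact h
  have h3 : 0 ≤ ‖v‖ ^ 2 := by positivity
  calc (2 * ‖Real.pi‖) ^ 2 * ‖(inner ℝ ξ v : ℝ)‖ ^ 2
      ≤ (2 * ‖Real.pi‖) ^ 2 * (‖ξ‖ * ‖v‖) ^ 2 := by gcongr
    _ ≤ ‖v‖ ^ 2 * (1 + (2 * ‖Real.pi‖ * ‖ξ‖) ^ 2) := by nlinarith

theorem norm_lapSymbol_le (ξ : Eu m) : ‖lapSymbol ξ‖ ≤ jap ξ := by
  unfold lapSymbol jap
  rw [norm_neg, Complex.norm_real, Real.norm_of_nonneg (by positivity)]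
  linarith

@[fun_prop]
theorem measurable_derivSymbol (v : Eu m) : Measurable (derivSymbol v) :=
  (derivSymbol_hasTemperateGrowth v).1.continuous.measurable

@[fun_prop]
theorem measurable_lapSymbol : Measurable (lapSymbol (m := m)) :=
  lapSymbol_hasTemperateGrowth.1.continuous.measurable

theorem sobSq_deriv_le {v : Eu m} {a b : SpaceL2 m} (h : IsMul (derivSymbol v) a b) (s : ℝ) :
    sobSq s b ≤ ENNReal.ofReal (‖v‖ ^ 2) * sobSq (s + 1) a := by
  refine h.sobSq_le (by positivity) fun ξ => ?_
  rw [Real.rpow_add_one (jap_pos ξ).ne']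
  have h1 := norm_derivSymbol_sq_le v ξ
  have h2 : 0 ≤ jap ξ ^ s := Real.rpow_nonneg (jap_pos ξ).le _
  nlinarith [mul_le_mul_of_nonneg_left h1 h2]

theorem sobSq_lap_le {a b : SpaceL2 m} (h : IsMul lapSymbol a b) (s : ℝ) :
    sobSq s b ≤ sobSq (s + 2) a := by
  refine (h.sobSq_le zero_le_one (r := s + 2) fun ξ => ?_).trans (by simp)
  rw [Real.rpow_add (jap_pos ξ), one_mul]
  rw [Real.rpow_two]
  exact mul_le_mul_of_nonneg_left (pow_le_pow_left₀ (norm_nonneg _) (norm_lapSymbol_le ξ) 2)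
    (Real.rpow_nonneg (jap_pos ξ).le _)

theorem exists_deriv (v : Eu m) {a : SpaceL2 m} (ha : sobSq 1 a < ⊤) :
    ∃ b, IsMul (derivSymbol v) a b :=
  exists_isMul (measurable_derivSymbol v) (sq_nonneg ‖v‖) (r := 1)
    (fun ξ => by simpa using norm_derivSymbol_sq_le v ξ) ha

theorem exists_lap {a : SpaceL2 m} (ha : sobSq 2 a < ⊤) : ∃ b, IsMul lapSymbol a b :=
  exists_isMul measurable_lapSymbol zero_le_one (r := 2)
    (fun ξ => by
      rw [one_mul, Real.rpow_two]
      exact pow_le_pow_left₀ (norm_nonneg _) (norm_lapSymbol_le ξ) 2) ha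

theorem sobSq_deriv_lt_top {v : Eu m} {a b : SpaceL2 m} (h : IsMul (derivSymbol v) a b) {s : ℝ}
    (ha : sobSq (s + 1) a < ⊤) : sobSq s b < ⊤ :=
  (sobSq_deriv_le h s).trans_lt (ENNReal.mul_lt_top ENNReal.ofReal_lt_top ha)

theorem tendsto_of_enorm_sub_sq {α : Type*} [MeasurableSpace α] {μ : Measure α} {a : Lp ℂ 2 μ}
    {u : ℕ → Lp ℂ 2 μ} (h : Tendsto (fun j => ‖a - u j‖ₑ ^ 2) atTop (𝓝 0)) :
    Tendsto u atTop (𝓝 a) := by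
  have h1 : Tendsto (fun j => (‖a - u j‖ₑ ^ 2) ^ (1 / 2 : ℝ)) atTop (𝓝 0) := by
    have := h.ennrpow_const (1 / 2 : ℝ)
    rwa [ENNReal.zero_rpow_of_pos (by norm_num)] at this
  have h2 : ∀ j, (‖a - u j‖ₑ ^ 2) ^ (1 / 2 : ℝ) = edist (u j) a := fun j => by
    rw [← ENNReal.rpow_natCast, ← ENNReal.rpow_mul, edist_comm, edist_eq_enorm_sub]
    norm_num
  simp only [h2] at h1
  exact tendsto_iff_edist_tendsto_0.2 h1

theorem exists_schwartz_seq {r : ℝ} {a : SpaceL2 m} (ha : sobSq r a < ⊤) :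
    ∃ φ : ℕ → 𝓢(Eu m, ℂ), Tendsto (fun j => sobSq r (a - toL2 (φ j))) atTop (𝓝 0) := by
  have h : ∀ j : ℕ, ∃ φ : 𝓢(Eu m, ℂ), sobSq r (a - toL2 φ) < ((j : ℝ≥0∞) + 1)⁻¹ := fun j =>
    exists_schwartz_approx ha (by simp)
  choose φ hφ using h
  refine ⟨φ, tendsto_of_tendsto_of_tendsto_of_le_of_le tendsto_const_nhds ?_ (fun _ => zero_le)
    fun j => (hφ j).le⟩
  have := (tendsto_add_atTop_iff_nat 1).2 ENNReal.tendsto_inv_nat_nhds_zero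
  simpa using this

theorem sobSq_toL2_lt_top (r : ℝ) (φ : 𝓢(Eu m, ℂ)) : sobSq r (toL2 φ) < ⊤ := by
  let J : Eu m → ℂ := fun ξ => ((1 + ‖(2 * Real.pi) • ξ‖ ^ 2) ^ (r / 2) : ℝ)
  have hJ : J.HasTemperateGrowth := by
    have h1 : (fun ξ : Eu m => (1 + ‖(2 * Real.pi) • ξ‖ ^ 2) ^ (r / 2)).HasTemperateGrowth :=
      (by fun_prop : (fun ξ : Eu m => (1 + ‖ξ‖ ^ 2) ^ (r / 2)).HasTemperateGrowth).comp
        (by fun_prop : (fun ξ : Eu m => (2 * Real.pi) • ξ).HasTemperateGrowth)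
    exact Complex.ofRealCLM.hasTemperateGrowth.comp h1
  refine lt_of_eq_of_lt ?_ (ENNReal.pow_lt_top (n := 2)
    (enorm_lt_top (x := toL2 (smulLeftCLM ℂ J (𝓕 φ)))))
  rw [enorm_sq_eq_lintegral]
  unfold sobSq
  rw [fourier_toL2]
  refine lintegral_congr_ae ?_
  filter_upwards [coeFn_toL2 (𝓕 φ), coeFn_toL2 (smulLeftCLM ℂ J (𝓕 φ))] with ξ h1 h2
  rw [h1, h2, smulLeftCLM_apply_apply hJ, smul_eq_mul, enorm_mul, mul_pow]
  congr 1
  change _ = ‖((jap ξ ^ (r / 2) : ℝ) : ℂ)‖ₑ ^ 2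
  rw [← ofReal_norm, ← ENNReal.ofReal_pow (norm_nonneg _), Complex.norm_real, Real.norm_eq_abs,
    sq_abs, ← Real.rpow_natCast, ← Real.rpow_mul (jap_pos ξ).le]
  norm_num

end DerivativeBounds

/-! ### The Gauss–Green formula and trace inequalities on the half space -/

section GaussGreen

variable {d : ℕ}

/-- Complex valued `L²(ℝⁿ₊)`, `n = d + 1`. -/
abbrev HalfL2 (d : ℕ) : Type := Lp ℂ 2 ((volume : Measure (Eu (d + 1))).restrict (halfE d))

/-- The restriction `L²(ℝⁿ) → L²(ℝⁿ₊)`. -/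
def resHalf (d : ℕ) : SpaceL2 (d + 1) →L[ℂ] HalfL2 d :=
  LpToLpRestrictCLM (Eu (d + 1)) ℂ ℂ volume 2 (halfE d)

theorem coeFn_resHalf (a : SpaceL2 (d + 1)) :
    resHalf d a =ᵐ[volume.restrict (halfE d)] a :=
  LpToLpRestrictCLM_coeFn ℂ (halfE d) a

theorem resHalf_eq_iff {a b : SpaceL2 (d + 1)} :
    resHalf d a = resHalf d b ↔ ∀ᵐ x, x ∈ halfE d → a x = b x := by
  rw [← ae_restrict_iff' measurableSet_halfE]
  constructor
  · intro h
    filter_upwards [coeFn_resHalf a, coeFn_resHalf b] with x h1 h2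
    rw [← h1, ← h2, h]
  · intro h
    refine Lp.ext ?_
    filter_upwards [coeFn_resHalf a, coeFn_resHalf b, h] with x h1 h2 h3
    rw [h1, h2, h3]

theorem enorm_resHalf_sq_le (a : SpaceL2 (d + 1)) : ‖resHalf d a‖ₑ ^ 2 ≤ ‖a‖ₑ ^ 2 := by
  rw [enorm_sq_eq_lintegral, enorm_sq_eq_lintegral]
  refine le_trans (le_of_eq ?_) (setLIntegral_le_lintegral (halfE d) _)
  refine lintegral_congr_ae ?_
  filter_upwards [coeFn_resHalf a] with x hx
  rw [hx]

theorem inner_resHalf (a b : SpaceL2 (d + 1)) : inner ℂ (resHalf d a) (resHalf d b) =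
    ∫ x in halfE d, (starRingEnd ℂ) (a x) * b x := by
  rw [L2.inner_def]
  refine integral_congr_ae ?_
  filter_upwards [coeFn_resHalf a, coeFn_resHalf b] with x h1 h2
  rw [h1, h2, RCLike.inner_apply, mul_comm]

/-- The Gauss–Green formula on the half space for functions in `H¹`. -/
theorem inner_resHalf_deriv {v : Eu (d + 1)} {a a' b b' : SpaceL2 (d + 1)} {g h : SpaceL2 d}
    (ha : sobSq 1 a < ⊤) (hb : sobSq 1 b < ⊤) (Da : IsMul (derivSymbol v) a a')
    (Db : IsMul (derivSymbol v) b b') (Ta : IsTrace a g) (Tb : IsTrace b h) :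
    inner ℂ (resHalf d a') (resHalf d b) + inner ℂ (resHalf d a) (resHalf d b') =
      -(v (Fin.last d) : ℂ) * inner ℂ g h := by
  -- for Schwartz functions this is the divergence theorem
  have key : ∀ φ ψ : 𝓢(Eu (d + 1), ℂ),
      inner ℂ (resHalf d (toL2 (∂_{v} φ))) (resHalf d (toL2 ψ)) +
        inner ℂ (resHalf d (toL2 φ)) (resHalf d (toL2 (∂_{v} ψ))) =
      -(v (Fin.last d) : ℂ) * inner ℂ (toL2 (slice 0 φ)) (toL2 (slice 0 ψ)) := by
    intro φ ψ
    have h0 := setIntegral_halfE_lineDeriv (conjMul φ ψ) v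
    simp only [lineDeriv_conjMul] at h0
    have hi : ∀ φ ψ : 𝓢(Eu (d + 1), ℂ), IntegrableOn (fun x => (starRingEnd ℂ) (φ x) * ψ x)
        (halfE d) := fun φ ψ => (conjMul φ ψ).integrable.integrableOn
    rw [integral_add (hi _ _) (hi _ _)] at h0
    have h1 : ∀ φ ψ : 𝓢(Eu (d + 1), ℂ), inner ℂ (resHalf d (toL2 φ)) (resHalf d (toL2 ψ)) =
        ∫ x in halfE d, (starRingEnd ℂ) (φ x) * ψ x := fun φ ψ => by
      rw [inner_resHalf]
      refine setIntegral_congr_ae measurableSet_halfE ?_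
      filter_upwards [coeFn_toL2 φ, coeFn_toL2 ψ] with x h1 h2 _
      rw [h1, h2]
    rw [h1, h1, h0, L2.inner_def]
    congr 1
    refine integral_congr_ae ?_
    filter_upwards [coeFn_toL2 (slice 0 φ), coeFn_toL2 (slice 0 ψ)] with x h1 h2
    rw [h1, h2, RCLike.inner_apply, mul_comm]
    rfl
  -- the general case follows by density
  have lim : ∀ {a a' : SpaceL2 (d + 1)} {g : SpaceL2 d}, sobSq 1 a < ⊤ →
      IsMul (derivSymbol v) a a' → IsTrace a g → ∃ φ : ℕ → 𝓢(Eu (d + 1), ℂ),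
        Tendsto (fun j => toL2 (φ j)) atTop (𝓝 a) ∧
        Tendsto (fun j => toL2 (∂_{v} (φ j))) atTop (𝓝 a') ∧
        Tendsto (fun j => toL2 (slice 0 (φ j))) atTop (𝓝 g) := by
    intro a a' g ha Da Ta
    obtain ⟨φ, hφ⟩ := exists_schwartz_seq ha
    refine ⟨φ, tendsto_of_enorm_sub_sq ?_, tendsto_of_enorm_sub_sq ?_, tendsto_of_enorm_sub_sq ?_⟩
    · exact tendsto_of_tendsto_of_tendsto_of_le_of_le tendsto_const_nhds hφ (fun _ => zero_le)
        fun j => enorm_sq_le_sobSq zero_le_one _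
    · have h1 : Tendsto (fun j => ENNReal.ofReal (‖v‖ ^ 2) * sobSq 1 (a - toL2 (φ j))) atTop
          (𝓝 0) := by
        have := ENNReal.Tendsto.const_mul (a := ENNReal.ofReal (‖v‖ ^ 2)) hφ
          (Or.inr ENNReal.ofReal_ne_top)
        rwa [mul_zero] at this
      refine tendsto_of_tendsto_of_tendsto_of_le_of_le tendsto_const_nhds h1 (fun _ => zero_le)
        fun j => ?_
      have h2 := sobSq_deriv_le (Da.sub (isMul_lineDeriv (φ j) v)) 0
      rwa [sobSq_zero_order, zero_add] at h2
    · refine tendsto_of_tendsto_of_tendsto_of_le_of_le tendsto_const_nhds hφ (fun _ => zero_le)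
        fun j => ?_
      refine (enorm_sq_le_sobSq (by norm_num) _).trans
        (IsTrace.sobSq_le le_rfl (Ta.sub ha (sobSq_toL2_lt_top 1 _) (isTrace_toL2 (φ j))))
  obtain ⟨φ, h1, h2, h3⟩ := lim ha Da Ta
  obtain ⟨ψ, k1, k2, k3⟩ := lim hb Db Tb
  have hr := (resHalf d).continuous
  have hL := (((hr.tendsto _).comp h2).inner (𝕜 := ℂ) ((hr.tendsto _).comp k1)).add
    (((hr.tendsto _).comp h1).inner (𝕜 := ℂ) ((hr.tendsto _).comp k2))
  have hR := (h3.inner (𝕜 := ℂ) k3).const_mul (-(v (Fin.last d) : ℂ))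
  exact tendsto_nhds_unique hL (hR.congr fun j => (key (φ j) (ψ j)).symm)

/-- A function vanishes on the half space if it is annihilated by the test functions there. -/
theorem resHalf_eq_zero_of_integral {a : SpaceL2 (d + 1)}
    (h : ∀ φ : 𝓢(Eu (d + 1), ℂ), HasCompactSupport φ → tsupport φ ⊆ halfE d →
      ∫ x, φ x * a x = 0) : resHalf d a = 0 := by
  have h0 := isOpen_halfE.ae_eq_zero_of_integral_contDiff_smul_eq_zero
    (((Lp.memLp a).locallyIntegrable (by norm_num)).locallyIntegrableOn (halfE d))
    fun g hg hgs hgt => ?_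
  · rw [← map_zero (resHalf d), resHalf_eq_iff]
    filter_upwards [h0, Lp.coeFn_zero ℂ 2 (volume : Measure (Eu (d + 1)))] with x hx h1 hxs
    rw [hx hxs, h1]
    rfl
  · let ψ : 𝓢(Eu (d + 1), ℂ) := HasCompactSupport.toSchwartzMap (f := fun x => (g x : ℂ))
      (hgs.comp_left (g := fun y : ℝ => (y : ℂ)) rfl) (Complex.ofRealCLM.contDiff.comp hg)
    have hψs : tsupport ψ ⊆ tsupport g :=
      closure_mono fun x hx => fun h => hx (by change ((g x : ℝ) : ℂ) = 0; rw [h]; rfl)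
    have := h ψ (hgs.comp_left (g := fun y : ℝ => (y : ℂ)) rfl) (hψs.trans hgt)
    exact this

theorem integral_mul_eq_zero_of_resHalf_eq_zero {a : SpaceL2 (d + 1)} (ha : resHalf d a = 0)
    {φ : Eu (d + 1) → ℂ} (hφ : tsupport φ ⊆ halfE d) : ∫ x, φ x * a x = 0 := by
  rw [← map_zero (resHalf d), resHalf_eq_iff] at ha
  rw [integral_eq_zero_of_ae]
  filter_upwards [ha, Lp.coeFn_zero ℂ 2 (volume : Measure (Eu (d + 1)))] with x hx h0
  by_cases h : x ∈ halfE d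
  · simp [hx h]
  · have : φ x = 0 := image_eq_zero_of_notMem_tsupport fun hx' => h (hφ hx')
    simp [this]

/-- Derivatives are local. -/
theorem resHalf_deriv_eq_zero {v : Eu (d + 1)} {a b : SpaceL2 (d + 1)}
    (h : IsMul (derivSymbol v) a b) (ha : resHalf d a = 0) : resHalf d b = 0 := by
  refine resHalf_eq_zero_of_integral fun φ _ hφ => ?_
  rw [isMul_derivSymbol_iff.1 h φ, integral_mul_eq_zero_of_resHalf_eq_zero ha, neg_zero]
  exact (tsupport_lineDerivOp_subset v φ).trans hφ

theorem tsupport_laplacian_subset {m : ℕ} (φ : 𝓢(Eu m, ℂ)) :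
    tsupport (Δ φ : 𝓢(Eu m, ℂ)) ⊆ tsupport φ := by
  refine closure_minimal (fun x hx => ?_) (isClosed_tsupport _)
  by_contra h
  refine hx ?_
  rw [laplacian_eq_sum_single, _root_.sum_apply]
  refine Finset.sum_eq_zero fun i _ => ?_
  refine image_eq_zero_of_notMem_tsupport fun h2 => h ?_
  exact ((tsupport_lineDerivOp_subset _ _).trans (tsupport_lineDerivOp_subset _ φ)) h2

/-- The multiplicative trace inequality. -/
theorem norm_trace_sq_le {a a' : SpaceL2 (d + 1)} {g : SpaceL2 d} (ha : sobSq 1 a < ⊤)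
    (Da : IsMul (derivSymbol (normal d)) a a') (Ta : IsTrace a g) :
    ‖g‖ ^ 2 ≤ 2 * (‖resHalf d a‖ * ‖resHalf d a'‖) := by
  have h := inner_resHalf_deriv ha ha Da Da Ta Ta
  have h1 : ((normal d) (Fin.last d) : ℂ) = 1 := by simp
  rw [h1, inner_self_eq_norm_sq_to_K] at h
  have h3 := congrArg norm h
  have h4 : ‖(-1 : ℂ) * (RCLike.ofReal ‖g‖ : ℂ) ^ 2‖ = ‖g‖ ^ 2 := by simp
  rw [h4] at h3
  rw [← h3]
  refine (norm_add_le _ _).trans ?_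
  have h5 := norm_inner_le_norm (𝕜 := ℂ) (resHalf d a') (resHalf d a)
  have h6 := norm_inner_le_norm (𝕜 := ℂ) (resHalf d a) (resHalf d a')
  linarith [mul_comm ‖resHalf d a'‖ ‖resHalf d a‖]

/-- The trace depends only on the restriction to the half space. -/
theorem trace_eq_zero_of_resHalf_eq_zero {a : SpaceL2 (d + 1)} {g : SpaceL2 d}
    (ha : sobSq 1 a < ⊤) (Ta : IsTrace a g) (h0 : resHalf d a = 0) : g = 0 := by
  obtain ⟨a', Da⟩ := exists_deriv (normal d) ha
  have h := norm_trace_sq_le ha Da Ta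
  rw [h0, norm_zero, zero_mul, mul_zero] at h
  exact norm_eq_zero.1 (pow_eq_zero_iff (two_ne_zero)|>.1 (le_antisymm h (sq_nonneg _)))

/-- Interpolation on the half space: the trace of `p` is controlled by `p` and its second normal
derivative. -/
theorem norm_trace_pow_four_le {p q r : SpaceL2 (d + 1)} {g : SpaceL2 d} (hp : sobSq 2 p < ⊤)
    (Dp : IsMul (derivSymbol (normal d)) p q) (Dq : IsMul (derivSymbol (normal d)) q r)
    (Tp : IsTrace p g) :
    ‖g‖ ^ 4 ≤ 24 * (‖resHalf d p‖ ^ 3 * ‖resHalf d r‖) := by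
  have hp1 : sobSq 1 p < ⊤ := (sobSq_mono (by norm_num) p).trans_lt hp
  have hq1 : sobSq 1 q < ⊤ := sobSq_deriv_lt_top Dp (by norm_num; exact hp)
  obtain ⟨k, Tq⟩ := exists_isTrace hq1
  have h1 := norm_trace_sq_le hp1 Dp Tp
  have h2 := norm_trace_sq_le hq1 Dq Tq
  -- Integrate by parts to control `q = ∂ₙ p` by `p`, `r = ∂ₙ² p` and the traces `g`, `k` of `p`,
  -- `q`; the traces are absorbed by the multiplicative trace inequality.
  have h3 := inner_resHalf_deriv hp1 hq1 Dp Dq Tp Tq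
  have h4 : ‖resHalf d q‖ ^ 2 ≤ ‖resHalf d p‖ * ‖resHalf d r‖ + ‖g‖ * ‖k‖ := by
    have e1 : inner ℂ (resHalf d q) (resHalf d q) = -inner ℂ g k -
        inner ℂ (resHalf d p) (resHalf d r) := by
      rw [eq_sub_iff_add_eq, h3]
      simp
    have e2 := congrArg norm e1
    rw [inner_self_eq_norm_sq_to_K] at e2
    have e3 : ‖(RCLike.ofReal ‖resHalf d q‖ : ℂ) ^ 2‖ = ‖resHalf d q‖ ^ 2 := by simp
    rw [e3] at e2
    rw [e2]
    refine (norm_sub_le _ _).trans ?_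
    rw [norm_neg, add_comm]
    exact add_le_add (norm_inner_le_norm _ _) (norm_inner_le_norm _ _)
  set P := ‖resHalf d p‖
  set Q := ‖resHalf d q‖
  set R := ‖resHalf d r‖
  have hP : 0 ≤ P := norm_nonneg _
  have hQ : 0 ≤ Q := norm_nonneg _
  have hR : 0 ≤ R := norm_nonneg _
  have h5 : ‖g‖ * ‖k‖ ≤ Q ^ 2 / 2 + 2 * (P * R) := by
    refine le_of_sq_le_sq ?_ (by positivity)
    calc (‖g‖ * ‖k‖) ^ 2 = ‖g‖ ^ 2 * ‖k‖ ^ 2 := by ring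
      _ ≤ (2 * (P * Q)) * (2 * (Q * R)) := by gcongr
      _ ≤ (Q ^ 2 / 2 + 2 * (P * R)) ^ 2 := by nlinarith [sq_nonneg (Q ^ 2 / 2 - 2 * (P * R))]
  have h6 : Q ^ 2 ≤ 6 * (P * R) := by linarith
  calc ‖g‖ ^ 4 = (‖g‖ ^ 2) ^ 2 := by ring
    _ ≤ (2 * (P * Q)) ^ 2 := by gcongr
    _ = 4 * P ^ 2 * Q ^ 2 := by ring
    _ ≤ 4 * P ^ 2 * (6 * (P * R)) := by gcongr
    _ = 24 * (P ^ 3 * R) := by ring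

end GaussGreen

/-! ### Extension by reflection -/

section Reflection

variable {d : ℕ}

/-- The reflection `(x', xₙ) ↦ (x', -xₙ)`. -/
def refl (d : ℕ) : Eu (d + 1) ≃ₗᵢ[ℝ] Eu (d + 1) where
  toLinearEquiv := ((glue d).symm.toLinearEquiv.trans
    ((LinearEquiv.refl ℝ (Eu d)).prodCongr (LinearEquiv.neg ℝ))).trans (glue d).toLinearEquiv
  norm_map' x := by
    obtain ⟨p, rfl⟩ := (glue d).surjective x
    rw [← sq_eq_sq₀ (norm_nonneg _) (norm_nonneg _), norm_sq_glue]
    have : (((glue d).symm.toLinearEquiv.trans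
      ((LinearEquiv.refl ℝ (Eu d)).prodCongr (LinearEquiv.neg ℝ))).trans (glue d).toLinearEquiv)
        (glue d p) = glue d (p.1, -p.2) := by
      simp
    rw [this, norm_sq_glue]
    simp

theorem refl_glue (x : Eu d) (s : ℝ) : refl d (glue d (x, s)) = glue d (x, -s) := by
  change (glue d) (((LinearEquiv.refl ℝ (Eu d)).prodCongr (LinearEquiv.neg ℝ))
    ((glue d).symm (glue d (x, s)))) = _
  simp

theorem refl_last (x : Eu (d + 1)) : refl d x (Fin.last d) = -x (Fin.last d) := by
  obtain ⟨p, rfl⟩ := (glue d).surjective x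
  rw [refl_glue]
  simp

theorem refl_castSucc (x : Eu (d + 1)) (i : Fin d) : refl d x i.castSucc = x i.castSucc := by
  obtain ⟨p, rfl⟩ := (glue d).surjective x
  rw [refl_glue]
  simp

theorem refl_refl (x : Eu (d + 1)) : refl d (refl d x) = x := by
  obtain ⟨⟨x, s⟩, rfl⟩ := (glue d).surjective x
  rw [refl_glue, refl_glue, neg_neg]

theorem measurePreserving_refl : MeasurePreserving (refl d) volume volume :=
  (refl d).measurePreserving

theorem measurableEmbedding_refl : MeasurableEmbedding (refl d) :=
  (refl d).toHomeomorph.measurableEmbedding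

/-- The sign by which the reflection acts on the `i`-th coordinate. -/
def reflSign (d : ℕ) (i : Fin (d + 1)) : ℝ := if i = Fin.last d then -1 else 1

theorem refl_single (i : Fin (d + 1)) :
    refl d (EuclideanSpace.single i 1) = reflSign d i • EuclideanSpace.single i (1 : ℝ) := by
  ext j
  refine Fin.lastCases ?_ (fun j => ?_) j
  · rw [refl_last]
    by_cases h : i = Fin.last d
    · simp [h, reflSign]
    · simp [Ne.symm h]
  · rw [refl_castSucc]
    by_cases h : i = Fin.last d
    · simp [h, Fin.castSucc_ne_last]
    · simp [reflSign, h]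

theorem ae_last_ne_zero : ∀ᵐ x : Eu (d + 1), x (Fin.last d) ≠ 0 := by
  have h : MeasurableSet {x : Eu (d + 1) | x (Fin.last d) ≠ 0} :=
    (isOpen_ne_fun (by fun_prop) continuous_const).measurableSet
  have h1 : ∀ᵐ p : Eu d × ℝ, (glue d p) (Fin.last d) ≠ 0 := by
    simp only [glue_last]
    have h2 : ∀ᵐ s : ℝ, s ≠ 0 := by
      simp [ae_iff]
    exact (Measure.quasiMeasurePreserving_snd (μ := (volume : Measure (Eu d)))).ae h2
  rw [← measurePreserving_glue.map_eq]
  exact (ae_map_iff (glue d).continuous.measurable.aemeasurable h).2 h1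

theorem setLIntegral_compl_halfE (f : Eu (d + 1) → ℝ≥0∞) :
    ∫⁻ x in (halfE d)ᶜ, f x = ∫⁻ x in halfE d, f (refl d x) := by
  rw [← measurePreserving_refl.setLIntegral_comp_preimage_emb measurableEmbedding_refl]
  refine setLIntegral_congr ?_
  filter_upwards [ae_last_ne_zero] with x hx
  refine propext ?_
  change ¬ (0 < refl d x (Fin.last d)) ↔ 0 < x (Fin.last d)
  rw [refl_last, not_lt, neg_nonpos]
  exact ⟨fun h => lt_of_le_of_ne h (Ne.symm hx), le_of_lt⟩

theorem setIntegral_compl_halfE (f : Eu (d + 1) → ℂ) :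
    ∫ x in (halfE d)ᶜ, f x = ∫ x in halfE d, f (refl d x) := by
  rw [← measurePreserving_refl.setIntegral_preimage_emb measurableEmbedding_refl]
  refine setIntegral_congr_set ?_
  filter_upwards [ae_last_ne_zero] with x hx
  refine propext ?_
  change ¬ (0 < refl d x (Fin.last d)) ↔ 0 < x (Fin.last d)
  rw [refl_last, not_lt, neg_nonpos]
  exact ⟨fun h => lt_of_le_of_ne h (Ne.symm hx), le_of_lt⟩

open Classical in
/-- The map `(x', xₙ) ↦ (x', |xₙ|)`. -/
def foldMap (d : ℕ) (x : Eu (d + 1)) : Eu (d + 1) := if x ∈ halfE d then x else refl d x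

theorem foldMap_of_mem {x : Eu (d + 1)} (hx : x ∈ halfE d) : foldMap d x = x := if_pos hx

theorem refl_notMem {x : Eu (d + 1)} (hx : x ∈ halfE d) : refl d x ∉ halfE d := by
  simp only [halfE, Set.mem_ofPred_eq, refl_last, not_lt] at *
  linarith

theorem foldMap_refl {x : Eu (d + 1)} (hx : x ∈ halfE d) : foldMap d (refl d x) = x := by
  rw [foldMap, if_neg (refl_notMem hx), refl_refl]

theorem measurable_foldMap : Measurable (foldMap d) :=
  Measurable.ite measurableSet_halfE measurable_id (refl d).continuous.measurable

theorem quasiMeasurePreserving_foldMap :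
    Measure.QuasiMeasurePreserving (foldMap d) volume (volume.restrict (halfE d)) := by
  refine ⟨measurable_foldMap, Measure.AbsolutelyContinuous.mk fun s hs h0 => ?_⟩
  rw [Measure.map_apply measurable_foldMap hs, ← lintegral_indicator_one (measurable_foldMap hs),
    ← lintegral_add_compl _ (measurableSet_halfE (d := d)), setLIntegral_compl_halfE]
  have h1 : ∫⁻ x in halfE d, s.indicator (1 : Eu (d + 1) → ℝ≥0∞) x = 0 := by
    rw [lintegral_indicator_one hs, h0]
  have h2 : ∀ x, (foldMap d ⁻¹' s).indicator (1 : Eu (d + 1) → ℝ≥0∞) x =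
      s.indicator 1 (foldMap d x) := fun x => rfl
  simp only [h2]
  rw [setLIntegral_congr_fun measurableSet_halfE fun x hx => by rw [foldMap_of_mem hx], h1,
    setLIntegral_congr_fun measurableSet_halfE fun x hx => by rw [foldMap_refl hx], h1, add_zero]

open Classical in
/-- The factor `1` on the half space and `c` on its complement. -/
def sideFactor (d : ℕ) (c : ℂ) (x : Eu (d + 1)) : ℂ := if x ∈ halfE d then 1 else c

theorem sideFactor_of_mem {c : ℂ} {x : Eu (d + 1)} (hx : x ∈ halfE d) : sideFactor d c x = 1 :=
  if_pos hx

theorem sideFactor_refl {c : ℂ} {x : Eu (d + 1)} (hx : x ∈ halfE d) :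
    sideFactor d c (refl d x) = c := if_neg (refl_notMem hx)

theorem measurable_sideFactor (c : ℂ) : Measurable (sideFactor d c) :=
  Measurable.ite measurableSet_halfE measurable_const measurable_const

theorem lintegral_foldMap (c : ℂ) (f : Eu (d + 1) → ℂ) :
    ∫⁻ x, ‖sideFactor d c x * f (foldMap d x)‖ₑ ^ 2 =
      (1 + ‖c‖ₑ ^ 2) * ∫⁻ x in halfE d, ‖f x‖ₑ ^ 2 := by
  rw [← lintegral_add_compl _ (measurableSet_halfE (d := d)), setLIntegral_compl_halfE, add_mul,
    one_mul, ← lintegral_const_mul' _ _ (ENNReal.pow_ne_top enorm_ne_top)]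
  congr 1
  · refine setLIntegral_congr_fun measurableSet_halfE fun x hx => ?_
    simp only [foldMap_of_mem hx, sideFactor_of_mem hx, one_mul]
  · refine setLIntegral_congr_fun measurableSet_halfE fun x hx => ?_
    simp only [foldMap_refl hx, sideFactor_refl hx, enorm_mul, mul_pow]

theorem memLp_fold (c : ℂ) (f : HalfL2 d) :
    MemLp (fun x => sideFactor d c x * f (foldMap d x)) 2 volume := by
  rw [memLp_two_iff_lintegral, lintegral_foldMap, ← enorm_sq_eq_lintegral]
  · exact ENNReal.mul_lt_top (ENNReal.add_lt_top.2 ⟨ENNReal.one_lt_top,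
      ENNReal.pow_lt_top enorm_lt_top⟩) (ENNReal.pow_lt_top enorm_lt_top)
  · exact (measurable_sideFactor c).aestronglyMeasurable.mul
      ((Lp.aestronglyMeasurable f).comp_quasiMeasurePreserving quasiMeasurePreserving_foldMap)

/-- The extension of a function from the half space to `ℝⁿ` by `f(x', xₙ) = c f(x', -xₙ)` for
`xₙ < 0`: the even extension for `c = 1`, the odd one for `c = -1`. -/
def fold (c : ℂ) : HalfL2 d →ₗ[ℂ] SpaceL2 (d + 1) where
  toFun f := (memLp_fold c f).toLp _
  map_add' a b := by
    rw [← MemLp.toLp_add]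
    refine MemLp.toLp_congr _ _ ?_
    filter_upwards [quasiMeasurePreserving_foldMap.ae (Lp.coeFn_add a b)] with p hp
    rw [Pi.add_apply, hp, Pi.add_apply, mul_add]
  map_smul' z a := by
    rw [RingHom.id_apply, ← MemLp.toLp_const_smul]
    refine MemLp.toLp_congr _ _ ?_
    filter_upwards [quasiMeasurePreserving_foldMap.ae (Lp.coeFn_smul z a)] with p hp
    rw [Pi.smul_apply, hp, Pi.smul_apply, smul_eq_mul, smul_eq_mul]
    ring

theorem coeFn_fold (c : ℂ) (f : HalfL2 d) :
    fold c f =ᵐ[volume] fun x => sideFactor d c x * f (foldMap d x) :=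
  (memLp_fold c f).coeFn_toLp

theorem enorm_fold_sq (c : ℂ) (f : HalfL2 d) : ‖fold c f‖ₑ ^ 2 = (1 + ‖c‖ₑ ^ 2) * ‖f‖ₑ ^ 2 := by
  rw [enorm_sq_eq_lintegral f, ← lintegral_foldMap]
  exact enorm_toLp_sq (memLp_fold c f)

theorem resHalf_fold (c : ℂ) (f : HalfL2 d) : resHalf d (fold c f) = f := by
  refine Lp.ext ?_
  filter_upwards [coeFn_resHalf (fold c f), ae_restrict_of_ae (coeFn_fold c f),
    ae_restrict_mem measurableSet_halfE] with x h1 h2 h3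
  rw [h1, h2, foldMap_of_mem h3, sideFactor_of_mem h3, one_mul]

theorem integral_mul_fold (c : ℂ) (f : HalfL2 d) (φ : 𝓢(Eu (d + 1), ℂ)) :
    ∫ x, φ x * fold c f x = ∫ x in halfE d, (φ x + c * φ (refl d x)) * f x := by
  have hi := integrable_schwartz_mul φ (fold c f)
  rw [← integral_add_compl (measurableSet_halfE (d := d)) hi, setIntegral_compl_halfE]
  have h1 : IntegrableOn (fun x => φ x * fold c f x) (halfE d) := hi.integrableOn
  have h2 : IntegrableOn (fun x => φ (refl d x) * fold c f (refl d x)) (halfE d) :=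
    ((measurePreserving_refl.integrable_comp_emb measurableEmbedding_refl).2 hi).integrableOn
  rw [← integral_add h1 h2]
  refine setIntegral_congr_ae measurableSet_halfE ?_
  filter_upwards [coeFn_fold c f,
    measurePreserving_refl.quasiMeasurePreserving.ae (coeFn_fold c f)] with x h3 h4 hx
  rw [h3, h4, foldMap_of_mem hx, foldMap_refl hx, sideFactor_of_mem hx, sideFactor_refl hx]
  ring

theorem fold_one_even (f : HalfL2 d) : ∀ᵐ x, fold 1 f (refl d x) = fold 1 f x := by
  filter_upwards [coeFn_fold 1 f,
    measurePreserving_refl.quasiMeasurePreserving.ae (coeFn_fold 1 f), ae_last_ne_zero]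
    with x h1 h2 h3
  rw [h1, h2]
  by_cases hx : x ∈ halfE d
  · rw [foldMap_refl hx, foldMap_of_mem hx, sideFactor_refl hx, sideFactor_of_mem hx]
  · have hx' : refl d x ∈ halfE d := by
      simp only [halfE, Set.mem_ofPred_eq, refl_last, not_lt] at *
      have := lt_of_le_of_ne hx h3
      linarith
    have h4 := foldMap_refl hx'
    have h5 := sideFactor_refl (c := 1) hx'
    rw [refl_refl] at h4 h5
    rw [h4, foldMap_of_mem hx', h5, sideFactor_of_mem hx']

/-- The composition of a Schwartz function with the reflection. -/
def reflS (d : ℕ) : 𝓢(Eu (d + 1), ℂ) →L[ℂ] 𝓢(Eu (d + 1), ℂ) :=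
  compCLMOfContinuousLinearEquiv ℂ (refl d).toContinuousLinearEquiv

theorem reflS_apply (φ : 𝓢(Eu (d + 1), ℂ)) (x : Eu (d + 1)) : reflS d φ x = φ (refl d x) := rfl

theorem lineDeriv_reflS (φ : 𝓢(Eu (d + 1), ℂ)) {v : Eu (d + 1)} {e : ℝ} (he : e * e = 1)
    (hv : refl d v = e • v) (x : Eu (d + 1)) :
    (∂_{v} φ : 𝓢(Eu (d + 1), ℂ)) (refl d x) =
      (e : ℂ) * (∂_{v} (reflS d φ) : 𝓢(Eu (d + 1), ℂ)) x := by
  have h1 : (∂_{v} (reflS d φ) : 𝓢(Eu (d + 1), ℂ)) = reflS d (∂_{refl d v} φ) :=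
    lineDerivOp_compCLMOfContinuousLinearEquiv ℂ v (refl d).toContinuousLinearEquiv φ
  rw [h1, hv, LineDeriv.lineDerivOp_left_smul, reflS_apply]
  simp only [_root_.smul_apply, Complex.real_smul]
  rw [← mul_assoc, ← Complex.ofReal_mul, he, Complex.ofReal_one, one_mul]

/-- The complex conjugate of a Schwartz function. -/
def conjS {m : ℕ} (φ : 𝓢(Eu m, ℂ)) : 𝓢(Eu m, ℂ) :=
  SchwartzMap.postcompCLM (𝕜 := ℝ) (Complex.conjCLE : ℂ →L[ℝ] ℂ) φ

theorem conjS_apply {m : ℕ} (φ : 𝓢(Eu m, ℂ)) (x : Eu m) :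
    conjS φ x = (starRingEnd ℂ) (φ x) := rfl

theorem lineDeriv_conjS {m : ℕ} (φ : 𝓢(Eu m, ℂ)) (v x : Eu m) :
    (∂_{v} (conjS φ) : 𝓢(Eu m, ℂ)) x = (starRingEnd ℂ) ((∂_{v} φ : 𝓢(Eu m, ℂ)) x) := by
  simp only [SchwartzMap.lineDerivOp_apply_eq_fderiv]
  have h1 : HasFDerivAt (conjS φ) ((Complex.conjCLE : ℂ →L[ℝ] ℂ).comp (fderiv ℝ φ x)) x :=
    (Complex.conjCLE : ℂ →L[ℝ] ℂ).hasFDerivAt.comp x (φ.hasFDerivAt x)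
  rw [h1.fderiv]
  simp

/-- The Gauss–Green formula, tested with a Schwartz function. -/
theorem setIntegral_lineDeriv_mul {v : Eu (d + 1)} {a a' : SpaceL2 (d + 1)} {g : SpaceL2 d}
    (ha : sobSq 1 a < ⊤) (Da : IsMul (derivSymbol v) a a') (Ta : IsTrace a g)
    (φ : 𝓢(Eu (d + 1), ℂ)) :
    ∫ x in halfE d, (∂_{v} φ : 𝓢(Eu (d + 1), ℂ)) x * a x = -(∫ x in halfE d, φ x * a' x) -
      (v (Fin.last d) : ℂ) * ∫ x, φ (glue d (x, 0)) * g x := by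
  have h := inner_resHalf_deriv (sobSq_toL2_lt_top 1 (conjS φ)) ha (isMul_lineDeriv (conjS φ) v) Da
    (isTrace_toL2 (conjS φ)) Ta
  rw [inner_resHalf, inner_resHalf, L2.inner_def] at h
  have h1 : ∫ x in halfE d, (starRingEnd ℂ) (toL2 (∂_{v} (conjS φ)) x) * a x =
      ∫ x in halfE d, (∂_{v} φ : 𝓢(Eu (d + 1), ℂ)) x * a x := by
    refine setIntegral_congr_ae measurableSet_halfE ?_
    filter_upwards [coeFn_toL2 (∂_{v} (conjS φ))] with x hx _
    rw [hx, lineDeriv_conjS, Complex.conj_conj]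
  have h2 : ∫ x in halfE d, (starRingEnd ℂ) (toL2 (conjS φ) x) * a' x =
      ∫ x in halfE d, φ x * a' x := by
    refine setIntegral_congr_ae measurableSet_halfE ?_
    filter_upwards [coeFn_toL2 (conjS φ)] with x hx _
    rw [hx, conjS_apply, Complex.conj_conj]
  have h3 : ∫ x, inner ℂ (toL2 (slice 0 (conjS φ)) x) (g x) =
      ∫ x, φ (glue d (x, 0)) * g x := by
    refine integral_congr_ae ?_
    filter_upwards [coeFn_toL2 (slice 0 (conjS φ))] with x hx
    rw [hx, RCLike.inner_apply, slice_apply, conjS_apply, mul_comm]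
    simp
  rw [h1, h2, h3] at h
  linear_combination h

/-- The derivative of a reflected extension. There is no jump across the boundary if the direction
is tangential, if the extension of the function is even, or if the trace vanishes. -/
theorem isMul_deriv_fold {v : Eu (d + 1)} {e : ℝ} (he : e * e = 1) (hv : refl d v = e • v)
    {a a' : SpaceL2 (d + 1)} {g : SpaceL2 d} (ha : sobSq 1 a < ⊤)
    (Da : IsMul (derivSymbol v) a a') (Ta : IsTrace a g) {c : ℂ}
    (h0 : v (Fin.last d) = 0 ∨ c * e = -1 ∨ g = 0) :
    IsMul (derivSymbol v) (fold c (resHalf d a)) (fold (c * e) (resHalf d a')) := by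
  rw [isMul_derivSymbol_iff]
  intro φ
  rw [integral_mul_fold, integral_mul_fold]
  -- folding the test function moves the integrals to the half space; `h0` removes the boundary
  -- term
  let ψ : 𝓢(Eu (d + 1), ℂ) := φ + (c * e) • reflS d φ
  have h1 : ∀ x, (∂_{v} φ : 𝓢(Eu (d + 1), ℂ)) x +
      c * (∂_{v} φ : 𝓢(Eu (d + 1), ℂ)) (refl d x) = (∂_{v} ψ : 𝓢(Eu (d + 1), ℂ)) x := by
    intro x
    simp only [ψ]
    rw [lineDeriv_reflS φ he hv, LineDeriv.lineDerivOp_add, LineDeriv.lineDerivOp_smul]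
    simp [mul_assoc]
  have h2 : ∀ x, φ x + c * e * φ (refl d x) = ψ x := fun x => by
    simp [ψ, reflS_apply]
  have h3 : ∀ x, ψ (glue d (x, 0)) = (1 + c * e) * φ (glue d (x, 0)) := fun x => by
    rw [← h2, refl_glue, neg_zero]
    ring
  simp only [h1, h2]
  have h4 : ∫ x in halfE d, (∂_{v} ψ : 𝓢(Eu (d + 1), ℂ)) x * (resHalf d a) x =
      ∫ x in halfE d, (∂_{v} ψ : 𝓢(Eu (d + 1), ℂ)) x * a x := by
    refine integral_congr_ae ?_
    filter_upwards [coeFn_resHalf a] with x hx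
    rw [hx]
  have h5 : ∫ x in halfE d, ψ x * (resHalf d a') x = ∫ x in halfE d, ψ x * a' x := by
    refine integral_congr_ae ?_
    filter_upwards [coeFn_resHalf a'] with x hx
    rw [hx]
  rw [h4, h5, setIntegral_lineDeriv_mul ha Da Ta]
  have h6 : (v (Fin.last d) : ℂ) * ∫ x, ψ (glue d (x, 0)) * g x = 0 := by
    rcases h0 with h0 | h0 | h0
    · rw [h0, Complex.ofReal_zero, zero_mul]
    · simp only [h3, h0]
      simp
    · rw [integral_eq_zero_of_ae, mul_zero]
      rw [h0]
      filter_upwards [Lp.coeFn_zero ℂ 2 (volume : Measure (Eu d))] with x hx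
      rw [hx]
      simp
  rw [h6]
  ring

theorem reflSign_mul_self (i : Fin (d + 1)) : reflSign d i * reflSign d i = 1 := by
  unfold reflSign
  split_ifs <;> norm_num

/-- The norm of `H¹` in terms of first derivatives. -/
theorem sobSq_one_eq {m : ℕ} {a : SpaceL2 m} {D : Fin m → SpaceL2 m}
    (h : ∀ i, IsMul (derivSymbol (EuclideanSpace.single i 1)) a (D i)) :
    sobSq 1 a = ‖a‖ₑ ^ 2 + ∑ i, ‖D i‖ₑ ^ 2 := by
  have hmeas : ∀ b : SpaceL2 m, AEMeasurable fun ξ => ‖(𝓕 b : SpaceL2 m) ξ‖ₑ ^ 2 := fun b =>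
    (Lp.aestronglyMeasurable _).enorm.pow_const 2
  simp only [← sobSq_zero_order, sobSq, Real.rpow_zero, ENNReal.ofReal_one, one_mul, Real.rpow_one]
  rw [← lintegral_finsetSum' _ fun i _ => hmeas (D i), ← lintegral_add_left' (hmeas a)]
  refine lintegral_congr_ae ?_
  filter_upwards [ae_all_iff.2 h] with ξ hξ
  simp only [hξ, enorm_mul, mul_pow]
  rw [← Finset.sum_mul, ← one_add_mul]
  congr 1
  have h1 : ∀ i, ‖derivSymbol (EuclideanSpace.single i 1) ξ‖ₑ ^ 2 =
      ENNReal.ofReal ((2 * Real.pi) ^ 2 * ξ i ^ 2) := fun i => by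
    rw [← ofReal_norm, ← ENNReal.ofReal_pow (norm_nonneg _), derivSymbol,
      EuclideanSpace.inner_single_right]
    congr 1
    simp only [norm_mul, Complex.norm_ofNat, Complex.norm_real, Complex.norm_I, mul_pow,
      Real.norm_eq_abs, sq_abs]
    simp
  simp only [h1]
  rw [← ENNReal.ofReal_sum_of_nonneg fun i _ => by positivity, ← ENNReal.ofReal_one,
    ← ENNReal.ofReal_add zero_le_one (Finset.sum_nonneg fun i _ => by positivity)]
  congr 1
  rw [jap, norm_smul, mul_pow ‖2 * Real.pi‖, EuclideanSpace.norm_sq_eq, ← Finset.mul_sum]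
  simp only [Real.norm_eq_abs, sq_abs]

/-- The even extension is bounded on `H¹`. -/
theorem sobSq_one_fold_le {a : SpaceL2 (d + 1)} (ha : sobSq 1 a < ⊤) :
    sobSq 1 (fold 1 (resHalf d a)) ≤ 2 * sobSq 1 a := by
  obtain ⟨g, Ta⟩ := exists_isTrace ha
  choose D hD using fun i : Fin (d + 1) => exists_deriv (EuclideanSpace.single i 1) ha
  have h1 : ∀ i, IsMul (derivSymbol (EuclideanSpace.single i 1)) (fold 1 (resHalf d a))
      (fold (1 * reflSign d i) (resHalf d (D i))) := fun i => by
    refine isMul_deriv_fold (reflSign_mul_self i) (refl_single i) ha (hD i) Ta ?_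
    by_cases h : i = Fin.last d
    · right; left
      simp [reflSign, h]
    · left
      simp [Ne.symm h]
  have h2 : ∀ i : Fin (d + 1), ‖fold (1 * (reflSign d i : ℂ)) (resHalf d (D i))‖ₑ ^ 2 ≤
      2 * ‖D i‖ₑ ^ 2 := fun i => by
    have : ‖(1 * (reflSign d i : ℂ))‖ₑ = 1 := by
      unfold reflSign
      split_ifs <;> simp
    rw [enorm_fold_sq, this, one_pow, one_add_one_eq_two]
    exact mul_le_mul_right (enorm_resHalf_sq_le _) _
  have h3 : ‖fold 1 (resHalf d a)‖ₑ ^ 2 ≤ 2 * ‖a‖ₑ ^ 2 := by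
    rw [enorm_fold_sq, enorm_one, one_pow, one_add_one_eq_two]
    exact mul_le_mul_right (enorm_resHalf_sq_le _) _
  rw [sobSq_one_eq h1, sobSq_one_eq hD, mul_add, Finset.mul_sum]
  exact add_le_add h3 (Finset.sum_le_sum fun i _ => h2 i)

theorem IsMul.sum {m : ℕ} {ι : Type*} (s : Finset ι) {μ : ι → Eu m → ℂ} {a : SpaceL2 m}
    {b : ι → SpaceL2 m} (h : ∀ i ∈ s, IsMul (μ i) a (b i)) :
    IsMul (fun ξ => ∑ i ∈ s, μ i ξ) a (∑ i ∈ s, b i) := by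
  classical
  induction s using Finset.induction_on with
  | empty =>
    unfold IsMul
    simp only [Finset.sum_empty, zero_mul]
    exact coeFn_fourier_zero
  | insert i s hi ih =>
    have h1 := h i (Finset.mem_insert_self i s)
    have h2 := ih fun j hj => h j (Finset.mem_insert_of_mem hj)
    unfold IsMul at *
    simp only [Finset.sum_insert hi]
    filter_upwards [h1, h2, coeFn_fourier_add (b i) (∑ j ∈ s, b j)] with ξ k1 k2 k3
    rw [k3, k1, k2, add_mul]

/-- The even extension of a function with vanishing Neumann trace has no jump in the Laplacian. -/
theorem isMul_lap_fold {a q b : SpaceL2 (d + 1)} (ha : sobSq 2 a < ⊤)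
    (Dq : IsMul (derivSymbol (normal d)) a q) (Tq : IsTrace q 0) (Lb : IsMul lapSymbol a b) :
    IsMul lapSymbol (fold 1 (resHalf d a)) (fold 1 (resHalf d b)) := by
  have ha1 : sobSq 1 a < ⊤ := (sobSq_mono (by norm_num) a).trans_lt ha
  obtain ⟨g, Ta⟩ := exists_isTrace ha1
  choose D hD using fun i : Fin (d + 1) => exists_deriv (EuclideanSpace.single i 1) ha1
  have hD1 : ∀ i, sobSq 1 (D i) < ⊤ := fun i => sobSq_deriv_lt_top (hD i) (by norm_num; exact ha)
  choose D2 hD2 using fun i : Fin (d + 1) => exists_deriv (EuclideanSpace.single i 1) (hD1 i)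
  choose t ht using fun i : Fin (d + 1) => exists_isTrace (hD1 i)
  have h1 : ∀ i, IsMul (derivSymbol (EuclideanSpace.single i 1)) (fold 1 (resHalf d a))
      (fold (1 * reflSign d i) (resHalf d (D i))) := fun i => by
    refine isMul_deriv_fold (reflSign_mul_self i) (refl_single i) ha1 (hD i) Ta ?_
    by_cases h : i = Fin.last d
    · right; left
      simp [reflSign, h]
    · left
      simp [Ne.symm h]
  have h2 : ∀ i, IsMul (derivSymbol (EuclideanSpace.single i 1))
      (fold (1 * reflSign d i) (resHalf d (D i))) (fold 1 (resHalf d (D2 i))) := fun i => by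
    have h3 : (1 * (reflSign d i : ℂ)) * (reflSign d i : ℂ) = 1 := by
      rw [one_mul, ← Complex.ofReal_mul, reflSign_mul_self, Complex.ofReal_one]
    have h4 := isMul_deriv_fold (c := 1 * (reflSign d i : ℂ)) (reflSign_mul_self i) (refl_single i)
      (hD1 i) (hD2 i) (ht i) ?_
    · rwa [h3] at h4
    by_cases h : i = Fin.last d
    · right; right
      have : D i = q := by
        subst h
        exact (hD _).unique Dq
      exact (ht i).unique (this ▸ Tq)
    · left
      simp [Ne.symm h]
  have h5 := IsMul.sum Finset.univ fun i _ => (h1 i).comp (h2 i)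
  have h6 := IsMul.sum Finset.univ fun i _ => (hD i).comp (hD2 i)
  simp only [← sq, sum_derivSymbol_sq] at h5 h6
  rw [h6.unique Lb |>.symm, map_sum, map_sum]
  exact h5

/-- The Fourier transform of an even function is even. -/
theorem fourier_even {a : SpaceL2 (d + 1)} (ha : ∀ᵐ x, a (refl d x) = a x) :
    ∀ᵐ ξ, (𝓕 a : SpaceL2 (d + 1)) (refl d ξ) = (𝓕 a : SpaceL2 (d + 1)) ξ := by
  -- both sides have the same integrals against Schwartz functions
  have hm : MemLp (fun ξ => (𝓕 a : SpaceL2 (d + 1)) (refl d ξ)) 2 volume :=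
    (Lp.memLp _).comp_measurePreserving measurePreserving_refl
  let b : SpaceL2 (d + 1) := hm.toLp _
  have hfr : ∀ φ : 𝓢(Eu (d + 1), ℂ), (𝓕 (reflS d φ) : 𝓢(Eu (d + 1), ℂ)) = reflS d (𝓕 φ) := by
    intro φ
    ext ξ
    rw [reflS_apply, SchwartzMap.fourier_coe, SchwartzMap.fourier_coe]
    exact Real.fourier_comp_linearIsometry (refl d) φ ξ
  have hch : ∀ F : Eu (d + 1) → ℂ, ∫ x, F (refl d x) = ∫ x, F x := fun F =>
    measurePreserving_refl.integral_comp measurableEmbedding_refl F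
  have key : ∀ φ : 𝓢(Eu (d + 1), ℂ),
      ∫ ξ, φ ξ * b ξ = ∫ ξ, φ ξ * (𝓕 a : SpaceL2 (d + 1)) ξ := by
    intro φ
    have h1 : ∫ ξ, φ ξ * b ξ =
        ∫ ξ, (reflS d φ) (refl d ξ) * (𝓕 a : SpaceL2 (d + 1)) (refl d ξ) := by
      refine integral_congr_ae ?_
      filter_upwards [hm.coeFn_toLp] with ξ hξ
      rw [hξ, reflS_apply, refl_refl]
    rw [h1, hch fun ξ => (reflS d φ) ξ * (𝓕 a : SpaceL2 (d + 1)) ξ, integral_mul_fourier, hfr,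
      integral_mul_fourier, ← hch fun x => (𝓕 φ : 𝓢(Eu (d + 1), ℂ)) x * a x]
    refine integral_congr_ae ?_
    filter_upwards [ha] with x hx
    rw [hx, reflS_apply]
  have h2 : IsMul (fun _ => 1) (𝓕 a : SpaceL2 (d + 1)) b :=
    IsMul.of_integral_eq (Q := id) (by fun_prop) (fun φ ξ => by simp) key
  have h3 : b = (𝓕 a : SpaceL2 (d + 1)) := by
    refine fourier_injective (Lp.ext ?_)
    filter_upwards [h2] with ξ hξ
    rw [hξ, one_mul]
  have h4 : b =ᵐ[volume] _ := hm.coeFn_toLp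
  rw [h3] at h4
  filter_upwards [h4] with ξ hξ
  exact hξ.symm

/-- An odd function has trace zero, as its Fourier transform is odd in the normal frequency. -/
theorem isTrace_zero_of_odd {q : SpaceL2 (d + 1)}
    (hq : ∀ᵐ ξ, (𝓕 q : SpaceL2 (d + 1)) (refl d ξ) = -(𝓕 q : SpaceL2 (d + 1)) ξ) :
    IsTrace q 0 := by
  unfold IsTrace
  filter_upwards [ae_glue hq, coeFn_fourier_zero (m := d)] with x hx h0
  rw [h0]
  simp only [refl_glue] at hx
  have h1 := integral_neg_eq_self (fun s : ℝ => (𝓕 q : SpaceL2 (d + 1)) (glue d (x, s))) volume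
  rw [integral_congr_ae hx, integral_neg] at h1
  exact (self_eq_neg.1 h1.symm).symm

end Reflection

/-! ### Lifting Neumann data -/

section NeumannLift

variable {d : ℕ}

theorem sq_div_cube_le {A : ℝ} (hA : 0 < A) (t : ℝ) :
    t ^ 2 * ((A + t ^ 2) ^ 3)⁻¹ ≤ A⁻¹ * (A + t ^ 2)⁻¹ := by
  have h : 0 < A + t ^ 2 := by positivity
  rw [← div_eq_mul_inv, ← mul_inv, ← one_div, div_le_div_iff₀ (by positivity) (by positivity)]
  nlinarith [sq_nonneg t, mul_pos h h, mul_nonneg hA.le (sq_nonneg t), pow_pos h 3,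
    mul_nonneg h.le (sq_nonneg (t ^ 2)), mul_pos (mul_pos h h) hA]

theorem integrable_sq_div_cube {A : ℝ} (hA : 0 < A) : Integrable fun s : ℝ =>
    (2 * Real.pi * s) ^ 2 * ((A + (2 * Real.pi * s) ^ 2) ^ 3)⁻¹ := by
  refine ((integrable_inv_add_sq hA).const_mul A⁻¹).mono' ?_ (ae_of_all _ fun s => ?_)
  · exact Measurable.aestronglyMeasurable (by fun_prop)
  · rw [Real.norm_of_nonneg (by positivity)]
    exact sq_div_cube_le hA _

/-- The constant that makes the Neumann trace of the lift equal to the given datum. -/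
def liftConst : ℝ := ∫ s : ℝ, (2 * Real.pi * s) ^ 2 * ((1 + (2 * Real.pi * s) ^ 2) ^ 3)⁻¹

theorem liftConst_pos : 0 < liftConst := by
  unfold liftConst
  rw [integral_pos_iff_support_of_nonneg (fun s => by positivity)
    (integrable_sq_div_cube one_pos)]
  have h : Set.Ioi (0 : ℝ) ⊆ Function.support fun s : ℝ =>
      (2 * Real.pi * s) ^ 2 * ((1 + (2 * Real.pi * s) ^ 2) ^ 3)⁻¹ := fun s hs => by
    have hs' : (0 : ℝ) < s := hs
    rw [Function.mem_support]
    positivity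
  refine lt_of_lt_of_le ?_ (measure_mono h)
  simp

/-- Scaling of the integral that normalizes the profile. -/
theorem integral_sq_div_cube {A : ℝ} (hA : 0 < A) :
    ∫ s : ℝ, (2 * Real.pi * s) ^ 2 * ((A + (2 * Real.pi * s) ^ 2) ^ 3)⁻¹ =
      (A * Real.sqrt A)⁻¹ * liftConst := by
  have hs : 0 < Real.sqrt A := Real.sqrt_pos.2 hA
  have hsq : Real.sqrt A ^ 2 = A := Real.sq_sqrt hA.le
  have h := Measure.integral_comp_mul_left
    (fun s : ℝ => (2 * Real.pi * s) ^ 2 * ((A + (2 * Real.pi * s) ^ 2) ^ 3)⁻¹) (Real.sqrt A)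
  have h1 : ∀ s : ℝ, (2 * Real.pi * (Real.sqrt A * s)) ^ 2 *
      ((A + (2 * Real.pi * (Real.sqrt A * s)) ^ 2) ^ 3)⁻¹ =
      (A ^ 2)⁻¹ * ((2 * Real.pi * s) ^ 2 * ((1 + (2 * Real.pi * s) ^ 2) ^ 3)⁻¹) := fun s => by
    have e : (2 * Real.pi * (Real.sqrt A * s)) ^ 2 = A * (2 * Real.pi * s) ^ 2 := by
      calc (2 * Real.pi * (Real.sqrt A * s)) ^ 2
          = Real.sqrt A ^ 2 * (2 * Real.pi * s) ^ 2 := by ring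
        _ = A * (2 * Real.pi * s) ^ 2 := by rw [hsq]
    rw [e]
    have e2 : A + A * (2 * Real.pi * s) ^ 2 = A * (1 + (2 * Real.pi * s) ^ 2) := by ring
    rw [e2]
    have : (1 + (2 * Real.pi * s) ^ 2) ≠ 0 := by positivity
    field_simp
  simp only [h1] at h
  rw [integral_const_mul, abs_of_pos (by positivity), smul_eq_mul] at h
  rw [liftConst]
  set X := ∫ s : ℝ, (2 * Real.pi * s) ^ 2 * ((A + (2 * Real.pi * s) ^ 2) ^ 3)⁻¹
  set Y := ∫ s : ℝ, (2 * Real.pi * s) ^ 2 * ((1 + (2 * Real.pi * s) ^ 2) ^ 3)⁻¹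
  have h2 : X = Real.sqrt A * ((A ^ 2)⁻¹ * Y) := by
    rw [h]
    field_simp
  rw [h2]
  have h3 : (A * Real.sqrt A)⁻¹ = Real.sqrt A * (A ^ 2)⁻¹ := by
    field_simp
    rw [hsq]
  rw [h3]
  ring

/-- The profile of the Neumann lift in the normal frequency `s`, for a parameter `A > 0`. It is odd
in `s`; up to a constant, multiplication by the symbol of `∂ₙ` turns it into a multiple of
`σ² (A + σ²)⁻³`, `σ = 2πs`, and `liftConst` makes the integral over `s` equal to one. -/
def liftProfile (A s : ℝ) : ℝ :=
  liftConst⁻¹ * (A * Real.sqrt A) * (2 * Real.pi * s) * ((A + (2 * Real.pi * s) ^ 2) ^ 3)⁻¹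

theorem lintegral_liftProfile_le {A r a : ℝ} (ha : 0 ≤ a) (haA : a ≤ A) (hA : 0 < A) (hr : 0 ≤ r)
    (hr3 : r ≤ 3) :
    ∫⁻ s : ℝ, ENNReal.ofReal ((a + (2 * Real.pi * s) ^ 2) ^ r) * ‖liftProfile A s‖ₑ ^ 2 ≤
      ENNReal.ofReal (liftConst⁻¹ ^ 2) * ENNReal.ofReal (A ^ (r - 3 / 2)) := by
  have hK := liftConst_pos
  have h1 : ∀ s : ℝ, ENNReal.ofReal ((a + (2 * Real.pi * s) ^ 2) ^ r) * ‖liftProfile A s‖ₑ ^ 2 ≤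
      ENNReal.ofReal (liftConst⁻¹ ^ 2 * A ^ 3) *
        ENNReal.ofReal ((A + (2 * Real.pi * s) ^ 2) ^ (-(5 - r))) := by
    intro s
    rw [← ofReal_norm, ← ENNReal.ofReal_pow (norm_nonneg _), ← ENNReal.ofReal_mul (by positivity),
      ← ENNReal.ofReal_mul (by positivity)]
    refine ENNReal.ofReal_le_ofReal ?_
    rw [Real.norm_eq_abs, sq_abs, liftProfile]
    set t := 2 * Real.pi * s
    set D := A + t ^ 2 with hDdef
    have hD : 0 < D := by positivity
    have htD : t ^ 2 ≤ D := by rw [hDdef]; linarith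
    have e1 : D ^ (-(5 - r)) = D ^ r * (D * ((D ^ 3)⁻¹) ^ 2) := by
      have : D * ((D ^ 3)⁻¹) ^ 2 = D ^ (-5 : ℝ) := by
        rw [Real.rpow_neg hD.le, show (5 : ℝ) = ((5 : ℕ) : ℝ) by norm_num, Real.rpow_natCast]
        field_simp
      rw [this, ← Real.rpow_add hD]
      congr 1
      ring
    have e2 : (liftConst⁻¹ * (A * Real.sqrt A) * t * (D ^ 3)⁻¹) ^ 2 =
        liftConst⁻¹ ^ 2 * A ^ 3 * (t ^ 2 * ((D ^ 3)⁻¹) ^ 2) := by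
      have := Real.sq_sqrt hA.le
      calc _ = liftConst⁻¹ ^ 2 * (A ^ 2 * Real.sqrt A ^ 2) * (t ^ 2 * ((D ^ 3)⁻¹) ^ 2) := by ring
        _ = _ := by rw [this]; ring
    rw [e1, e2, mul_left_comm]
    have h2 : (a + t ^ 2) ^ r ≤ D ^ r :=
      Real.rpow_le_rpow (by positivity) (by rw [hDdef]; linarith) hr
    gcongr
  refine (lintegral_mono h1).trans ?_
  rw [lintegral_const_mul' _ _ ENNReal.ofReal_ne_top]
  refine (mul_le_mul_right (lintegral_rpow_neg_add_sq_le hA (by linarith)) _).trans (le_of_eq ?_)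
  rw [← ENNReal.ofReal_mul (by positivity), ← ENNReal.ofReal_mul (by positivity)]
  congr 1
  rw [mul_assoc]
  congr 1
  rw [← Real.rpow_natCast, ← Real.rpow_add hA]
  congr 1
  push_cast
  ring

/-- The Neumann lift. The larger the parameter `M`, the faster the lift decays away from the
boundary. -/
theorem exists_neumannLift {M : ℝ} (hM : 0 ≤ M) (g : SpaceL2 d) : ∃ u q : SpaceL2 (d + 1),
    IsMul (derivSymbol (normal d)) u q ∧ IsTrace q g ∧
    ∀ r : ℝ, 0 ≤ r → r ≤ 3 → sobSq r u ≤ ENNReal.ofReal (liftConst⁻¹ ^ 2) *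
      ∫⁻ x, ENNReal.ofReal ((jap x + M) ^ (r - 3 / 2)) * ‖(𝓕 g : SpaceL2 d) x‖ₑ ^ 2 := by
  have hA : ∀ x : Eu d, 0 < jap x + M := fun x => by linarith [jap_pos x]
  -- the Fourier transform of the lift
  let H : Eu d × ℝ → ℂ := fun p =>
    -Complex.I * (𝓕 g : SpaceL2 d) p.1 * (liftProfile (jap p.1 + M) p.2 : ℂ)
  have hprof : Measurable fun p : Eu d × ℝ => (liftProfile (jap p.1 + M) p.2 : ℂ) := by
    unfold liftProfile
    fun_prop
  have hH : AEStronglyMeasurable H ((volume : Measure (Eu d)).prod (volume : Measure ℝ)) := by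
    refine AEStronglyMeasurable.mul ?_ hprof.aestronglyMeasurable
    exact (Lp.aestronglyMeasurable (𝓕 g : SpaceL2 d)).comp_fst.const_mul _
  have hbound : ∀ r : ℝ, 0 ≤ r → r ≤ 3 →
      ∫⁻ x : Eu d, ∫⁻ s : ℝ, ENNReal.ofReal (jap (glue d (x, s)) ^ r) * ‖H (x, s)‖ₑ ^ 2 ≤
      ENNReal.ofReal (liftConst⁻¹ ^ 2) *
      ∫⁻ x, ENNReal.ofReal ((jap x + M) ^ (r - 3 / 2)) * ‖(𝓕 g : SpaceL2 d) x‖ₑ ^ 2 := by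
    intro r hr hr3
    rw [← lintegral_const_mul' _ _ ENNReal.ofReal_ne_top]
    refine lintegral_mono fun x => ?_
    have h1 : ∀ s : ℝ, ENNReal.ofReal (jap (glue d (x, s)) ^ r) * ‖H (x, s)‖ₑ ^ 2 =
        ‖(𝓕 g : SpaceL2 d) x‖ₑ ^ 2 * (ENNReal.ofReal ((jap x + (2 * Real.pi * s) ^ 2) ^ r) *
          ‖liftProfile (jap x + M) s‖ₑ ^ 2) := fun s => by
      have h2 : ‖H (x, s)‖ₑ = ‖(𝓕 g : SpaceL2 d) x‖ₑ * ‖liftProfile (jap x + M) s‖ₑ := by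
        simp only [H, enorm_mul, enorm_neg]
        have e1 : ‖Complex.I‖ₑ = 1 := by rw [← ofReal_norm, Complex.norm_I, ENNReal.ofReal_one]
        have e2 : ‖(liftProfile (jap x + M) s : ℂ)‖ₑ = ‖liftProfile (jap x + M) s‖ₑ := by
          rw [← ofReal_norm, Complex.norm_real, ofReal_norm]
        rw [e1, e2, one_mul]
      rw [h2, jap_glue, mul_pow]
      ring
    simp only [h1]
    rw [lintegral_const_mul' _ _ (ENNReal.pow_ne_top enorm_ne_top), ← mul_assoc, mul_comm]
    refine (mul_le_mul_left (lintegral_liftProfile_le (jap_pos x).le (by linarith) (hA x) hr hr3)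
      _).trans (le_of_eq ?_)
    ring
  have hH' : AEStronglyMeasurable (fun ξ => H ((glue d).symm ξ)) (volume : Measure (Eu (d + 1))) := by
    have := (measurePreserving_glue (d := d)).symm (glue d).toHomeomorph.toMeasurableEquiv
    exact hH.comp_quasiMeasurePreserving this.quasiMeasurePreserving
  have hglue : ∀ r : ℝ, ∫⁻ ξ, ENNReal.ofReal (jap ξ ^ r) * ‖H ((glue d).symm ξ)‖ₑ ^ 2 =
      ∫⁻ x : Eu d, ∫⁻ s : ℝ, ENNReal.ofReal (jap (glue d (x, s)) ^ r) * ‖H (x, s)‖ₑ ^ 2 := by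
    intro r
    refine (lintegral_glue ((by fun_prop : Measurable fun ξ : Eu (d + 1) =>
      ENNReal.ofReal (jap ξ ^ r)).aemeasurable.mul (hH'.enorm.pow_const 2))).trans ?_
    simp only [Pi.mul_apply, ContinuousLinearEquiv.symm_apply_apply]
  have hfin : ∀ r : ℝ, r - 3 / 2 ≤ 0 →
      ∫⁻ x, ENNReal.ofReal ((jap x + M) ^ (r - 3 / 2)) * ‖(𝓕 g : SpaceL2 d) x‖ₑ ^ 2 < ⊤ := by
    intro r hr
    refine lt_of_le_of_lt (lintegral_mono fun x => mul_le_of_le_one_left zero_le ?_) ?_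
    · rw [← ENNReal.ofReal_one]
      refine ENNReal.ofReal_le_ofReal (Real.rpow_le_one_of_one_le_of_nonpos ?_ hr)
      linarith [one_le_jap x]
    · rw [← enorm_sq_eq_lintegral]
      exact ENNReal.pow_lt_top enorm_lt_top
  obtain ⟨u, hu⟩ := exists_fourier_ae_eq hH' (by
    have h := hglue 0
    simp only [Real.rpow_zero, ENNReal.ofReal_one, one_mul] at h
    have h2 := hbound 0 le_rfl (by norm_num)
    simp only [Real.rpow_zero, ENNReal.ofReal_one, one_mul] at h2
    rw [h]
    exact h2.trans_lt (ENNReal.mul_lt_top ENNReal.ofReal_lt_top (hfin 0 (by norm_num))))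
  have hsob : ∀ r : ℝ, 0 ≤ r → r ≤ 3 → sobSq r u ≤ ENNReal.ofReal (liftConst⁻¹ ^ 2) *
      ∫⁻ x, ENNReal.ofReal ((jap x + M) ^ (r - 3 / 2)) * ‖(𝓕 g : SpaceL2 d) x‖ₑ ^ 2 := by
    intro r hr hr3
    refine le_trans (le_of_eq ?_) (hbound r hr hr3)
    rw [← hglue, sobSq]
    refine lintegral_congr_ae ?_
    filter_upwards [hu] with ξ hξ
    rw [hξ]
  have hu1 : sobSq 1 u < ⊤ := (hsob 1 (by norm_num) (by norm_num)).trans_lt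
    (ENNReal.mul_lt_top ENNReal.ofReal_lt_top (hfin 1 (by norm_num)))
  obtain ⟨q, hq⟩ := exists_deriv (normal d) hu1
  refine ⟨u, q, hq, ?_, hsob⟩
  unfold IsTrace
  filter_upwards [ae_glue hq, ae_glue hu] with x h1 h2
  have hK := liftConst_pos
  have hAx := hA x
  have hsA : 0 < Real.sqrt (jap x + M) := Real.sqrt_pos.2 hAx
  -- the Fourier transform of the normal derivative integrates to `𝓕 g` in the normal frequency
  have h3 : ∀ᵐ s : ℝ, (𝓕 q : SpaceL2 (d + 1)) (glue d (x, s)) =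
      (𝓕 g : SpaceL2 d) x * ((liftConst⁻¹ * ((jap x + M) * Real.sqrt (jap x + M)) *
        ((2 * Real.pi * s) ^ 2 * ((jap x + M + (2 * Real.pi * s) ^ 2) ^ 3)⁻¹) : ℝ) : ℂ) := by
    filter_upwards [h1, h2] with s e1 e2
    rw [e1, e2]
    simp only [H, ContinuousLinearEquiv.symm_apply_apply, derivSymbol, inner_normal, glue_last,
      liftProfile]
    push_cast
    linear_combination (-(𝓕 g : SpaceL2 d) x * (liftConst : ℂ)⁻¹ *
      (((jap x : ℂ) + M) * (Real.sqrt (jap x + M) : ℂ)) * (2 * Real.pi * s) ^ 2 *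
      (((jap x : ℂ) + M + (2 * Real.pi * s) ^ 2) ^ 3)⁻¹) * Complex.I_sq
  rw [integral_congr_ae h3, integral_const_mul, integral_complex_ofReal, integral_const_mul,
    integral_sq_div_cube hAx]
  have h4 : liftConst⁻¹ * ((jap x + M) * Real.sqrt (jap x + M)) *
      (((jap x + M) * Real.sqrt (jap x + M))⁻¹ * liftConst) = 1 := by
    field_simp
  rw [h4, Complex.ofReal_one, mul_one]

end NeumannLift

/-! ### The symbol of the system -/

section ModeProblem

variable {d : ℕ}

/-- The lift for the first unknown, uniform in the time frequency `τ`. -/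
theorem exists_neumannLift_one : ∃ C : ℝ≥0, ∀ (τ : ℝ) (g : SpaceL2 d),
    ∃ u q : SpaceL2 (d + 1), IsMul (derivSymbol (normal d)) u q ∧ IsTrace q g ∧
      ENNReal.ofReal (1 + τ ^ 2) * sobSq 1 u + sobSq 3 u ≤
        C * (ENNReal.ofReal ((1 + τ ^ 2) ^ (3 / 4 : ℝ)) * sobSq 0 g + sobSq (3 / 2) g) := by
  set K := ENNReal.ofReal (liftConst⁻¹ ^ 2) with hK
  refine ⟨(liftConst⁻¹ ^ 2).toNNReal * 5, fun τ g => ?_⟩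
  set W := 1 + τ ^ 2 with hW
  have hW1 : 1 ≤ W := by rw [hW]; linarith [sq_nonneg τ]
  have hW0 : 0 < W := by linarith
  -- the boundary layer of the lift has the width `(1 + |ξ'|² + ⟨τ⟩)^{-1/2}`
  set M := W ^ (1 / 2 : ℝ) with hM
  have hM0 : 0 < M := by positivity
  obtain ⟨u, q, hq, ht, hs⟩ := exists_neumannLift hM0.le g
  refine ⟨u, q, hq, ht, ?_⟩
  have h0 : sobSq 0 g = ∫⁻ x, ‖(𝓕 g : SpaceL2 d) x‖ₑ ^ 2 := by simp [sobSq]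
  have h1 : ENNReal.ofReal W * sobSq 1 u ≤ K * (ENNReal.ofReal (W ^ (3 / 4 : ℝ)) * sobSq 0 g) := by
    refine (mul_le_mul_right (hs 1 (by norm_num) (by norm_num)) _).trans ?_
    rw [mul_left_comm]
    refine mul_le_mul_right ?_ _
    rw [h0, ← lintegral_const_mul' _ _ ENNReal.ofReal_ne_top,
      ← lintegral_const_mul' _ _ ENNReal.ofReal_ne_top]
    refine lintegral_mono fun x => ?_
    rw [← mul_assoc, ← ENNReal.ofReal_mul hW0.le]
    gcongr ?_ * _
    refine ENNReal.ofReal_le_ofReal ?_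
    have e1 : (jap x + M) ^ (1 - 3 / 2 : ℝ) ≤ M ^ (1 - 3 / 2 : ℝ) :=
      Real.rpow_le_rpow_of_nonpos hM0 (by linarith [jap_pos x]) (by norm_num)
    refine (mul_le_mul_of_nonneg_left e1 hW0.le).trans (le_of_eq ?_)
    rw [hM, ← Real.rpow_mul hW0.le, ← Real.rpow_one_add' hW0.le (by norm_num)]
    norm_num
  have h2 : sobSq 3 u ≤ K * (4 * (sobSq (3 / 2) g + ENNReal.ofReal (W ^ (3 / 4 : ℝ)) * sobSq 0 g)) := by
    refine (hs 3 (by norm_num) le_rfl).trans ?_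
    refine mul_le_mul_right ?_ _
    rw [h0, sobSq, ← lintegral_const_mul' _ _ ENNReal.ofReal_ne_top, ← lintegral_add_right',
      ← lintegral_const_mul' _ _ (by norm_num)]
    · refine lintegral_mono fun x => ?_
      simp only
      rw [← add_mul, ← mul_assoc]
      gcongr ?_ * _
      have e0 : (4 : ℝ≥0∞) = ENNReal.ofReal 4 := by norm_num
      rw [e0, ← ENNReal.ofReal_add (Real.rpow_nonneg (jap_pos x).le _) (by positivity),
        ← ENNReal.ofReal_mul (by norm_num)]
      refine ENNReal.ofReal_le_ofReal ?_
      have e1 : W ^ (3 / 4 : ℝ) = M ^ (3 / 2 : ℝ) := by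
        rw [hM, ← Real.rpow_mul hW0.le]
        norm_num
      rw [e1]
      have hj := jap_pos x
      have e2 : (3 - 3 / 2 : ℝ) = 3 / 2 := by norm_num
      have e4 : (2 : ℝ) ^ (3 / 2 : ℝ) ≤ 4 := by
        calc (2 : ℝ) ^ (3 / 2 : ℝ) ≤ 2 ^ (2 : ℝ) :=
              Real.rpow_le_rpow_of_exponent_le (by norm_num) (by norm_num)
          _ = 4 := by norm_num
      have e5 : (0 : ℝ) ≤ jap x ^ (3 / 2 : ℝ) := by positivity
      have e6 : (0 : ℝ) ≤ M ^ (3 / 2 : ℝ) := by positivity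
      rw [e2]
      rcases le_total (jap x) M with h | h
      · calc (jap x + M) ^ (3 / 2 : ℝ) ≤ (2 * M) ^ (3 / 2 : ℝ) := by gcongr; linarith
          _ = 2 ^ (3 / 2 : ℝ) * M ^ (3 / 2 : ℝ) := Real.mul_rpow (by norm_num) hM0.le
          _ ≤ 4 * (jap x ^ (3 / 2 : ℝ) + M ^ (3 / 2 : ℝ)) := by nlinarith
      · calc (jap x + M) ^ (3 / 2 : ℝ) ≤ (2 * jap x) ^ (3 / 2 : ℝ) := by gcongr; linarith
          _ = 2 ^ (3 / 2 : ℝ) * jap x ^ (3 / 2 : ℝ) := Real.mul_rpow (by norm_num) hj.le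
          _ ≤ 4 * (jap x ^ (3 / 2 : ℝ) + M ^ (3 / 2 : ℝ)) := by nlinarith
    · exact ((Lp.aestronglyMeasurable _).enorm.pow_const 2).const_mul _
  have hKC : ((((liftConst⁻¹ ^ 2).toNNReal * 5 : ℝ≥0)) : ℝ≥0∞) = K * 5 := by
    rw [ENNReal.coe_mul]; rfl
  rw [hKC]
  set a := ENNReal.ofReal (W ^ (3 / 4 : ℝ)) * sobSq 0 g
  set b := sobSq (3 / 2) g
  calc _ ≤ K * a + K * (4 * (b + a)) := add_le_add h1 h2
    _ = K * (5 * a + 4 * b) := by ring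
    _ ≤ K * (5 * a + 5 * b) := by gcongr; norm_num
    _ = K * 5 * (a + b) := by ring

/-- The lift for the second unknown, which needs no control in time. -/
theorem exists_neumannLift_two : ∃ C : ℝ≥0, ∀ g : SpaceL2 d,
    ∃ u q : SpaceL2 (d + 1), IsMul (derivSymbol (normal d)) u q ∧ IsTrace q g ∧
      sobSq 2 u ≤ C * sobSq (1 / 2) g := by
  refine ⟨(liftConst⁻¹ ^ 2).toNNReal, fun g => ?_⟩
  obtain ⟨u, q, hq, ht, hs⟩ := exists_neumannLift le_rfl g
  refine ⟨u, q, hq, ht, (hs 2 (by norm_num) (by norm_num)).trans (le_of_eq ?_)⟩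
  simp only [add_zero, sobSq]
  norm_num
  rfl

/-- The determinant of the symbol of the Cahn–Hilliard–Gurtin system, with `z = |ξ|²`. It vanishes
only for `τ = 0` and `z = 0`. -/
def chgDet (τ z : ℝ) : ℂ := z ^ 2 + Complex.I * τ * (1 + z)

theorem norm_chgDet_sq (τ z : ℝ) : ‖chgDet τ z‖ ^ 2 = z ^ 4 + τ ^ 2 * (1 + z) ^ 2 := by
  have : chgDet τ z = ((z ^ 2 : ℝ) : ℂ) + ((τ * (1 + z) : ℝ) : ℂ) * Complex.I := by
    unfold chgDet
    push_cast
    ring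
  rw [this, ← Complex.normSq_eq_norm_sq, Complex.normSq_add_mul_I]
  ring

theorem chgDet_ne_zero {τ z : ℝ} (hτ : τ ≠ 0) (hz : 0 ≤ z) : chgDet τ z ≠ 0 := by
  have h := norm_chgDet_sq τ z
  intro h0
  rw [h0, norm_zero] at h
  have : 0 < τ ^ 2 * (1 + z) ^ 2 := by positivity
  nlinarith [pow_nonneg hz 4]

/-- For purely oscillatory time frequencies the determinant is as large as its principal part. -/
theorem one_add_pow_four_le {τ τ₀ z : ℝ} (h0 : 0 < τ₀) (hτ : τ₀ ≤ |τ|) (hz : 0 ≤ z) :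
    (1 + z) ^ 4 ≤ 8 * (1 + (τ₀ ^ 2)⁻¹) * (z ^ 4 + τ ^ 2 * (1 + z) ^ 2) := by
  have h1 : 1 ≤ (τ₀ ^ 2)⁻¹ * τ ^ 2 := by
    rw [← sq_abs τ, inv_mul_eq_div, one_le_div (by positivity)]
    gcongr
  have h2 : (1 + z) ^ 4 ≤ 8 * (1 + z ^ 4) := by
    nlinarith [sq_nonneg (z - 1), sq_nonneg (z ^ 2 - 1), sq_nonneg (z ^ 2 - z), mul_nonneg hz hz]
  have h3 : 1 ≤ (τ₀ ^ 2)⁻¹ * (τ ^ 2 * (1 + z) ^ 2) := by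
    nlinarith [mul_nonneg hz hz]
  have h4 : 0 ≤ (τ₀ ^ 2)⁻¹ * z ^ 4 := by positivity
  have h5 : 0 ≤ τ ^ 2 * (1 + z) ^ 2 := by positivity
  nlinarith

theorem one_add_sq_mul_le {τ τ₀ z : ℝ} (h0 : 0 < τ₀) (hτ : τ₀ ≤ |τ|) (hz : 0 ≤ z) :
    (1 + τ ^ 2) * (1 + z) ^ 2 ≤ (1 + (τ₀ ^ 2)⁻¹) * (z ^ 4 + τ ^ 2 * (1 + z) ^ 2) := by
  have h1 : 1 ≤ (τ₀ ^ 2)⁻¹ * τ ^ 2 := by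
    rw [← sq_abs τ, inv_mul_eq_div, one_le_div (by positivity)]
    gcongr
  have h2 : 0 ≤ (1 + (τ₀ ^ 2)⁻¹) * z ^ 4 := by positivity
  have h3 : 0 ≤ (1 + z) ^ 2 := by positivity
  nlinarith

/-- The constant of the whole space estimate for time frequencies `|τ| ≥ τ₀`. -/
def modeConst (τ₀ : ℝ) : ℝ := 16 * (1 + (τ₀ ^ 2)⁻¹) + 2

/-- Cramer's rule for `iτ v₁ + z v₂ = a`, `-(z + iτ) v₁ + v₂ = b`: the entries of the inverse
symbol are bounded in the norms of the solution space and of the data. -/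
theorem norm_solve_le {τ τ₀ z : ℝ} (h0 : 0 < τ₀) (hτ : τ₀ ≤ |τ|) (hz : 0 ≤ z) (a b : ℂ) :
    (1 + τ ^ 2) * (1 + z) * ‖(a - z * b) / chgDet τ z‖ ^ 2 ≤
      modeConst τ₀ * (‖a‖ ^ 2 + (1 + z) * ‖b‖ ^ 2) ∧
    (1 + z) ^ 3 * ‖(a - z * b) / chgDet τ z‖ ^ 2 ≤
      modeConst τ₀ * (‖a‖ ^ 2 + (1 + z) * ‖b‖ ^ 2) ∧
    (1 + z) ^ 2 * ‖(Complex.I * τ * b + (z + Complex.I * τ) * a) / chgDet τ z‖ ^ 2 ≤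
      modeConst τ₀ * (‖a‖ ^ 2 + (1 + z) * ‖b‖ ^ 2) := by
  have hτ0 : τ ≠ 0 := fun h => by rw [h, abs_zero] at hτ; linarith
  have hP : 0 < z ^ 4 + τ ^ 2 * (1 + z) ^ 2 := by positivity
  have hc : 0 ≤ (τ₀ ^ 2)⁻¹ := by positivity
  have k1 := one_add_pow_four_le h0 hτ hz
  have k2 := one_add_sq_mul_le h0 hτ hz
  have hsq : ∀ x y : ℝ, (x + y) ^ 2 ≤ 2 * (x ^ 2 + y ^ 2) := fun x y => by
    nlinarith [sq_nonneg (x - y)]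
  have hN1 : ‖a - z * b‖ ^ 2 ≤ 2 * (‖a‖ ^ 2 + z ^ 2 * ‖b‖ ^ 2) := by
    have : ‖a - z * b‖ ≤ ‖a‖ + z * ‖b‖ := by
      refine (norm_sub_le _ _).trans (le_of_eq ?_)
      rw [norm_mul, Complex.norm_real, Real.norm_of_nonneg hz]
    calc _ ≤ (‖a‖ + z * ‖b‖) ^ 2 := by gcongr
      _ ≤ 2 * (‖a‖ ^ 2 + (z * ‖b‖) ^ 2) := hsq _ _
      _ = _ := by ring
  have hN2 : ‖Complex.I * τ * b + (z + Complex.I * τ) * a‖ ^ 2 ≤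
      2 * (τ ^ 2 * ‖b‖ ^ 2 + (z ^ 2 + τ ^ 2) * ‖a‖ ^ 2) := by
    have e1 : ‖(z + Complex.I * τ : ℂ)‖ ^ 2 = z ^ 2 + τ ^ 2 := by
      rw [mul_comm Complex.I, ← Complex.normSq_eq_norm_sq, Complex.normSq_add_mul_I]
    have e2 : ‖Complex.I * τ * b‖ ^ 2 = τ ^ 2 * ‖b‖ ^ 2 := by
      rw [norm_mul, norm_mul, Complex.norm_I, one_mul, Complex.norm_real, mul_pow,
        Real.norm_eq_abs, sq_abs]
    calc _ ≤ (‖Complex.I * τ * b‖ + ‖(z + Complex.I * τ) * a‖) ^ 2 := by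
          gcongr; exact norm_add_le _ _
      _ ≤ 2 * (‖Complex.I * τ * b‖ ^ 2 + ‖(z + Complex.I * τ) * a‖ ^ 2) := hsq _ _
      _ = _ := by rw [e2, norm_mul, mul_pow, e1]
  have hA := sq_nonneg ‖a‖
  have hB := sq_nonneg ‖b‖
  unfold modeConst
  set P := z ^ 4 + τ ^ 2 * (1 + z) ^ 2 with hPdef
  set c := (τ₀ ^ 2)⁻¹
  set A := ‖a‖ ^ 2
  set B := ‖b‖ ^ 2
  rw [norm_div, div_pow, norm_div, div_pow, norm_chgDet_sq, ← hPdef, ← mul_div_assoc,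
    ← mul_div_assoc, ← mul_div_assoc, div_le_iff₀ hP, div_le_iff₀ hP, div_le_iff₀ hP]
  have hS : 0 ≤ A + (1 + z) * B := by positivity
  have j1 : A + z ^ 2 * B ≤ (1 + z) * (A + (1 + z) * B) := by nlinarith [mul_nonneg hz hA, mul_nonneg hz hB, mul_nonneg hz (mul_nonneg hz hB)]
  refine ⟨?_, ?_, ?_⟩
  · calc (1 + τ ^ 2) * (1 + z) * ‖a - z * b‖ ^ 2
        ≤ (1 + τ ^ 2) * (1 + z) * (2 * ((1 + z) * (A + (1 + z) * B))) := by
          gcongr; exact hN1.trans (by linarith)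
      _ = 2 * ((1 + τ ^ 2) * (1 + z) ^ 2) * (A + (1 + z) * B) := by ring
      _ ≤ 2 * ((1 + c) * P) * (A + (1 + z) * B) := by gcongr
      _ ≤ (16 * (1 + c) + 2) * (A + (1 + z) * B) * P := by
          have : 0 ≤ (A + (1 + z) * B) * P := by positivity
          nlinarith [mul_nonneg hc this]
  · calc (1 + z) ^ 3 * ‖a - z * b‖ ^ 2
        ≤ (1 + z) ^ 3 * (2 * ((1 + z) * (A + (1 + z) * B))) := by
          gcongr; exact hN1.trans (by linarith)
      _ = 2 * ((1 + z) ^ 4) * (A + (1 + z) * B) := by ring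
      _ ≤ 2 * (8 * (1 + c) * P) * (A + (1 + z) * B) := by gcongr
      _ ≤ (16 * (1 + c) + 2) * (A + (1 + z) * B) * P := by
          have : 0 ≤ (A + (1 + z) * B) * P := by positivity
          nlinarith [mul_nonneg hc this]
  · have j2 : (1 + z) ^ 2 * τ ^ 2 ≤ P := by rw [hPdef]; nlinarith [pow_nonneg hz 4]
    have j3 : (1 + z) ^ 2 * (z ^ 2 + τ ^ 2) ≤ 8 * (1 + c) * P + P := by
      have : (1 + z) ^ 2 * z ^ 2 ≤ (1 + z) ^ 4 := by
        nlinarith [sq_nonneg (1 + z), mul_nonneg hz (sq_nonneg (1 + z))]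
      nlinarith
    calc (1 + z) ^ 2 * ‖Complex.I * τ * b + (z + Complex.I * τ) * a‖ ^ 2
        ≤ (1 + z) ^ 2 * (2 * (τ ^ 2 * B + (z ^ 2 + τ ^ 2) * A)) := by gcongr
      _ = 2 * (((1 + z) ^ 2 * τ ^ 2) * B + ((1 + z) ^ 2 * (z ^ 2 + τ ^ 2)) * A) := by ring
      _ ≤ 2 * (P * B + (8 * (1 + c) * P + P) * A) := by gcongr
      _ ≤ (16 * (1 + c) + 2) * (A + (1 + z) * B) * P := by
          have e1 : 0 ≤ B * P := by positivity
          have e2 : 0 ≤ z * B * P := by positivity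
          nlinarith [mul_nonneg hc e1, mul_nonneg hc e2]

end ModeProblem

/-! ### The resolvent problem: whole space and uniqueness -/

section ModeSolvability

variable {d : ℕ}

theorem jap_refl (ξ : Eu (d + 1)) : jap (refl d ξ) = jap ξ := by
  unfold jap
  rw [← map_smul, LinearIsometryEquiv.norm_map]

theorem lapSymbol_eq {m : ℕ} (ξ : Eu m) : lapSymbol ξ = -((jap ξ - 1 : ℝ) : ℂ) := by
  unfold lapSymbol jap
  rw [add_sub_cancel_left]

theorem aemeasurable_weight_mul {m : ℕ} (r : ℝ) (a : SpaceL2 m) : AEMeasurable (fun ξ : Eu m =>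
    ENNReal.ofReal (jap ξ ^ r) * ‖(𝓕 a : SpaceL2 m) ξ‖ₑ ^ 2) :=
  (by fun_prop : Measurable fun ξ : Eu m => ENNReal.ofReal (jap ξ ^ r)).aemeasurable.mul
    ((Lp.aestronglyMeasurable _).enorm.pow_const 2)

theorem lintegral_weight_le {m : ℕ} {w : Eu m → ℝ} {H : Eu m → ℂ} {C : ℝ} (hw : ∀ ξ, 0 ≤ w ξ)
    (hC : 0 ≤ C) {a b : SpaceL2 m} (h : ∀ ξ, w ξ * ‖H ξ‖ ^ 2 ≤
      C * (‖(𝓕 a : SpaceL2 m) ξ‖ ^ 2 + jap ξ * ‖(𝓕 b : SpaceL2 m) ξ‖ ^ 2)) :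
    ∫⁻ ξ, ENNReal.ofReal (w ξ) * ‖H ξ‖ₑ ^ 2 ≤ ENNReal.ofReal C * (sobSq 0 a + sobSq 1 b) := by
  unfold sobSq
  rw [← lintegral_add_left' (aemeasurable_weight_mul 0 a),
    ← lintegral_const_mul' _ _ ENNReal.ofReal_ne_top]
  refine lintegral_mono fun ξ => ?_
  simp only [Real.rpow_zero, Real.rpow_one, ENNReal.ofReal_one, one_mul]
  simp only [← ofReal_norm, ← ENNReal.ofReal_pow (norm_nonneg _)]
  rw [← ENNReal.ofReal_mul (hw ξ), ← ENNReal.ofReal_mul (jap_pos ξ).le,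
    ← ENNReal.ofReal_add (by positivity) (mul_nonneg (jap_pos ξ).le (by positivity)),
    ← ENNReal.ofReal_mul hC]
  exact ENNReal.ofReal_le_ofReal (h ξ)

/-- The system on the whole space, for one time frequency `τ ≠ 0`: it is solved by inverting its
symbol. Since the symbol is even in the normal frequency, even data have an even solution. -/
theorem exists_wholeSpace_solution {τ₀ : ℝ} (h0 : 0 < τ₀) {τ : ℝ} (hτ : τ₀ ≤ |τ|)
    {e₁ e₂ : SpaceL2 (d + 1)} (he₂ : sobSq 1 e₂ < ⊤)
    (h1 : ∀ᵐ ξ, (𝓕 e₁ : SpaceL2 (d + 1)) (refl d ξ) = (𝓕 e₁ : SpaceL2 (d + 1)) ξ)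
    (h2 : ∀ᵐ ξ, (𝓕 e₂ : SpaceL2 (d + 1)) (refl d ξ) = (𝓕 e₂ : SpaceL2 (d + 1)) ξ) :
    ∃ V₁ V₂ L₁ L₂ : SpaceL2 (d + 1), IsMul lapSymbol V₁ L₁ ∧ IsMul lapSymbol V₂ L₂ ∧
      (Complex.I * τ) • V₁ - L₂ = e₁ ∧ L₁ - (Complex.I * τ) • V₁ + V₂ = e₂ ∧
      (∀ᵐ ξ, (𝓕 V₁ : SpaceL2 (d + 1)) (refl d ξ) = (𝓕 V₁ : SpaceL2 (d + 1)) ξ) ∧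
      (∀ᵐ ξ, (𝓕 V₂ : SpaceL2 (d + 1)) (refl d ξ) = (𝓕 V₂ : SpaceL2 (d + 1)) ξ) ∧
      ENNReal.ofReal (1 + τ ^ 2) * sobSq 1 V₁ + sobSq 3 V₁ + sobSq 2 V₂ ≤
        3 * ENNReal.ofReal (modeConst τ₀) * (sobSq 0 e₁ + sobSq 1 e₂) := by
  have hτ0 : τ ≠ 0 := fun h => by rw [h, abs_zero] at hτ; linarith
  have hz : ∀ ξ : Eu (d + 1), 0 ≤ jap ξ - 1 := fun ξ => by linarith [one_le_jap ξ]
  have hC : 0 ≤ modeConst τ₀ := by unfold modeConst; positivity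
  let H₁ : Eu (d + 1) → ℂ := fun ξ => ((𝓕 e₁ : SpaceL2 (d + 1)) ξ - (jap ξ - 1 : ℝ) *
    (𝓕 e₂ : SpaceL2 (d + 1)) ξ) / chgDet τ (jap ξ - 1)
  let H₂ : Eu (d + 1) → ℂ := fun ξ => (Complex.I * τ * (𝓕 e₂ : SpaceL2 (d + 1)) ξ +
    ((jap ξ - 1 : ℝ) + Complex.I * τ) * (𝓕 e₁ : SpaceL2 (d + 1)) ξ) / chgDet τ (jap ξ - 1)
  have key := fun ξ : Eu (d + 1) => norm_solve_le h0 hτ (hz ξ) ((𝓕 e₁ : SpaceL2 (d + 1)) ξ)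
    ((𝓕 e₂ : SpaceL2 (d + 1)) ξ)
  simp only [add_sub_cancel] at key
  have hm₁ := Lp.aestronglyMeasurable (𝓕 e₁ : SpaceL2 (d + 1))
  have hm₂ := Lp.aestronglyMeasurable (𝓕 e₂ : SpaceL2 (d + 1))
  have hjm : AEStronglyMeasurable (fun ξ : Eu (d + 1) => ((jap ξ - 1 : ℝ) : ℂ)) :=
    Measurable.aestronglyMeasurable (by fun_prop)
  have hdm : AEStronglyMeasurable (fun ξ : Eu (d + 1) => (chgDet τ (jap ξ - 1))⁻¹) := by
    unfold chgDet
    exact Measurable.aestronglyMeasurable (by fun_prop)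
  have hH₁ : AEStronglyMeasurable H₁ := by
    simp only [H₁, div_eq_mul_inv]
    exact (hm₁.sub (hjm.mul hm₂)).mul hdm
  have hH₂ : AEStronglyMeasurable H₂ := by
    simp only [H₂, div_eq_mul_inv]
    exact ((hm₂.const_mul _).add ((hjm.add aestronglyMeasurable_const).mul hm₁)).mul hdm
  have b1 := lintegral_weight_le (w := fun ξ => (1 + τ ^ 2) * jap ξ) (H := H₁)
    (fun ξ => mul_nonneg (by positivity) (jap_pos ξ).le) hC fun ξ => (key ξ).1
  have b2 := lintegral_weight_le (w := fun ξ => jap ξ ^ 3) (H := H₁)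
    (fun ξ => (pow_pos (jap_pos ξ) 3).le) hC fun ξ => (key ξ).2.1
  have b3 := lintegral_weight_le (w := fun ξ => jap ξ ^ 2) (H := H₂)
    (fun ξ => (pow_pos (jap_pos ξ) 2).le) hC fun ξ => (key ξ).2.2
  set N := sobSq 0 e₁ + sobSq 1 e₂ with hN
  by_cases hNtop : sobSq 0 e₁ = ⊤
  · rw [sobSq_zero_order] at hNtop
    exact absurd hNtop (ENNReal.pow_ne_top enorm_ne_top)
  have hNt : ENNReal.ofReal (modeConst τ₀) * N < ⊤ :=
    ENNReal.mul_lt_top ENNReal.ofReal_lt_top (ENNReal.add_lt_top.2 ⟨lt_top_iff_ne_top.2 hNtop, he₂⟩)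
  have hone : ∀ (n : ℕ) (H : Eu (d + 1) → ℂ), ∫⁻ ξ, ‖H ξ‖ₑ ^ 2 ≤
      ∫⁻ ξ, ENNReal.ofReal (jap ξ ^ n) * ‖H ξ‖ₑ ^ 2 := fun n H => by
    refine lintegral_mono fun ξ => le_mul_of_one_le_left zero_le ?_
    rw [← ENNReal.ofReal_one]
    exact ENNReal.ofReal_le_ofReal (one_le_pow₀ (one_le_jap ξ))
  obtain ⟨V₁, hV₁⟩ := exists_fourier_ae_eq hH₁ (((hone 3 H₁).trans b2).trans_lt hNt)
  obtain ⟨V₂, hV₂⟩ := exists_fourier_ae_eq hH₂ (((hone 2 H₂).trans b3).trans_lt hNt)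
  have c1 : ENNReal.ofReal (1 + τ ^ 2) * sobSq 1 V₁ ≤ ENNReal.ofReal (modeConst τ₀) * N := by
    refine le_trans (le_of_eq ?_) b1
    rw [sobSq, ← lintegral_const_mul' _ _ ENNReal.ofReal_ne_top]
    refine lintegral_congr_ae ?_
    filter_upwards [hV₁] with ξ hξ
    rw [hξ, Real.rpow_one, ← mul_assoc, ← ENNReal.ofReal_mul (by positivity)]
  have c2 : sobSq 3 V₁ ≤ ENNReal.ofReal (modeConst τ₀) * N := by
    refine le_trans (le_of_eq ?_) b2
    rw [sobSq]
    refine lintegral_congr_ae ?_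
    filter_upwards [hV₁] with ξ hξ
    rw [hξ]
    norm_cast
  have c3 : sobSq 2 V₂ ≤ ENNReal.ofReal (modeConst τ₀) * N := by
    refine le_trans (le_of_eq ?_) b3
    rw [sobSq]
    refine lintegral_congr_ae ?_
    filter_upwards [hV₂] with ξ hξ
    rw [hξ, Real.rpow_two]
  obtain ⟨L₁, hL₁⟩ := exists_lap (((sobSq_mono (by norm_num) V₁).trans c2).trans_lt hNt)
  obtain ⟨L₂, hL₂⟩ := exists_lap (c3.trans_lt hNt)
  have hdet : ∀ ξ : Eu (d + 1), chgDet τ (jap ξ - 1) ≠ 0 := fun ξ => chgDet_ne_zero hτ0 (hz ξ)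
  refine ⟨V₁, V₂, L₁, L₂, hL₁, hL₂, ?_, ?_, ?_, ?_, ?_⟩
  · refine fourier_injective (Lp.ext ?_)
    filter_upwards [coeFn_fourier_sub ((Complex.I * τ) • V₁) L₂,
      coeFn_fourier_smul (Complex.I * τ) V₁, hL₂, hV₁, hV₂] with ξ k1 k2 k3 k4 k5
    rw [k1, k2, k3, k4, k5, lapSymbol_eq]
    simp only [H₁, H₂]
    have h := hdet ξ
    field_simp
    unfold chgDet
    push_cast
    ring
  · refine fourier_injective (Lp.ext ?_)
    filter_upwards [coeFn_fourier_add (L₁ - (Complex.I * τ) • V₁) V₂,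
      coeFn_fourier_sub L₁ ((Complex.I * τ) • V₁),
      coeFn_fourier_smul (Complex.I * τ) V₁, hL₁, hV₁, hV₂] with ξ k0 k1 k2 k3 k4 k5
    rw [k0, k1, k2, k3, k4, k5, lapSymbol_eq]
    simp only [H₁, H₂]
    have h := hdet ξ
    field_simp
    unfold chgDet
    push_cast
    ring
  · filter_upwards [hV₁, measurePreserving_refl.quasiMeasurePreserving.ae hV₁, h1, h2]
      with ξ k1 k2 k3 k4
    rw [k1, k2]
    simp only [H₁, jap_refl, k3, k4]
  · filter_upwards [hV₂, measurePreserving_refl.quasiMeasurePreserving.ae hV₂, h1, h2]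
      with ξ k1 k2 k3 k4
    rw [k1, k2]
    simp only [H₂, jap_refl, k3, k4]
  · refine (add_le_add (add_le_add c1 c2) c3).trans (le_of_eq ?_)
    ring

theorem isTrace_normalDeriv_zero_of_even {a q : SpaceL2 (d + 1)}
    (ha : ∀ᵐ ξ, (𝓕 a : SpaceL2 (d + 1)) (refl d ξ) = (𝓕 a : SpaceL2 (d + 1)) ξ)
    (hq : IsMul (derivSymbol (normal d)) a q) : IsTrace q 0 := by
  refine isTrace_zero_of_odd ?_
  filter_upwards [hq, measurePreserving_refl.quasiMeasurePreserving.ae hq, ha] with ξ k1 k2 k3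
  rw [k1, k2, k3]
  simp only [derivSymbol, inner_normal, refl_last]
  push_cast
  ring

/-- The boundary value problem for one time frequency `τ`, on the level of extensions to the whole
space: `i τ u₁ - Δ u₂ = f₁` and `Δ u₁ - i τ u₁ + u₂ = f₂` on the half space, and `∂ₙ u_j = g_j` on
its boundary. -/
structure SolvesMode (τ : ℝ) (u₁ u₂ f₁ f₂ : SpaceL2 (d + 1)) (g₁ g₂ : SpaceL2 d) : Prop where
  eq_one : ∀ L₂, IsMul lapSymbol u₂ L₂ →
    resHalf d ((Complex.I * τ) • u₁ - L₂) = resHalf d f₁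
  eq_two : ∀ L₁, IsMul lapSymbol u₁ L₁ →
    resHalf d (L₁ - (Complex.I * τ) • u₁ + u₂) = resHalf d f₂
  trace_one : ∀ q, IsMul (derivSymbol (normal d)) u₁ q → IsTrace q g₁
  trace_two : ∀ q, IsMul (derivSymbol (normal d)) u₂ q → IsTrace q g₂

/-- Uniqueness for one time frequency: the even extension of a solution with vanishing data solves
the homogeneous system on the whole space, where the symbol is invertible. -/
theorem SolvesMode.eq_zero {τ : ℝ} (hτ : τ ≠ 0) {u₁ u₂ f₁ f₂ : SpaceL2 (d + 1)}
    (h : SolvesMode τ u₁ u₂ f₁ f₂ 0 0) (hf₁ : resHalf d f₁ = 0) (hf₂ : resHalf d f₂ = 0)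
    (hu₁ : sobSq 2 u₁ < ⊤) (hu₂ : sobSq 2 u₂ < ⊤) : resHalf d u₁ = 0 ∧ resHalf d u₂ = 0 := by
  obtain ⟨L₁, hL₁⟩ := exists_lap hu₁
  obtain ⟨L₂, hL₂⟩ := exists_lap hu₂
  obtain ⟨q₁, hq₁⟩ := exists_deriv (normal d) ((sobSq_mono (by norm_num) u₁).trans_lt hu₁)
  obtain ⟨q₂, hq₂⟩ := exists_deriv (normal d) ((sobSq_mono (by norm_num) u₂).trans_lt hu₂)
  have k1 := isMul_lap_fold hu₁ hq₁ (h.trace_one q₁ hq₁) hL₁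
  have k2 := isMul_lap_fold hu₂ hq₂ (h.trace_two q₂ hq₂) hL₂
  have e1 := congrArg (fold 1) ((h.eq_one L₂ hL₂).trans hf₁)
  have e2 := congrArg (fold 1) ((h.eq_two L₁ hL₁).trans hf₂)
  simp only [map_sub, map_add, map_smul, map_zero] at e1 e2
  set E₁ := fold 1 (resHalf d u₁) with hE₁
  set E₂ := fold 1 (resHalf d u₂) with hE₂
  set M₁ := fold 1 (resHalf d L₁)
  set M₂ := fold 1 (resHalf d L₂)
  have hzero : ∀ᵐ ξ, (𝓕 E₁ : SpaceL2 (d + 1)) ξ = 0 ∧ (𝓕 E₂ : SpaceL2 (d + 1)) ξ = 0 := by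
    have f1 := coeFn_fourier_sub ((Complex.I * τ) • E₁) M₂
    rw [e1] at f1
    have f2 := coeFn_fourier_add (M₁ - (Complex.I * τ) • E₁) E₂
    rw [e2] at f2
    filter_upwards [f1, f2, coeFn_fourier_sub M₁ ((Complex.I * τ) • E₁),
      coeFn_fourier_smul (Complex.I * τ) E₁, k1, k2, coeFn_fourier_zero (m := d + 1)]
      with ξ a1 a2 a3 a4 a5 a6 a7
    rw [a7, a4, a6, lapSymbol_eq] at a1
    rw [a7, a3, a4, a5, lapSymbol_eq] at a2
    have hdet := chgDet_ne_zero hτ (z := jap ξ - 1) (by linarith [one_le_jap ξ])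
    have hE : (𝓕 E₁ : SpaceL2 (d + 1)) ξ = 0 := by
      have : chgDet τ (jap ξ - 1) * (𝓕 E₁ : SpaceL2 (d + 1)) ξ = 0 := by
        unfold chgDet
        push_cast at a1 a2 ⊢
        -- eliminate the second unknown
        linear_combination (-1 : ℂ) * a1 + ((jap ξ : ℂ) - 1) * a2
      exact (mul_eq_zero.1 this).resolve_left hdet
    refine ⟨hE, ?_⟩
    rw [hE] at a2
    simpa using a2.symm
  have hres : ∀ a : HalfL2 d, (∀ᵐ ξ, (𝓕 (fold 1 a) : SpaceL2 (d + 1)) ξ = 0) → a = 0 := by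
    intro a ha
    have : fold 1 a = 0 := by
      refine fourier_injective (Lp.ext ?_)
      filter_upwards [ha, coeFn_fourier_zero (m := d + 1)] with ξ b1 b2
      rw [b1, b2]
    rw [← resHalf_fold 1 a, this, map_zero]
  exact ⟨hres _ (hzero.mono fun ξ hξ => hξ.1), hres _ (hzero.mono fun ξ hξ => hξ.2)⟩

end ModeSolvability

/-! ### The resolvent problem: uniform estimates -/

section ModeBounds

variable {d : ℕ}

theorem enorm_I_mul_ofReal_sq (τ : ℝ) : ‖(Complex.I * τ : ℂ)‖ₑ ^ 2 ≤ ENNReal.ofReal (1 + τ ^ 2) := by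
  rw [← ofReal_norm, ← ENNReal.ofReal_pow (norm_nonneg _), norm_mul, Complex.norm_I, one_mul,
    Complex.norm_real, Real.norm_eq_abs, sq_abs]
  exact ENNReal.ofReal_le_ofReal (by linarith)

theorem sobSq_smul_sub_le {τ : ℝ} (s : ℝ) (a b : SpaceL2 (d + 1)) :
    sobSq s ((Complex.I * τ) • a - b) ≤
      2 * (ENNReal.ofReal (1 + τ ^ 2) * sobSq s a + sobSq s b) := by
  refine (sobSq_sub_le s _ _).trans ?_
  rw [sobSq_smul]
  gcongr
  exact enorm_I_mul_ofReal_sq τ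

theorem sobSq_sub_smul_add_le {τ : ℝ} (s : ℝ) (a b c : SpaceL2 (d + 1)) :
    sobSq s (a - (Complex.I * τ) • b + c) ≤
      4 * (sobSq s a + ENNReal.ofReal (1 + τ ^ 2) * sobSq s b) + 2 * sobSq s c := by
  have h1 := sobSq_add_le s (a - (Complex.I * τ) • b) c
  have h2 := sobSq_sub_le s a ((Complex.I * τ) • b)
  rw [sobSq_smul] at h2
  calc _ ≤ 2 * (sobSq s (a - (Complex.I * τ) • b) + sobSq s c) := h1
    _ ≤ 2 * (2 * (sobSq s a + ENNReal.ofReal (1 + τ ^ 2) * sobSq s b) + sobSq s c) := by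
        gcongr
        refine h2.trans ?_
        gcongr
        exact enorm_I_mul_ofReal_sq τ
    _ = _ := by ring

/-- Solvability for one time frequency with a bound that is uniform for `τ` away from zero. Subtract
lifts of the Neumann data, extend the remaining right-hand sides evenly and solve on the whole space;
the solution is even and thus has vanishing Neumann traces. -/
theorem exists_solvesMode {τ₀ : ℝ} (h0 : 0 < τ₀) : ∃ C : ℝ≥0, ∀ τ : ℝ, τ₀ ≤ |τ| →
    ∀ (f₁ f₂ : SpaceL2 (d + 1)) (g₁ g₂ : SpaceL2 d), sobSq 1 f₂ < ⊤ → sobSq (3 / 2) g₁ < ⊤ →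
    sobSq (1 / 2) g₂ < ⊤ → ∃ u₁ u₂ : SpaceL2 (d + 1), SolvesMode τ u₁ u₂ f₁ f₂ g₁ g₂ ∧
      ENNReal.ofReal (1 + τ ^ 2) * sobSq 1 u₁ + sobSq 3 u₁ + sobSq 2 u₂ ≤
        C * (sobSq 0 f₁ + sobSq 1 f₂ + (ENNReal.ofReal ((1 + τ ^ 2) ^ (3 / 4 : ℝ)) * sobSq 0 g₁ +
          sobSq (3 / 2) g₁) + sobSq (1 / 2) g₂) := by
  obtain ⟨C₁, lift₁⟩ := exists_neumannLift_one (d := d)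
  obtain ⟨C₂, lift₂⟩ := exists_neumannLift_two (d := d)
  set m : ℝ≥0 := (modeConst τ₀).toNNReal with hm
  refine ⟨2 * (6 * m * (4 + 12 * C₁ + 8 * C₂) + C₁ + C₂), ?_⟩
  intro τ hτ f₁ f₂ g₁ g₂ hf₂ hg₁ hg₂
  obtain ⟨U₁, p₁, hp₁, tp₁, b₁⟩ := lift₁ τ g₁
  obtain ⟨U₂, p₂, hp₂, tp₂, b₂⟩ := lift₂ g₂
  set W := ENNReal.ofReal (1 + τ ^ 2) with hW
  have hW1 : 1 ≤ W := by
    rw [hW, ← ENNReal.ofReal_one]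
    exact ENNReal.ofReal_le_ofReal (by linarith [sq_nonneg τ])
  set Ng := ENNReal.ofReal ((1 + τ ^ 2) ^ (3 / 4 : ℝ)) * sobSq 0 g₁ + sobSq (3 / 2) g₁ with hNg
  have hNg_top : Ng < ⊤ := ENNReal.add_lt_top.2 ⟨ENNReal.mul_lt_top ENNReal.ofReal_lt_top
    ((sobSq_mono (by norm_num) g₁).trans_lt hg₁), hg₁⟩
  set N := sobSq 0 f₁ + sobSq 1 f₂ + Ng + sobSq (1 / 2) g₂ with hN
  have nf : sobSq 0 f₁ + sobSq 1 f₂ ≤ N := by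
    rw [hN, add_assoc (sobSq 0 f₁ + sobSq 1 f₂)]
    exact le_self_add
  set X := W * sobSq 1 U₁ + sobSq 3 U₁ with hX
  have X1 : W * sobSq 1 U₁ ≤ X := le_self_add
  have X3 : sobSq 3 U₁ ≤ X := le_add_self
  have hXN : X ≤ C₁ * N := b₁.trans (mul_le_mul_right (by
    rw [hN, add_right_comm]
    exact le_add_self) _)
  have hYN : sobSq 2 U₂ ≤ C₂ * N := b₂.trans (mul_le_mul_right le_add_self _)
  have hX_top : X < ⊤ := b₁.trans_lt (ENNReal.mul_lt_top ENNReal.coe_lt_top hNg_top)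
  have hU₁ : sobSq 3 U₁ < ⊤ := X3.trans_lt hX_top
  have hU₂ : sobSq 2 U₂ < ⊤ := b₂.trans_lt (ENNReal.mul_lt_top ENNReal.coe_lt_top hg₂)
  obtain ⟨P₁, hP₁⟩ := exists_lap ((sobSq_mono (by norm_num) U₁).trans_lt hU₁)
  obtain ⟨P₂, hP₂⟩ := exists_lap hU₂
  -- the right-hand sides that remain after subtracting the lifts `U₁`, `U₂`
  set F₁ := f₁ - ((Complex.I * τ) • U₁ - P₂) with hF₁
  set F₂ := f₂ - (P₁ - (Complex.I * τ) • U₁ + U₂) with hF₂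
  have hP2 : sobSq 0 P₂ ≤ sobSq 2 U₂ := by simpa using sobSq_lap_le hP₂ 0
  have hP1 : sobSq 1 P₁ ≤ sobSq 3 U₁ := by
    have := sobSq_lap_le hP₁ 1
    norm_num at this
    exact this
  have e₁ : sobSq 0 F₁ ≤ 2 * (sobSq 0 f₁ + 2 * (X + sobSq 2 U₂)) := by
    refine (sobSq_sub_le 0 _ _).trans ?_
    gcongr
    refine (sobSq_smul_sub_le 0 _ _).trans ?_
    gcongr
    exact (mul_le_mul_right (sobSq_mono (by norm_num) U₁) _).trans X1
  have e₂ : sobSq 1 F₂ ≤ 2 * (sobSq 1 f₂ + (4 * X + 2 * sobSq 2 U₂)) := by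
    refine (sobSq_sub_le 1 _ _).trans ?_
    gcongr
    refine (sobSq_sub_smul_add_le 1 _ _ _).trans ?_
    gcongr
    · rw [hX, add_comm]
      gcongr
    · exact sobSq_mono (by norm_num) _
  have hF₂_top : sobSq 1 F₂ < ⊤ := by
    refine e₂.trans_lt (ENNReal.mul_lt_top (by norm_num) (ENNReal.add_lt_top.2 ⟨hf₂, ?_⟩))
    exact ENNReal.add_lt_top.2 ⟨ENNReal.mul_lt_top (by norm_num) hX_top,
      ENNReal.mul_lt_top (by norm_num) hU₂⟩
  have s₁ : sobSq 0 (fold 1 (resHalf d F₁)) ≤ 2 * sobSq 0 F₁ := by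
    rw [sobSq_zero_order, sobSq_zero_order, enorm_fold_sq, enorm_one, one_pow, one_add_one_eq_two]
    exact mul_le_mul_right (enorm_resHalf_sq_le _) _
  have s₂ := sobSq_one_fold_le hF₂_top
  obtain ⟨V₁, V₂, L₁, L₂, hL₁, hL₂, q₁, q₂, ev₁, ev₂, bV⟩ :=
    exists_wholeSpace_solution h0 hτ (s₂.trans_lt (ENNReal.mul_lt_top (by norm_num) hF₂_top))
      (fourier_even (fold_one_even (resHalf d F₁))) (fourier_even (fold_one_even (resHalf d F₂)))
  have hbV : W * sobSq 1 V₁ + sobSq 3 V₁ + sobSq 2 V₂ ≤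
      (6 * m * (4 + 12 * C₁ + 8 * C₂) : ℝ≥0) * N := by
    refine bV.trans ?_
    calc 3 * (m : ℝ≥0∞) * (sobSq 0 (fold 1 (resHalf d F₁)) + sobSq 1 (fold 1 (resHalf d F₂)))
        ≤ 3 * m * (2 * (2 * (sobSq 0 f₁ + 2 * (X + sobSq 2 U₂))) +
          2 * (2 * (sobSq 1 f₂ + (4 * X + 2 * sobSq 2 U₂)))) := by
          gcongr
          · exact s₁.trans (mul_le_mul_right e₁ _)
          · exact s₂.trans (mul_le_mul_right e₂ _)
      _ = 6 * m * (2 * (sobSq 0 f₁ + sobSq 1 f₂) + 12 * X + 8 * sobSq 2 U₂) := by ring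
      _ ≤ 6 * m * (2 * N + 12 * (C₁ * N) + 8 * (C₂ * N)) := by gcongr
      _ = 6 * m * (2 + 12 * C₁ + 8 * C₂) * N := by ring
      _ ≤ 6 * m * (4 + 12 * C₁ + 8 * C₂) * N := by gcongr; norm_num
      _ = _ := by push_cast; ring
  have hV3 : sobSq 3 V₁ < ⊤ := by
    refine lt_of_le_of_lt (le_trans ?_ bV) (ENNReal.mul_lt_top (ENNReal.mul_lt_top (by norm_num)
      ENNReal.ofReal_lt_top) (ENNReal.add_lt_top.2 ⟨?_, s₂.trans_lt
        (ENNReal.mul_lt_top (by norm_num) hF₂_top)⟩))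
    · rw [add_right_comm]
      exact le_add_self
    · rw [sobSq_zero_order]
      exact ENNReal.pow_lt_top enorm_lt_top
  have hV2 : sobSq 2 V₂ < ⊤ := by
    refine lt_of_le_of_lt (le_trans le_add_self bV) (ENNReal.mul_lt_top (ENNReal.mul_lt_top
      (by norm_num) ENNReal.ofReal_lt_top) (ENNReal.add_lt_top.2 ⟨?_, s₂.trans_lt
        (ENNReal.mul_lt_top (by norm_num) hF₂_top)⟩))
    rw [sobSq_zero_order]
    exact ENNReal.pow_lt_top enorm_lt_top
  -- the even solution `V` does not contribute to the Neumann trace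
  have trace : ∀ {V U p q : SpaceL2 (d + 1)} {g : SpaceL2 d}, sobSq 2 V < ⊤ → sobSq 2 U < ⊤ →
      (∀ᵐ ξ, (𝓕 V : SpaceL2 (d + 1)) (refl d ξ) = (𝓕 V : SpaceL2 (d + 1)) ξ) →
      IsMul (derivSymbol (normal d)) U p → IsTrace p g →
      IsMul (derivSymbol (normal d)) (V + U) q → IsTrace q g := by
    intro V U p q g hV hU ev hp tp hq
    obtain ⟨v, hv⟩ := exists_deriv (normal d) ((sobSq_mono (by norm_num) V).trans_lt hV)
    have h3 := (isTrace_normalDeriv_zero_of_even ev hv).add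
      (sobSq_deriv_lt_top hv (by norm_num; exact hV)) (sobSq_deriv_lt_top hp (by norm_num; exact hU))
      tp
    rwa [zero_add, ← hq.unique (hv.add hp)] at h3
  refine ⟨V₁ + U₁, V₂ + U₂, ⟨?_, ?_, ?_, ?_⟩, ?_⟩
  · intro L hL
    rw [hL.unique (hL₂.add hP₂)]
    have e : (Complex.I * τ) • (V₁ + U₁) - (L₂ + P₂) =
        ((Complex.I * τ) • V₁ - L₂) + ((Complex.I * τ) • U₁ - P₂) := by
      rw [smul_add]
      abel
    rw [e, q₁, map_add, resHalf_fold, ← map_add, hF₁, sub_add_cancel]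
  · intro L hL
    rw [hL.unique (hL₁.add hP₁)]
    have e : L₁ + P₁ - (Complex.I * τ) • (V₁ + U₁) + (V₂ + U₂) =
        (L₁ - (Complex.I * τ) • V₁ + V₂) + (P₁ - (Complex.I * τ) • U₁ + U₂) := by
      rw [smul_add]
      abel
    rw [e, q₂, map_add, resHalf_fold, ← map_add, hF₂, sub_add_cancel]
  · intro q hq
    exact trace ((sobSq_mono (by norm_num) V₁).trans_lt hV3)
      ((sobSq_mono (by norm_num) U₁).trans_lt hU₁) ev₁ hp₁ tp₁ hq
  · intro q hq
    exact trace hV2 hU₂ ev₂ hp₂ tp₂ hq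
  · calc W * sobSq 1 (V₁ + U₁) + sobSq 3 (V₁ + U₁) + sobSq 2 (V₂ + U₂)
        ≤ W * (2 * (sobSq 1 V₁ + sobSq 1 U₁)) + 2 * (sobSq 3 V₁ + sobSq 3 U₁) +
          2 * (sobSq 2 V₂ + sobSq 2 U₂) := by
          gcongr <;> exact sobSq_add_le _ _ _
      _ = 2 * ((W * sobSq 1 V₁ + sobSq 3 V₁ + sobSq 2 V₂) + X + sobSq 2 U₂) := by
          rw [hX]
          ring
      _ ≤ 2 * ((6 * m * (4 + 12 * C₁ + 8 * C₂) : ℝ≥0) * N + C₁ * N + C₂ * N) := by gcongr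
      _ = _ := by push_cast; ring

theorem enorm_sq_eq_ofReal {E : Type*} [NormedAddCommGroup E] (a : E) :
    ‖a‖ₑ ^ 2 = ENNReal.ofReal (‖a‖ ^ 2) := by
  rw [← ofReal_norm, ENNReal.ofReal_pow (norm_nonneg _)]

theorem sobSq_normalDeriv_le {a b : SpaceL2 (d + 1)} (h : IsMul (derivSymbol (normal d)) a b)
    (s : ℝ) : sobSq s b ≤ sobSq (s + 1) a := by
  simpa using sobSq_deriv_le h s

/-- The time regularity of the Neumann trace: interpolate between the extensions in `H^{(1,1)}` and
in `H^{(0,3)}`, which need not coincide. -/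
theorem sobSq_trace_normalDeriv_le (τ : ℝ) {u u' q : SpaceL2 (d + 1)} {g : SpaceL2 d}
    (h : resHalf d u = resHalf d u') (hu : sobSq 1 u < ⊤) (hu' : sobSq 3 u' < ⊤)
    (hq : IsMul (derivSymbol (normal d)) u' q) (hg : IsTrace q g) :
    ENNReal.ofReal ((1 + τ ^ 2) ^ (3 / 4 : ℝ)) * sobSq 0 g ≤
      5 * (ENNReal.ofReal (1 + τ ^ 2) * sobSq 1 u + sobSq 3 u') := by
  have hq2 : sobSq 2 q < ⊤ := sobSq_deriv_lt_top hq (by norm_num; exact hu')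
  obtain ⟨q', hq'⟩ := exists_deriv (normal d) ((sobSq_mono (by norm_num) q).trans_lt hq2)
  have hq1 : sobSq 1 q' < ⊤ := sobSq_deriv_lt_top hq' (by norm_num; exact hq2)
  obtain ⟨r, hr⟩ := exists_deriv (normal d) hq1
  obtain ⟨p, hp⟩ := exists_deriv (normal d) hu
  have hpq : resHalf d q = resHalf d p := by
    have := resHalf_deriv_eq_zero (hq.sub hp) (by rw [map_sub, h, sub_self])
    rwa [map_sub, sub_eq_zero] at this
  have h4 := norm_trace_pow_four_le hq2 hq' hr hg
  rw [hpq] at h4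
  have b1 : ‖resHalf d p‖ₑ ^ 2 ≤ sobSq 1 u := by
    refine (enorm_resHalf_sq_le p).trans ?_
    rw [← sobSq_zero_order]
    simpa using sobSq_normalDeriv_le hp 0
  have b3 : ‖resHalf d r‖ₑ ^ 2 ≤ sobSq 3 u' := by
    refine (enorm_resHalf_sq_le r).trans ?_
    rw [← sobSq_zero_order]
    have k1 := sobSq_normalDeriv_le hr 0
    have k2 := sobSq_normalDeriv_le hq' 1
    have k3 := sobSq_normalDeriv_le hq 2
    norm_num at k1 k2 k3
    exact k1.trans (k2.trans k3)
  refine le_trans ?_ (mul_le_mul_right (add_le_add (mul_le_mul_right b1 _) b3) _)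
  rw [sobSq_zero_order, enorm_sq_eq_ofReal, enorm_sq_eq_ofReal, enorm_sq_eq_ofReal]
  have hW : (0 : ℝ) < 1 + τ ^ 2 := by positivity
  have e5 : (5 : ℝ≥0∞) = ENNReal.ofReal 5 := by norm_num
  rw [e5, ← ENNReal.ofReal_mul (by positivity), ← ENNReal.ofReal_mul (by positivity),
    ← ENNReal.ofReal_add (by positivity) (by positivity), ← ENNReal.ofReal_mul (by norm_num)]
  refine ENNReal.ofReal_le_ofReal ?_
  -- the product of `w⁶ = ⟨τ⟩³` and the interpolation inequality, split by Young's inequality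
  set w := (1 + τ ^ 2) ^ (1 / 4 : ℝ) with hw
  have hw0 : 0 ≤ w := by positivity
  have w3 : (1 + τ ^ 2) ^ (3 / 4 : ℝ) = w ^ 3 := by
    rw [hw, ← Real.rpow_mul_natCast hW.le]
    norm_num
  have w4 : 1 + τ ^ 2 = w ^ 4 := by
    rw [hw, ← Real.rpow_mul_natCast hW.le]
    norm_num
  rw [w3, w4]
  set P := ‖resHalf d p‖
  set R := ‖resHalf d r‖
  have hP : 0 ≤ P := norm_nonneg _
  have hR : 0 ≤ R := norm_nonneg _
  refine le_of_sq_le_sq ?_ (by positivity)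
  set x := w ^ 2 * P with hx
  have hx0 : 0 ≤ x := by positivity
  calc (w ^ 3 * ‖g‖ ^ 2) ^ 2 = w ^ 6 * ‖g‖ ^ 4 := by ring
    _ ≤ w ^ 6 * (24 * (P ^ 3 * R)) := by gcongr
    _ = 24 * (x ^ 3 * R) := by rw [hx]; ring
    _ ≤ (5 * (x ^ 2 + R ^ 2)) ^ 2 := by
        nlinarith [sq_nonneg (x - R), sq_nonneg (x ^ 2), mul_nonneg hx0 hR, sq_nonneg (R ^ 2),
          mul_nonneg (sq_nonneg x) (sq_nonneg (x - R)), mul_nonneg (sq_nonneg x) (sq_nonneg R)]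
    _ = (5 * (w ^ 4 * P ^ 2 + R ^ 2)) ^ 2 := by rw [hx]; ring

/-- Every function in the solution space produces data with a bound that does not depend on `τ`. -/
theorem exists_data_of_mode (τ : ℝ) {u u' u₂ : SpaceL2 (d + 1)} (h : resHalf d u = resHalf d u')
    (hu : sobSq 1 u < ⊤) (hu' : sobSq 3 u' < ⊤) (hu₂ : sobSq 2 u₂ < ⊤) :
    ∃ (f₁ f₂ : SpaceL2 (d + 1)) (g₁ g₂ : SpaceL2 d), SolvesMode τ u' u₂ f₁ f₂ g₁ g₂ ∧
      sobSq 0 f₁ + sobSq 1 f₂ + (ENNReal.ofReal ((1 + τ ^ 2) ^ (3 / 4 : ℝ)) * sobSq 0 g₁ +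
        sobSq (3 / 2) g₁) + sobSq (1 / 2) g₂ ≤
      20 * (ENNReal.ofReal (1 + τ ^ 2) * sobSq 1 u + sobSq 3 u' + sobSq 2 u₂) := by
  have hu'2 : sobSq 2 u' < ⊤ := (sobSq_mono (by norm_num) u').trans_lt hu'
  obtain ⟨L₁, hL₁⟩ := exists_lap hu'2
  obtain ⟨L₂, hL₂⟩ := exists_lap hu₂
  obtain ⟨q₁, hq₁⟩ := exists_deriv (normal d) ((sobSq_mono (by norm_num) u').trans_lt hu')
  obtain ⟨q₂, hq₂⟩ := exists_deriv (normal d) ((sobSq_mono (by norm_num) u₂).trans_lt hu₂)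
  have hq₁2 : sobSq 2 q₁ < ⊤ := sobSq_deriv_lt_top hq₁ (by norm_num; exact hu')
  have hq₂1 : sobSq 1 q₂ < ⊤ := sobSq_deriv_lt_top hq₂ (by norm_num; exact hu₂)
  obtain ⟨g₁, hg₁⟩ := exists_isTrace ((sobSq_mono (by norm_num) q₁).trans_lt hq₁2)
  obtain ⟨g₂, hg₂⟩ := exists_isTrace hq₂1
  -- the extension `u` enters where a factor `τ` occurs, the extension `u'` elsewhere
  refine ⟨(Complex.I * τ) • u - L₂, L₁ - (Complex.I * τ) • u + u₂, g₁, g₂,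
    ⟨fun L hL => ?_, fun L hL => ?_, fun q hq => ?_, fun q hq => ?_⟩, ?_⟩
  · rw [hL.unique hL₂, map_sub, map_sub, map_smul, map_smul, h]
  · rw [hL.unique hL₁, map_add, map_sub, map_smul, map_add, map_sub, map_smul, h]
  · rwa [hq.unique hq₁]
  · rwa [hq.unique hq₂]
  set W := ENNReal.ofReal (1 + τ ^ 2)
  have e1 : sobSq 0 ((Complex.I * τ) • u - L₂) ≤ 2 * (W * sobSq 1 u + sobSq 2 u₂) := by
    refine (sobSq_smul_sub_le 0 _ _).trans ?_
    gcongr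
    · exact sobSq_mono (by norm_num) _
    · simpa using sobSq_lap_le hL₂ 0
  have e2 : sobSq 1 (L₁ - (Complex.I * τ) • u + u₂) ≤
      4 * (sobSq 3 u' + W * sobSq 1 u) + 2 * sobSq 2 u₂ := by
    refine (sobSq_sub_smul_add_le 1 _ _ _).trans ?_
    gcongr
    · have := sobSq_lap_le hL₁ 1
      norm_num at this
      exact this
    · exact sobSq_mono (by norm_num) _
  have e3 := sobSq_trace_normalDeriv_le τ h hu hu' hq₁ hg₁
  have e4 : sobSq (3 / 2) g₁ ≤ sobSq 3 u' := by
    have k1 := hg₁.sobSq_le (r := 2) (by norm_num)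
    have k2 := sobSq_normalDeriv_le hq₁ 2
    norm_num at k1 k2
    exact k1.trans k2
  have e5 : sobSq (1 / 2) g₂ ≤ sobSq 2 u₂ := by
    have k1 := hg₂.sobSq_le (r := 1) (by norm_num)
    have k2 := sobSq_normalDeriv_le hq₂ 1
    norm_num at k1 k2 ⊢
    exact k1.trans k2
  refine (add_le_add (add_le_add (add_le_add e1 e2) (add_le_add e3 e4)) e5).trans ?_
  set x := W * sobSq 1 u
  set y := sobSq 3 u'
  set z := sobSq 2 u₂
  calc _ = 11 * x + 10 * y + 5 * z := by ring
    _ ≤ 20 * x + 20 * y + 20 * z := by gcongr <;> norm_num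
    _ = 20 * (x + y + z) := by ring

end ModeBounds

/-! ### Smoothness of parametric integrals -/

section ParametricIntegrals

variable {E F : Type} [NormedAddCommGroup E] [NormedSpace ℝ E] [ProperSpace E]
  [NormedAddCommGroup F] [NormedSpace ℝ F]

theorem hasFDerivAt_intervalIntegral_of_contDiff {ψ : ℝ × E → F} (hψ : ContDiff ℝ 1 ψ) (a b : ℝ)
    (x₀ : E) : HasFDerivAt (fun x => ∫ s in a..b, ψ (s, x))
      (∫ s in a..b, (fderiv ℝ ψ (s, x₀)).comp (ContinuousLinearMap.inr ℝ ℝ E)) x₀ := by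
  have hc : Continuous fun p : ℝ × E =>
      (fderiv ℝ ψ p).comp (ContinuousLinearMap.inr ℝ ℝ E) :=
    (hψ.continuous_fderiv (by norm_num)).clm_comp continuous_const
  obtain ⟨C, hC⟩ := (isCompact_uIcc.prod (isCompact_closedBall x₀ 1)).exists_bound_of_continuousOn
    (s := Set.uIcc a b ×ˢ Metric.closedBall x₀ 1) hc.continuousOn
  refine intervalIntegral.hasFDerivAt_integral_of_dominated_of_fderiv_le
    (F := fun x s => ψ (s, x))
    (F' := fun x s => (fderiv ℝ ψ (s, x)).comp (ContinuousLinearMap.inr ℝ ℝ E))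
    (bound := fun _ => C) (s := Metric.closedBall x₀ 1) (μ := volume)
    (Metric.closedBall_mem_nhds x₀ one_pos) ?_ ?_ ?_ ?_ ?_ ?_
  · exact Eventually.of_forall fun x =>
      (hψ.continuous.comp (by fun_prop)).aestronglyMeasurable
  · exact (hψ.continuous.comp (by fun_prop : Continuous fun s : ℝ => (s, x₀))).intervalIntegrable _ _
  · exact (hc.comp (by fun_prop : Continuous fun s : ℝ => (s, x₀))).aestronglyMeasurable
  · exact ae_of_all _ fun s hs x hx => hC (s, x) ⟨Set.uIoc_subset_uIcc hs, hx⟩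
  · exact intervalIntegrable_const
  · refine ae_of_all _ fun s _ x _ => ?_
    have h1 := (hψ.differentiable (by norm_num) (s, x)).hasFDerivAt
    exact h1.comp x (hasFDerivAt_prodMk_right s x)

/-- Differentiation under the integral sign. The target varies in the induction, since the
derivative of the integrand takes values in a space of linear maps. -/
theorem contDiff_intervalIntegral (n : ℕ) : ∀ {F : Type} [NormedAddCommGroup F] [NormedSpace ℝ F]
    {ψ : ℝ × E → F}, ContDiff ℝ (⊤ : ℕ∞) ψ → ∀ a b : ℝ,
    ContDiff ℝ n (fun x => ∫ s in a..b, ψ (s, x)) := by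
  induction n with
  | zero =>
    intro F _ _ ψ hψ a b
    rw [Nat.cast_zero, contDiff_zero]
    exact continuous_iff_continuousAt.2 fun x =>
      (hasFDerivAt_intervalIntegral_of_contDiff (hψ.of_le (mod_cast le_top)) a b x).continuousAt
  | succ n ih =>
    intro F _ _ ψ hψ a b
    have h := contDiff_succ_iff_hasFDerivAt (𝕜 := ℝ) (n := n)
      (f := fun x => ∫ s in a..b, ψ (s, x))
    rw [Nat.cast_add, Nat.cast_one, h]
    refine ⟨fun x => ∫ s in a..b, (fderiv ℝ ψ (s, x)).comp (ContinuousLinearMap.inr ℝ ℝ E), ?_,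
      hasFDerivAt_intervalIntegral_of_contDiff (hψ.of_le (mod_cast le_top)) a b⟩
    exact ih (ψ := fun p => (fderiv ℝ ψ p).comp (ContinuousLinearMap.inr ℝ ℝ E))
      ((hψ.fderiv_right (m := ((⊤ : ℕ∞) : WithTop ℕ∞)) (by simp)).clm_comp contDiff_const) a b

end ParametricIntegrals

/-! ### Test functions on the cylinder -/

section CylinderTestFunctions

variable {T : ℝ} {m : ℕ}

/-- The derivative of a smooth function on the cylinder in the direction `w` of time and space. -/
def dirDeriv (w : ℝ × Eu m) (φ : Cyl T m → ℂ) (p : Cyl T m) : ℂ :=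
  deriv (fun r : ℝ => φ (p.1 + ((r * w.1 : ℝ) : AddCircle T), p.2 + r • w.2)) 0

theorem timeDeriv_eq_dirDeriv (φ : Cyl T m → ℂ) : timeDeriv φ = dirDeriv (1, 0) φ := by
  ext p
  simp [timeDeriv, dirDeriv]

theorem normalDeriv_eq_dirDeriv {d : ℕ} (φ : Cyl T (d + 1) → ℂ) :
    normalDeriv φ = dirDeriv (0, normal d) φ := by
  ext p
  simp [normalDeriv, dirDeriv, lineDeriv]

theorem dirDeriv_coe {w : ℝ × Eu m} {φ : Cyl T m → ℂ} (hφ : IsTestFunction φ)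
    (p : ℝ × Eu m) : dirDeriv w φ ((p.1 : AddCircle T), p.2) =
      fderiv ℝ (fun q : ℝ × Eu m => φ ((q.1 : AddCircle T), q.2)) p w := by
  have h := (hφ.smooth.differentiable (by simp) p).lineDeriv_eq_fderiv (v := w)
  rw [← h, dirDeriv, lineDeriv]
  congr 1

theorem eventually_curve {P : Cyl T m → Prop} {p : Cyl T m} (w : ℝ × Eu m)
    (h : ∀ᶠ q in 𝓝 p, P q) :
    ∀ᶠ r : ℝ in 𝓝 0, P (p.1 + ((r * w.1 : ℝ) : AddCircle T), p.2 + r • w.2) := by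
  have hc : Continuous fun r : ℝ => ((p.1 + ((r * w.1 : ℝ) : AddCircle T), p.2 + r • w.2) :
      Cyl T m) :=
    (continuous_const.add ((AddCircle.continuous_mk' T).comp (by fun_prop))).prodMk (by fun_prop)
  refine hc.continuousAt.eventually ?_
  simpa using h

theorem support_dirDeriv_subset (w : ℝ × Eu m) (φ : Cyl T m → ℂ) :
    Function.support (dirDeriv w φ) ⊆ tsupport φ := by
  intro p hp
  by_contra h
  refine hp ?_
  have h1 := eventually_curve w (notMem_tsupport_iff_eventuallyEq.1 h)
  have h2 : (fun r : ℝ => φ (p.1 + ((r * w.1 : ℝ) : AddCircle T), p.2 + r • w.2)) =ᶠ[𝓝 0]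
      fun _ => 0 := h1
  rw [dirDeriv, h2.deriv_eq, deriv_const]

theorem tsupport_dirDeriv_subset (w : ℝ × Eu m) (φ : Cyl T m → ℂ) :
    tsupport (dirDeriv w φ) ⊆ tsupport φ :=
  closure_minimal (support_dirDeriv_subset w φ) (isClosed_tsupport φ)

namespace IsTestFunction

variable {φ ψ : Cyl T m → ℂ}

theorem dirDeriv (hφ : IsTestFunction φ) (w : ℝ × Eu m) : IsTestFunction (dirDeriv w φ) where
  smooth := by
    have h : (fun p : ℝ × Eu m => CahnHilliardGurtin.dirDeriv w φ ((p.1 : AddCircle T), p.2)) =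
        fun p => fderiv ℝ (fun q : ℝ × Eu m => φ ((q.1 : AddCircle T), q.2)) p w := by
      ext p
      exact dirDeriv_coe hφ p
    rw [h]
    exact (hφ.smooth.fderiv_right (m := ((⊤ : ℕ∞) : WithTop ℕ∞)) (by simp)).clm_apply contDiff_const
  hasCompactSupport := hφ.hasCompactSupport.mono' (support_dirDeriv_subset w φ)

theorem add (hφ : IsTestFunction φ) (hψ : IsTestFunction ψ) : IsTestFunction (φ + ψ) where
  smooth := hφ.smooth.add hψ.smooth
  hasCompactSupport := hφ.hasCompactSupport.add hψ.hasCompactSupport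

theorem zero : IsTestFunction (0 : Cyl T m → ℂ) where
  smooth := contDiff_const
  hasCompactSupport := HasCompactSupport.zero

theorem sum {ι : Type*} (s : Finset ι) {φ : ι → Cyl T m → ℂ} (h : ∀ i ∈ s, IsTestFunction (φ i)) :
    IsTestFunction (∑ i ∈ s, φ i) :=
  Finset.sum_induction φ IsTestFunction (fun _ _ => add) zero h

theorem continuous (hφ : IsTestFunction φ) : Continuous φ := by
  have hq : IsOpenQuotientMap (fun p : ℝ × Eu m => (((p.1 : AddCircle T), p.2) : Cyl T m)) :=
    (QuotientAddGroup.isOpenQuotientMap_mk (N := AddSubgroup.zmultiples T)).prodMap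
      IsOpenQuotientMap.id
  exact hq.isQuotientMap.continuous_iff.2 hφ.smooth.continuous

theorem hasCompactSupport_slice (hφ : IsTestFunction φ) (t : AddCircle T) :
    HasCompactSupport fun x => φ (t, x) := by
  refine HasCompactSupport.intro (hφ.hasCompactSupport.image continuous_snd) fun x hx => ?_
  by_contra h
  exact hx ⟨(t, x), subset_tsupport φ h, rfl⟩

theorem contDiff_slice (hφ : IsTestFunction φ) (t : AddCircle T) :
    ContDiff ℝ (⊤ : ℕ∞) fun x => φ (t, x) := by
  induction t using QuotientAddGroup.induction_on with
  | H s => exact hφ.smooth.comp (contDiff_prodMk_right s)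

/-- The restriction of a test function to a time slice. -/
def slice (hφ : IsTestFunction φ) (t : AddCircle T) : 𝓢(Eu m, ℂ) :=
  (hφ.hasCompactSupport_slice t).toSchwartzMap (hφ.contDiff_slice t)

theorem slice_apply (hφ : IsTestFunction φ) (t : AddCircle T) (x : Eu m) :
    hφ.slice t x = φ (t, x) := rfl

theorem lineDeriv_slice (hφ : IsTestFunction φ) (t : AddCircle T) (v : Eu m) :
    (∂_{v} (hφ.slice t) : 𝓢(Eu m, ℂ)) = (hφ.dirDeriv (0, v)).slice t := by
  ext x
  rw [SchwartzMap.lineDerivOp_apply, slice_apply]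
  simp [CahnHilliardGurtin.dirDeriv, _root_.lineDeriv, slice_apply]

theorem spaceLaplacian_apply (hφ : IsTestFunction φ) (t : AddCircle T) (x : Eu m) :
    spaceLaplacian φ (t, x) = (Δ (hφ.slice t) : 𝓢(Eu m, ℂ)) x := by
  rw [SchwartzMap.laplacian_apply]
  rfl

theorem spaceLaplacian_eq_sum (hφ : IsTestFunction φ) : spaceLaplacian φ =
    ∑ i : Fin m, CahnHilliardGurtin.dirDeriv (0, EuclideanSpace.single i 1)
      (CahnHilliardGurtin.dirDeriv (0, EuclideanSpace.single i 1) φ) := by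
  ext ⟨t, x⟩
  rw [hφ.spaceLaplacian_apply, laplacian_eq_sum_single, _root_.sum_apply, Finset.sum_apply]
  refine Finset.sum_congr rfl fun i _ => ?_
  rw [lineDeriv_slice, lineDeriv_slice, slice_apply]

theorem timeDeriv (hφ : IsTestFunction φ) : IsTestFunction (timeDeriv φ) := by
  rw [timeDeriv_eq_dirDeriv]
  exact hφ.dirDeriv _

theorem spaceLaplacian (hφ : IsTestFunction φ) : IsTestFunction (spaceLaplacian φ) := by
  rw [hφ.spaceLaplacian_eq_sum]
  exact sum _ fun i _ => (hφ.dirDeriv _).dirDeriv _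

theorem normalDeriv {d : ℕ} {φ : Cyl T (d + 1) → ℂ} (hφ : IsTestFunction φ) :
    IsTestFunction (normalDeriv φ) := by
  rw [normalDeriv_eq_dirDeriv]
  exact hφ.dirDeriv _

theorem memLp [Fact (0 < T)] (hφ : IsTestFunction φ) : MemLp φ 2 volume :=
  hφ.continuous.memLp_of_hasCompactSupport hφ.hasCompactSupport

theorem boundary {d : ℕ} {φ : Cyl T (d + 1) → ℂ} (hφ : IsTestFunction φ) :
    IsTestFunction fun q : Cyl T d => φ (boundaryPoint q) where
  smooth := by
    have h : ContDiff ℝ (⊤ : ℕ∞) fun p : ℝ × Eu d => (p.1, glue d (p.2, 0)) :=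
      contDiff_fst.prodMk ((glue d).contDiff.comp (contDiff_snd.prodMk contDiff_const))
    exact hφ.smooth.comp h
  hasCompactSupport := by
    have h : Topology.IsClosedEmbedding fun q : Cyl T d => (boundaryPoint q : Cyl T (d + 1)) := by
      have h1 : Topology.IsClosedEmbedding fun x : Eu d => glue d (x, 0) :=
        (isometry_slice (d := d) 0).isClosedEmbedding
      exact Topology.IsClosedEmbedding.id.prodMap h1
    exact hφ.hasCompactSupport.comp_isClosedEmbedding h

end IsTestFunction

theorem contDiff_fourier_coe (k : ℤ) : ContDiff ℝ (⊤ : ℕ∞) fun s : ℝ =>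
    (fourier k (s : AddCircle T) : ℂ) := by
  simp only [fourier_coe_apply]
  exact ((contDiff_const.mul Complex.ofRealCLM.contDiff).div_const _).cexp

theorem isTestFunction_fourier_mul [Fact (0 < T)] (k : ℤ) {χ : 𝓢(Eu m, ℂ)}
    (hχ : HasCompactSupport χ) :
    IsTestFunction fun p : Cyl T m => (fourier k p.1 : ℂ) * χ p.2 where
  smooth := ((contDiff_fourier_coe k).comp contDiff_fst).mul (χ.smooth'.comp contDiff_snd)
  hasCompactSupport := by
    refine HasCompactSupport.intro (isCompact_univ.prod hχ) fun p hp => ?_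
    have : χ p.2 = 0 := image_eq_zero_of_notMem_tsupport fun h => hp ⟨Set.mem_univ _, h⟩
    rw [this, mul_zero]

theorem timeDeriv_fourier_mul (k : ℤ) (χ : 𝓢(Eu m, ℂ)) (p : Cyl T m) :
    timeDeriv (fun p : Cyl T m => (fourier k p.1 : ℂ) * χ p.2) p =
      (Complex.I * (2 * Real.pi * k / T : ℝ)) * (fourier k p.1 * χ p.2) := by
  have h1 : ∀ s : ℝ, (fourier k (p.1 + (s : AddCircle T)) : ℂ) * χ p.2 =
      fourier k p.1 * χ p.2 * Complex.exp (2 * Real.pi * Complex.I * k * s / T) := fun s => by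
    have : (fourier k (p.1 + (s : AddCircle T)) : ℂ) = fourier k p.1 * fourier k (s : AddCircle T) := by
      simp [fourier_apply, AddCircle.toCircle_add]
    rw [this, fourier_coe_apply]
    ring
  simp only [timeDeriv, h1]
  rw [deriv_const_mul_field]
  have h2 : HasDerivAt (fun s : ℝ => Complex.exp (2 * Real.pi * Complex.I * k * s / T))
      (2 * Real.pi * Complex.I * k / T) 0 := by
    have h3 : HasDerivAt (fun s : ℝ => 2 * Real.pi * Complex.I * k * (s : ℂ) / T)
        (2 * Real.pi * Complex.I * k / T) 0 := by
      simpa using ((Complex.ofRealCLM.hasDerivAt (x := 0)).const_mul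
        (2 * Real.pi * Complex.I * (k : ℂ))).div_const (T : ℂ)
    simpa using h3.cexp
  rw [h2.deriv]
  push_cast
  ring

namespace IsTestFunction

variable {φ : Cyl T m → ℂ}

theorem contDiff_fourier_smul (hφ : IsTestFunction φ) (k : ℤ) : ContDiff ℝ (⊤ : ℕ∞)
    fun p : ℝ × Eu m => (fourier (-k) (p.1 : AddCircle T) : ℂ) • φ ((p.1 : AddCircle T), p.2) :=
  ((contDiff_fourier_coe (-k)).comp contDiff_fst).smul hφ.smooth

variable [Fact (0 < T)]

theorem fourierCoeff_eq (φ : Cyl T m → ℂ) (k : ℤ) (x : Eu m) :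
    fourierCoeff (fun t : AddCircle T => φ (t, x)) k =
      (1 / T) • ∫ s in (0 : ℝ)..T, (fourier (-k) (s : AddCircle T) : ℂ) • φ ((s : AddCircle T), x) := by
  rw [fourierCoeff_eq_intervalIntegral _ _ 0, zero_add]

/-- A Fourier coefficient in time of a test function. -/
def coeff (hφ : IsTestFunction φ) (k : ℤ) : 𝓢(Eu m, ℂ) :=
  HasCompactSupport.toSchwartzMap
    (f := fun x => fourierCoeff (fun t : AddCircle T => φ (t, x)) k)
    (HasCompactSupport.intro (hφ.hasCompactSupport.image continuous_snd) fun x hx => by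
      have : ∀ t : AddCircle T, φ (t, x) = 0 := fun t => by
        by_contra h
        exact hx ⟨(t, x), subset_tsupport φ h, rfl⟩
      simp [fourierCoeff, this])
    (by
      simp only [fourierCoeff_eq]
      exact ContDiff.const_smul (1 / T : ℝ)
        (contDiff_infty.2 fun n => contDiff_intervalIntegral n (hφ.contDiff_fourier_smul k) 0 T))

theorem coeff_apply (hφ : IsTestFunction φ) (k : ℤ) (x : Eu m) :
    hφ.coeff k x = fourierCoeff (fun t : AddCircle T => φ (t, x)) k := rfl

/-- Space derivatives commute with taking Fourier coefficients in time. -/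
theorem lineDeriv_coeff (hφ : IsTestFunction φ) (k : ℤ) (v : Eu m) :
    (∂_{v} (hφ.coeff k) : 𝓢(Eu m, ℂ)) = (hφ.dirDeriv (0, v)).coeff k := by
  ext x
  have hs := (hφ.contDiff_fourier_smul k).of_le (m := 1) (by simp)
  have h1 := (hasFDerivAt_intervalIntegral_of_contDiff hs 0 T x).const_smul (1 / T)
  have h3 : HasFDerivAt (hφ.coeff k : Eu m → ℂ) _ x :=
    h1.congr_of_eventuallyEq (Eventually.of_forall fun y => fourierCoeff_eq φ k y)
  rw [SchwartzMap.lineDerivOp_apply, h3.hasLineDerivAt v |>.lineDeriv, coeff_apply, fourierCoeff_eq,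
    _root_.smul_apply]
  congr 1
  rw [ContinuousLinearMap.intervalIntegral_apply]
  · refine intervalIntegral.integral_congr fun s _ => ?_
    simp only [ContinuousLinearMap.comp_apply, ContinuousLinearMap.inr_apply]
    rw [dirDeriv_coe hφ (s, x)]
    have h4 : HasFDerivAt (fun p : ℝ × Eu m => (fourier (-k) (p.1 : AddCircle T) : ℂ) •
        φ ((p.1 : AddCircle T), p.2)) _ (s, x) :=
      (((contDiff_fourier_coe (T := T) (-k)).comp contDiff_fst).differentiable (by simp)
        (s, x)).hasFDerivAt.smul (hφ.smooth.differentiable (by simp) (s, x)).hasFDerivAt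
    rw [h4.fderiv]
    have h5 : fderiv ℝ (fun p : ℝ × Eu m => (fourier (-k) (p.1 : AddCircle T) : ℂ)) (s, x) (0, v) =
        0 := by
      have h6 := ((contDiff_fourier_coe (T := T) (-k)).differentiable (by simp) s).hasFDerivAt.comp
        (s, x) (hasFDerivAt_fst (𝕜 := ℝ) (E := ℝ) (F := Eu m) (p := (s, x)))
      have h7 := h6.fderiv
      change fderiv ℝ ((fun s : ℝ => (fourier (-k) (s : AddCircle T) : ℂ)) ∘ Prod.fst) (s, x) (0, v)
        = 0
      rw [h7]
      simp
    simp only [_root_.add_apply, _root_.smul_apply, ContinuousLinearMap.smulRight_apply]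
    change _ + (fderiv ℝ (fun p : ℝ × Eu m => (fourier (-k) (p.1 : AddCircle T) : ℂ)) (s, x) (0, v)) •
      _ = _
    rw [h5, zero_smul, add_zero]
    rfl
  · refine Continuous.intervalIntegrable ?_ _ _
    exact ((hs.continuous_fderiv (by norm_num)).comp (by fun_prop)).clm_comp continuous_const

theorem timeCoeff_toLp (hφ : IsTestFunction φ) (k : ℤ) :
    timeCoeff k (hφ.memLp.toLp φ) = toL2 (hφ.coeff k) := by
  refine Lp.ext ?_
  filter_upwards [coeFn_timeCoeff k (hφ.memLp.toLp φ), ae_slice hφ.memLp.coeFn_toLp,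
    coeFn_toL2 (hφ.coeff k)] with x h1 h2 h3
  rw [h1, h3, coeff_apply]
  exact congrFun (fourierCoeff_congr_ae h2) k

end IsTestFunction

end CylinderTestFunctions

/-! ### Norms in terms of Fourier coefficients in time -/

section NormsByModes

variable {T : ℝ} [Fact (0 < T)] {m d : ℕ}

/-- The angular frequency of the `k`-th mode. -/
def freq (T : ℝ) (k : ℤ) : ℝ := 2 * Real.pi * k / T

theorem le_abs_freq {k : ℤ} (hk : k ≠ 0) : 2 * Real.pi / T ≤ |freq T k| := by
  have hT : (0 : ℝ) < T := Fact.out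
  have h1 : (1 : ℝ) ≤ |(k : ℝ)| := by exact_mod_cast Int.one_le_abs hk
  rw [freq, abs_div, abs_mul, abs_of_pos hT, abs_of_pos Real.two_pi_pos]
  rw [div_le_div_iff_of_pos_right hT]
  nlinarith [Real.two_pi_pos]

/-- The norms of `H^{(s,r)}` are weighted sums of the norms of `Hʳ` of the Fourier coefficients. -/
theorem sobolevNormSq_eq (s r : ℝ) (f : L2 T m) : sobolevNormSq s r f =
    ENNReal.ofReal T * ∑' k : ℤ, ENNReal.ofReal ((1 + freq T k ^ 2) ^ s) *
      sobSq r (timeCoeff k f) := by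
  unfold sobolevNormSq sobSq
  congr 1
  refine tsum_congr fun k => ?_
  rw [← lintegral_const_mul' _ _ ENNReal.ofReal_ne_top]
  refine lintegral_congr fun ξ => ?_
  have h1 : (0 : ℝ) < 1 + freq T k ^ 2 := by positivity
  have h2 : weight s r (2 * Real.pi * k / T) ((2 * Real.pi) • ξ) ^ 2 =
      (1 + freq T k ^ 2) ^ s * jap ξ ^ r := by
    change ((1 + freq T k ^ 2) ^ (s / 2) * jap ξ ^ (r / 2)) ^ 2 = _
    rw [mul_pow, ← Real.rpow_mul_natCast h1.le, ← Real.rpow_mul_natCast (jap_pos ξ).le]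
    norm_num
  rw [mul_pow, ← ENNReal.ofReal_pow (by unfold weight; positivity), h2,
    ENNReal.ofReal_mul (by positivity), mul_assoc]

theorem sobolevNorm_sq (s r : ℝ) (f : L2 T m) : sobolevNorm s r f ^ 2 = sobolevNormSq s r f := by
  rw [sobolevNorm, ← ENNReal.rpow_mul_natCast]
  norm_num

theorem mem_sobolevPerp_iff {s r : ℝ} {f : L2 T m} :
    f ∈ sobolevPerp T m s r ↔ timeCoeff 0 f = 0 ∧ sobolevNormSq s r f < ⊤ := by
  rw [← sobolevNorm_lt_top_iff]
  rfl

theorem mode_le_sobolevNormSq (s r : ℝ) (f : L2 T m) (k : ℤ) :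
    ENNReal.ofReal T * (ENNReal.ofReal ((1 + freq T k ^ 2) ^ s) * sobSq r (timeCoeff k f)) ≤
      sobolevNormSq s r f := by
  rw [sobolevNormSq_eq]
  gcongr
  exact ENNReal.le_tsum (f := fun k => ENNReal.ofReal ((1 + freq T k ^ 2) ^ s) *
    sobSq r (timeCoeff k f)) k

theorem sobSq_timeCoeff_lt_top {s r : ℝ} {f : L2 T m} (hf : sobolevNormSq s r f < ⊤) (k : ℤ) :
    sobSq r (timeCoeff k f) < ⊤ := by
  have hT : (0 : ℝ) < T := Fact.out
  have h := (mode_le_sobolevNormSq s r f k).trans_lt hf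
  have hp : (0 : ℝ) < (1 + freq T k ^ 2) ^ s := Real.rpow_pos_of_pos (by positivity) s
  by_contra h0
  rw [not_lt, top_le_iff] at h0
  rw [h0, ENNReal.mul_top (by simpa using hp), ENNReal.mul_top (by simpa using hT)] at h
  exact h.ne rfl

end NormsByModes

/-! ### Restriction in terms of Fourier coefficients in time -/

section RestrictionByModes

variable {T : ℝ} {d : ℕ}

theorem upperHalf_eq : upperHalf T d = Set.univ ×ˢ halfE d := by
  ext p
  simp [upperHalf, halfE]

theorem measurableSet_upperHalf : MeasurableSet (upperHalf T d) := by
  rw [upperHalf_eq]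
  exact MeasurableSet.univ.prod measurableSet_halfE

variable [Fact (0 < T)]

theorem coeFn_restrictHalf (F : L2 T (d + 1)) :
    restrictHalf T d F =ᵐ[volume.restrict (upperHalf T d)] F :=
  LpToLpRestrictCLM_coeFn ℂ (upperHalf T d) F

/-- Restriction to the half space commutes with the Fourier series in time. -/
theorem restrictHalf_eq_zero_iff {F : L2 T (d + 1)} :
    restrictHalf T d F = 0 ↔ ∀ k, resHalf d (timeCoeff k F) = 0 := by
  have hm := (Lp.memLp F).indicator (measurableSet_upperHalf (T := T) (d := d))
  -- the cut-off of `F`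
  let G : L2 T (d + 1) := hm.toLp _
  have hG : ∀ k, ∀ᵐ x, timeCoeff k G x = (halfE d).indicator (timeCoeff k F) x := fun k => by
    filter_upwards [coeFn_timeCoeff k G, coeFn_timeCoeff k F, ae_slice hm.coeFn_toLp]
      with x h1 h2 h3
    rw [h1, fourierCoeff_congr_ae h3]
    by_cases hx : x ∈ halfE d
    · have : ∀ t : AddCircle T, (t, x) ∈ upperHalf T d := fun t => hx
      simp only [Set.indicator_of_mem (this _), Set.indicator_of_mem hx]
      rw [h2]
    · have : ∀ t : AddCircle T, (t, x) ∉ upperHalf T d := fun t => hx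
      simp only [Set.indicator_of_notMem (this _), Set.indicator_of_notMem hx]
      simp [fourierCoeff]
  have h1 : restrictHalf T d F = 0 ↔ G = 0 := by
    rw [Lp.eq_zero_iff_ae_eq_zero, Lp.eq_zero_iff_ae_eq_zero]
    have e1 : (restrictHalf T d F =ᵐ[volume.restrict (upperHalf T d)] 0) ↔
        ∀ᵐ p, p ∈ upperHalf T d → F p = 0 := by
      rw [← ae_restrict_iff' measurableSet_upperHalf]
      constructor
      · intro h
        filter_upwards [h, coeFn_restrictHalf F] with p h2 h3
        rw [← h3, h2]
        rfl
      · intro h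
        filter_upwards [h, coeFn_restrictHalf F] with p h2 h3
        rw [h3, h2]
        rfl
    rw [e1]
    constructor
    · intro h
      filter_upwards [h, hm.coeFn_toLp] with p h2 h3
      rw [h3]
      by_cases hp : p ∈ upperHalf T d
      · rw [Set.indicator_of_mem hp, h2 hp]
        rfl
      · rw [Set.indicator_of_notMem hp]
        rfl
    · intro h
      filter_upwards [h, hm.coeFn_toLp] with p h2 h3 hp
      rw [h3, Set.indicator_of_mem hp] at h2
      exact h2
  have h2 : ∀ k, resHalf d (timeCoeff k F) = 0 ↔ timeCoeff k G = 0 := fun k => by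
    rw [← map_zero (resHalf d), resHalf_eq_iff, Lp.eq_zero_iff_ae_eq_zero]
    constructor
    · intro h
      filter_upwards [h, hG k, Lp.coeFn_zero ℂ 2 (volume : Measure (Eu (d + 1)))] with x a1 a2 a3
      rw [a2]
      by_cases hx : x ∈ halfE d
      · rw [Set.indicator_of_mem hx, a1 hx, a3]
      · rw [Set.indicator_of_notMem hx]
        rfl
    · intro h
      filter_upwards [h, hG k, Lp.coeFn_zero ℂ 2 (volume : Measure (Eu (d + 1)))] with x a1 a2 a3 hx
      rw [a2, Set.indicator_of_mem hx] at a1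
      rw [a1, a3]
  rw [h1]
  simp only [h2]
  exact ⟨fun h k => by rw [h, map_zero], fun h => timeCoeff_injective fun k => by
    rw [h k, map_zero]⟩

theorem restrictHalf_eq_iff {F G : L2 T (d + 1)} : restrictHalf T d F = restrictHalf T d G ↔
    ∀ k, resHalf d (timeCoeff k F) = resHalf d (timeCoeff k G) := by
  rw [← sub_eq_zero, ← map_sub, restrictHalf_eq_zero_iff]
  simp only [map_sub, sub_eq_zero]

end RestrictionByModes

/-! ### Distributional equations in terms of Fourier coefficients in time -/

section WeakFormulation

variable {T : ℝ} [Fact (0 < T)] {m d : ℕ}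

theorem IsTestFunction.integrable_mul {φ : Cyl T m → ℂ} (hφ : IsTestFunction φ) (F : L2 T m) :
    Integrable fun p => F p * φ p :=
  (Lp.memLp F).integrable_mul hφ.memLp

/-- Parseval's identity for the pairing with a test function. -/
theorem hasSum_integral_mode_mul (F : L2 T m) {φ : Cyl T m → ℂ} (hφ : IsTestFunction φ) :
    HasSum (fun k => ∫ p, mode k (timeCoeff k F) p * φ p) (∫ p, F p * φ p) := by
  have hc : MemLp (fun p => (starRingEnd ℂ) (φ p)) 2 volume := hφ.memLp.star
  have h1 : ∀ G : L2 T m, inner ℂ (hc.toLp _) G = ∫ p, G p * φ p := fun G => by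
    rw [L2.inner_def]
    refine integral_congr_ae ?_
    filter_upwards [hc.coeFn_toLp] with p hp
    rw [hp, RCLike.inner_apply, RingHomCompTriple.comp_apply, RingHom.id_apply]
  have h2 := (hasSum_mode_timeCoeff F).mapL (innerSL ℂ (hc.toLp _))
  simpa only [innerSL_apply_apply, h1] using h2

theorem integral_mode_mul (k : ℤ) (a : SpaceL2 m) {φ : Cyl T m → ℂ} (hφ : IsTestFunction φ) :
    ∫ p, mode k a p * φ p = T * ∫ x, hφ.coeff (-k) x * a x := by
  have h1 : ∫ p, mode k a p * φ p = ∫ p : Cyl T m, fourier k p.1 * a p.2 * φ p := by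
    refine integral_congr_ae ?_
    filter_upwards [coeFn_mode k a] with p hp
    rw [hp]
  have hi : Integrable fun p : Cyl T m => fourier k p.1 * a p.2 * φ p :=
    (memLp_mode k a).integrable_mul hφ.memLp
  rw [h1, integral_cyl hi]
  congr 1
  refine integral_congr_ae (ae_of_all _ fun x => ?_)
  simp only [hφ.coeff_apply, fourierCoeff, neg_neg, smul_eq_mul]
  rw [← integral_mul_const]
  refine integral_congr_ae (ae_of_all _ fun t => ?_)
  ring

theorem integral_mul_fourier_mul (k : ℤ) (F : L2 T m) {χ : 𝓢(Eu m, ℂ)} (hχ : HasCompactSupport χ) :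
    ∫ p, F p * (fourier (-k) p.1 * χ p.2) = T * ∫ x, χ x * timeCoeff k F x := by
  rw [integral_cyl ((isTestFunction_fourier_mul (-k) hχ).integrable_mul F)]
  congr 1
  refine integral_congr_ae ?_
  filter_upwards [coeFn_timeCoeff k F] with x hx
  rw [hx, fourierCoeff, ← integral_const_mul]
  refine integral_congr_ae (ae_of_all _ fun t => ?_)
  simp only [smul_eq_mul]
  ring

theorem IsTestFunction.coeff_timeDeriv {φ : Cyl T m → ℂ} (hφ : IsTestFunction φ) (k : ℤ) (x : Eu m) :
    hφ.timeDeriv.coeff k x = Complex.I * freq T k * hφ.coeff k x := by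
  have hlift : ∀ {ψ : Cyl T m → ℂ}, IsTestFunction ψ →
      Continuous fun s : ℝ => (fourier (-k) (s : AddCircle T) : ℂ) * ψ ((s : AddCircle T), x) :=
    fun hψ => (contDiff_fourier_coe (-k)).continuous.mul
      (hψ.smooth.continuous.comp (by fun_prop : Continuous fun s : ℝ => (s, x)))
  -- integrate the derivative of `fourier (-k) * φ` over one period
  have hd : ∀ s : ℝ, HasDerivAt
      (fun s : ℝ => (fourier (-k) (s : AddCircle T) : ℂ) * φ ((s : AddCircle T), x))
      (-(Complex.I * freq T k) * (fourier (-k) (s : AddCircle T) * φ ((s : AddCircle T), x)) +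
        fourier (-k) (s : AddCircle T) * CahnHilliardGurtin.timeDeriv φ ((s : AddCircle T), x)) s := by
    intro s
    have h1 := hasDerivAt_fourier T (-k) s
    have h2 := (hφ.smooth.differentiable (by simp) (s, x)).hasFDerivAt.comp_hasDerivAt s
      ((hasDerivAt_id s).prodMk (hasDerivAt_const s x))
    rw [← dirDeriv_coe hφ (s, x), ← timeDeriv_eq_dirDeriv] at h2
    have h3 : HasDerivAt
      (fun s : ℝ => (fourier (-k) (s : AddCircle T) : ℂ) * φ ((s : AddCircle T), x)) _ s := h1.mul h2
    refine h3.congr_deriv ?_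
    simp only [freq]
    push_cast
    ring
  have i1 : IntervalIntegrable (fun s : ℝ => -(Complex.I * freq T k) *
      ((fourier (-k) (s : AddCircle T) : ℂ) * φ ((s : AddCircle T), x))) volume 0 T :=
    (continuous_const.mul (hlift hφ)).intervalIntegrable _ _
  have i2 := (hlift hφ.timeDeriv).intervalIntegrable (μ := volume) 0 T
  have h0 := intervalIntegral.integral_eq_sub_of_hasDerivAt (a := 0) (b := T) (fun s _ => hd s)
    (i1.add i2)
  rw [intervalIntegral.integral_add i1 i2, intervalIntegral.integral_const_mul,
    AddCircle.coe_period, AddCircle.coe_zero, sub_self] at h0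
  rw [coeff_apply, coeff_apply, fourierCoeff_eq, fourierCoeff_eq]
  simp only [smul_eq_mul, Complex.real_smul]
  linear_combination ((1 / T : ℝ) : ℂ) * h0

theorem IsTestFunction.coeff_spaceLaplacian {φ : Cyl T m → ℂ} (hφ : IsTestFunction φ) (k : ℤ) :
    hφ.spaceLaplacian.coeff k = Δ (hφ.coeff k) := by
  ext x
  rw [laplacian_eq_sum_single, _root_.sum_apply, coeff_apply]
  simp only [lineDeriv_coeff, coeff_apply, hφ.spaceLaplacian_eq_sum, Finset.sum_apply, fourierCoeff,
    Finset.smul_sum]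
  refine integral_finsetSum _ fun i _ => ?_
  have hc : Continuous fun t : AddCircle T => (fourier (-k) t : ℂ) •
      CahnHilliardGurtin.dirDeriv (0, EuclideanSpace.single i 1)
        (CahnHilliardGurtin.dirDeriv (0, EuclideanSpace.single i 1) φ) (t, x) :=
    (fourier (-k)).continuous.smul (((hφ.dirDeriv _).dirDeriv _).continuous.comp (by fun_prop))
  exact hc.integrable_of_hasCompactSupport (HasCompactSupport.of_compactSpace _)

theorem IsHalfTestFunction.tsupport_coeff_subset {φ : Cyl T (d + 1) → ℂ}
    (hφ : IsHalfTestFunction φ) (k : ℤ) : tsupport (hφ.toIsTestFunction.coeff k) ⊆ halfE d := by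
  have hc := hφ.hasCompactSupport.image (continuous_snd (X := AddCircle T) (Y := Eu (d + 1)))
  refine (closure_minimal (fun x hx => ?_) hc.isClosed).trans ?_
  · by_contra h
    have h0 : ∀ t : AddCircle T, φ (t, x) = 0 := fun t => by
      by_contra h1
      exact h ⟨(t, x), subset_tsupport φ h1, rfl⟩
    refine hx ?_
    rw [hφ.toIsTestFunction.coeff_apply]
    simp [fourierCoeff, h0]
  · rintro x ⟨p, hp, rfl⟩
    exact hφ.tsupport_subset hp

theorem integral_add_three {α : Type*} [MeasurableSpace α] {μ : Measure α} {f g h : α → ℂ}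
    (hf : Integrable f μ) (hg : Integrable g μ) (hh : Integrable h μ) :
    ∫ x, (f x + g x + h x) ∂μ = (∫ x, f x ∂μ) + (∫ x, g x ∂μ) + ∫ x, h x ∂μ := by
  rw [← integral_add hf hg]
  exact integral_add (hf.add hg) hh

theorem IsHalfTestFunction.setIntegral_eq {φ : Cyl T (d + 1) → ℂ} (hφ : IsHalfTestFunction φ)
    (A B C : L2 T (d + 1)) : ∫ p in upperHalf T d,
      (A p * timeDeriv φ p + B p * spaceLaplacian φ p + C p * φ p) =
      (∫ p, A p * timeDeriv φ p) + (∫ p, B p * spaceLaplacian φ p) + ∫ p, C p * φ p := by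
  have ht := hφ.toIsTestFunction
  rw [← integral_add_three (ht.timeDeriv.integrable_mul A) (ht.spaceLaplacian.integrable_mul B)
    (ht.integrable_mul C)]
  refine setIntegral_eq_integral_of_forall_compl_eq_zero fun p hp => ?_
  have hp' : p ∉ tsupport φ := fun h => hp (hφ.tsupport_subset h)
  have e1 : φ p = 0 := image_eq_zero_of_notMem_tsupport hp'
  have e2 : timeDeriv φ p = 0 := by
    rw [timeDeriv_eq_dirDeriv]
    exact image_eq_zero_of_notMem_tsupport fun h => hp' (tsupport_dirDeriv_subset _ _ h)
  have e3 : spaceLaplacian φ p = 0 := by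
    rw [ht.spaceLaplacian_eq_sum, Finset.sum_apply]
    refine Finset.sum_eq_zero fun i _ => ?_
    exact image_eq_zero_of_notMem_tsupport fun h => hp'
      (tsupport_dirDeriv_subset _ _ (tsupport_dirDeriv_subset _ _ h))
  rw [e1, e2, e3]
  simp

theorem integral_combination (z : ℂ) (a b c : SpaceL2 m) (χ : 𝓢(Eu m, ℂ)) :
    -z * (∫ x, χ x * a x) + (∫ x, χ x * b x) + ∫ x, χ x * c x =
      ∫ x, χ x * (b - z • a + c : SpaceL2 m) x := by
  rw [← integral_const_mul, ← integral_add_three ((integrable_schwartz_mul χ a).const_mul (-z))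
    (integrable_schwartz_mul χ b) (integrable_schwartz_mul χ c)]
  refine integral_congr_ae ?_
  filter_upwards [Lp.coeFn_add (b - z • a) c, Lp.coeFn_sub b (z • a), Lp.coeFn_smul z a]
    with x h1 h2 h3
  rw [h1, Pi.add_apply, h2, Pi.sub_apply, h3, Pi.smul_apply, smul_eq_mul]
  ring

theorem integral_mul_timeDeriv_fourier (k : ℤ) (A : L2 T m) {χ : 𝓢(Eu m, ℂ)}
    (hχ : HasCompactSupport χ) :
    ∫ p, A p * timeDeriv (fun p : Cyl T m => (fourier (-k) p.1 : ℂ) * χ p.2) p =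
      -(Complex.I * freq T k) * (T * ∫ x, χ x * timeCoeff k A x) := by
  rw [← integral_mul_fourier_mul k A hχ, ← integral_const_mul]
  refine integral_congr_ae (ae_of_all _ fun p => ?_)
  simp only [timeDeriv_fourier_mul, freq]
  push_cast
  ring

theorem integral_mul_spaceLaplacian_fourier (k : ℤ) (B : L2 T m) {χ : 𝓢(Eu m, ℂ)}
    (hχ : HasCompactSupport χ) :
    ∫ p, B p * spaceLaplacian (fun p : Cyl T m => (fourier (-k) p.1 : ℂ) * χ p.2) p =
      T * ∫ x, (Δ χ : 𝓢(Eu m, ℂ)) x * timeCoeff k B x := by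
  have hΔ : HasCompactSupport (Δ χ : 𝓢(Eu m, ℂ)) :=
    hχ.mono' ((subset_tsupport _).trans (tsupport_laplacian_subset χ))
  rw [← integral_mul_fourier_mul k B hΔ]
  refine integral_congr_ae (ae_of_all _ fun p => ?_)
  obtain ⟨t, x⟩ := p
  have ht := isTestFunction_fourier_mul (T := T) (-k) hχ
  have h1 : ht.slice t = (fourier (-k) t : ℂ) • χ := by
    ext x
    rfl
  have h2 : (Δ ((fourier (-k) t : ℂ) • χ) : 𝓢(Eu m, ℂ)) = (fourier (-k) t : ℂ) • Δ χ := by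
    simp only [← SchwartzMap.laplacianCLM_eq (𝕜 := ℂ)]
    exact map_smul _ _ _
  simp only [ht.spaceLaplacian_apply, h1, h2, _root_.smul_apply, smul_eq_mul]

/-- A distributional equation `-∂ₜ A + Δ B + C = 0` on the half space holds for each Fourier
coefficient in time: test it with products of an exponential and a function of `x`. -/
theorem modes_of_weak {A B C : L2 T (d + 1)}
    (h : ∀ φ : Cyl T (d + 1) → ℂ, IsHalfTestFunction φ → ∫ p in upperHalf T d,
      (A p * timeDeriv φ p + B p * spaceLaplacian φ p + C p * φ p) = 0)
    (k : ℤ) {L : SpaceL2 (d + 1)} (hL : IsMul lapSymbol (timeCoeff k B) L) :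
    resHalf d (L - (Complex.I * freq T k) • timeCoeff k A + timeCoeff k C) = 0 := by
  have hT : (T : ℂ) ≠ 0 := by
    have : (0 : ℝ) < T := Fact.out
    exact_mod_cast this.ne'
  refine resHalf_eq_zero_of_integral fun χ hχ hχs => ?_
  have ht := isTestFunction_fourier_mul (T := T) (-k) hχ
  have hφ : IsHalfTestFunction fun p : Cyl T (d + 1) => (fourier (-k) p.1 : ℂ) * χ p.2 :=
    { ht with
      tsupport_subset := by
        rw [upperHalf_eq]
        refine Set.Subset.trans ?_ (Set.prod_mono_right hχs)
        refine closure_minimal (fun p hp => ⟨Set.mem_univ _, subset_tsupport _ fun h0 => hp ?_⟩)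
          (isClosed_univ.prod (isClosed_tsupport _))
        simp [h0] }
  have h1 := h _ hφ
  rw [hφ.setIntegral_eq, integral_mul_timeDeriv_fourier k A hχ,
    integral_mul_spaceLaplacian_fourier k B hχ, integral_mul_fourier_mul k C hχ,
    ← isMul_lapSymbol_iff.1 hL χ] at h1
  rw [← integral_combination]
  refine mul_left_cancel₀ hT ?_
  rw [mul_zero, ← h1]
  ring

/-- Conversely, if the equation holds for each Fourier coefficient, expand both factors of the
pairing into Fourier series. -/
theorem weak_of_modes {A B C : L2 T (d + 1)} (hB : ∀ k, sobSq 2 (timeCoeff k B) < ⊤)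
    (h : ∀ k L, IsMul lapSymbol (timeCoeff k B) L →
      resHalf d (L - (Complex.I * freq T k) • timeCoeff k A + timeCoeff k C) = 0)
    {φ : Cyl T (d + 1) → ℂ} (hφ : IsHalfTestFunction φ) : ∫ p in upperHalf T d,
      (A p * timeDeriv φ p + B p * spaceLaplacian φ p + C p * φ p) = 0 := by
  have ht := hφ.toIsTestFunction
  rw [hφ.setIntegral_eq]
  refine (((hasSum_integral_mode_mul A ht.timeDeriv).add
    (hasSum_integral_mode_mul B ht.spaceLaplacian)).add
    (hasSum_integral_mode_mul C ht)).unique ?_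
  refine hasSum_zero.congr_fun fun k => ?_
  obtain ⟨L, hL⟩ := exists_lap (hB k)
  have e1 : ∫ x, ht.timeDeriv.coeff (-k) x * timeCoeff k A x =
      -(Complex.I * freq T k) * ∫ x, ht.coeff (-k) x * timeCoeff k A x := by
    rw [← integral_const_mul]
    refine integral_congr_ae (ae_of_all _ fun x => ?_)
    simp only [ht.coeff_timeDeriv, freq]
    push_cast
    ring
  rw [integral_mode_mul k _ ht.timeDeriv, integral_mode_mul k _ ht.spaceLaplacian,
    integral_mode_mul k _ ht, ht.coeff_spaceLaplacian, ← isMul_lapSymbol_iff.1 hL, e1, ← mul_add,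
    ← mul_add, integral_combination,
    integral_mul_eq_zero_of_resHalf_eq_zero (h k L hL) (hφ.tsupport_coeff_subset (-k)), mul_zero]

end WeakFormulation

/-! ### Neumann traces in terms of Fourier coefficients in time -/

section NeumannTraceByModes

variable {T : ℝ} [Fact (0 < T)] {m d : ℕ}

theorem enorm_trace_normalDeriv_sq_le {a q : SpaceL2 (d + 1)} {h : SpaceL2 d}
    (hq : IsMul (derivSymbol (normal d)) a q) (hh : IsTrace q h) : ‖h‖ₑ ^ 2 ≤ sobSq 2 a := by
  have h1 := hh.sobSq_le (r := 1) le_rfl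
  have h2 := sobSq_normalDeriv_le hq 1
  norm_num at h1 h2
  exact (enorm_sq_le_sobSq (by norm_num) h).trans (h1.trans h2)

theorem coeFn_sum_mode (S : Finset ℤ) (χ : ℤ → 𝓢(Eu m, ℂ)) :
    (∑ k ∈ S, mode k (toL2 (χ k)) : L2 T m) =ᵐ[volume]
      fun p => ∑ k ∈ S, (fourier k p.1 : ℂ) * χ k p.2 := by
  induction S using Finset.induction_on with
  | empty =>
    filter_upwards [Lp.coeFn_zero ℂ 2 (volume : Measure (Cyl T m))] with p hp
    simp
  | insert k S hk ih =>
    rw [Finset.sum_insert hk]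
    have h1 := (Measure.quasiMeasurePreserving_snd (μ := (volume : Measure (AddCircle T)))
      (ν := (volume : Measure (Eu m)))).ae (coeFn_toL2 (χ k))
    filter_upwards [ih, Lp.coeFn_add (mode k (toL2 (χ k)) : L2 T m) (∑ k ∈ S, mode k (toL2 (χ k))),
      coeFn_mode (T := T) k (toL2 (χ k)), h1] with p h2 h3 h4 h5
    rw [h3, Pi.add_apply, h2, h4, h5, Finset.sum_insert hk]

theorem timeCoeff_sum_mode (S : Finset ℤ) (h : ℤ → SpaceL2 m) (j : ℤ) :
    timeCoeff j (∑ k ∈ S, mode k (h k) : L2 T m) = if j ∈ S then h j else 0 := by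
  simp only [map_sum, timeCoeff_mode]
  exact Finset.sum_ite_eq S j h

theorem isTestFunction_sum_fourier_mul (S : Finset ℤ) {χ : ℤ → 𝓢(Eu m, ℂ)}
    (hχ : ∀ k, HasCompactSupport (χ k)) :
    IsTestFunction fun p : Cyl T m => ∑ k ∈ S, (fourier k p.1 : ℂ) * χ k p.2 := by
  have := IsTestFunction.sum S (φ := fun k (p : Cyl T m) => (fourier k p.1 : ℂ) * χ k p.2)
    fun k _ => isTestFunction_fourier_mul k (hχ k)
  convert this using 1
  ext p
  rw [Finset.sum_apply]

theorem normalDeriv_sum_fourier_mul (S : Finset ℤ) {χ : ℤ → 𝓢(Eu (d + 1), ℂ)}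
    (hχ : ∀ k, HasCompactSupport (χ k)) (q : Cyl T d) :
    normalDeriv (fun p : Cyl T (d + 1) => ∑ k ∈ S, (fourier k p.1 : ℂ) * χ k p.2)
      (boundaryPoint q) =
      ∑ k ∈ S, (fourier k q.1 : ℂ) * slice 0 (∂_{normal d} (χ k)) q.2 := by
  have ht := isTestFunction_sum_fourier_mul (T := T) S hχ
  have h1 : ht.slice q.1 = ∑ k ∈ S, (fourier k q.1 : ℂ) • χ k := by
    ext x
    rw [ht.slice_apply, _root_.sum_apply]
    rfl
  have h2 := (ht.dirDeriv (0, normal d)).slice_apply q.1 (glue d (q.2, 0))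
  rw [← ht.lineDeriv_slice, h1, ← normalDeriv_eq_dirDeriv] at h2
  change normalDeriv _ (q.1, glue d (q.2, 0)) = _
  rw [← h2, LineDeriv.lineDerivOp_sum, _root_.sum_apply]
  refine Finset.sum_congr rfl fun k _ => ?_
  rw [LineDeriv.lineDerivOp_smul]
  rfl

theorem sobolevNormSq_zero_left (r : ℝ) (f : L2 T m) :
    sobolevNormSq 0 r f = ENNReal.ofReal T * ∑' k : ℤ, sobSq r (timeCoeff k f) := by
  simp [sobolevNormSq_eq]

/-- Finite sums of products of exponentials in time and test functions in space are dense in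
`H^{(0,2)}_⊥`, and the Neumann traces converge along. -/
theorem exists_testFunction_approx_neumann {F : L2 T (d + 1)} (hF : F ∈ sobolevPerp T (d + 1) 0 2)
    {g : L2 T d} (h : ∀ k q, IsMul (derivSymbol (normal d)) (timeCoeff k F) q →
      IsTrace q (timeCoeff k g)) {ε : ℝ≥0∞} (hε : ε ≠ 0) :
    ∃ (φ : Cyl T (d + 1) → ℂ) (Φ : L2 T (d + 1)), IsTestFunction φ ∧ Φ =ᵐ[volume] φ ∧
      F - Φ ∈ sobolevPerp T (d + 1) 0 2 ∧ sobolevNormSq 0 2 (F - Φ) ≤ ENNReal.ofReal T * ε ∧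
      eLpNorm (fun q => g q - normalDeriv φ (boundaryPoint q)) 2 volume ^ 2 ≤
        ENNReal.ofReal T * ε := by
  have hT : (0 : ℝ) < T := Fact.out
  wlog hεt : ε < ⊤ generalizing ε
  · obtain ⟨φ, Φ, h1, h2, h3, h4, h5⟩ := this one_ne_zero ENNReal.one_lt_top
    have : (1 : ℝ≥0∞) ≤ ε := by
      rw [not_lt, top_le_iff] at hεt
      rw [hεt]
      exact le_top
    exact ⟨φ, Φ, h1, h2, h3, h4.trans (mul_le_mul_right this _), h5.trans (mul_le_mul_right this _)⟩
  rw [mem_sobolevPerp_iff] at hF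
  have hF2 := fun k => sobSq_timeCoeff_lt_top hF.2 k
  have hsum : ∑' k, sobSq 2 (timeCoeff k F) ≠ ⊤ := by
    intro h0
    have := hF.2
    rw [sobolevNormSq_zero_left, h0, ENNReal.mul_top (by simpa using hT)] at this
    exact this.ne rfl
  have hε2 : ε / 2 ≠ 0 := by simpa using hε
  -- Keep finitely many coefficients and approximate each of them. The coefficient zero is
  -- approximated by zero, so that the difference stays purely oscillatory.
  obtain ⟨S, hS⟩ := ((ENNReal.tendsto_tsum_compl_atTop_zero hsum).eventually
    (gt_mem_nhds (pos_iff_ne_zero.2 hε2))).exists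
  obtain ⟨δ, hδ0, hδ⟩ := ENNReal.exists_pos_sum_of_countable' hε2 ℤ
  have happ : ∀ k, ∃ χ : 𝓢(Eu (d + 1), ℂ), HasCompactSupport χ ∧
      sobSq 2 (timeCoeff k F - toL2 χ) ≤ δ k ∧ (k = 0 → toL2 χ = 0) := by
    intro k
    by_cases hk : k = 0
    · have h0 : toL2 (0 : 𝓢(Eu (d + 1), ℂ)) = 0 :=
        (SchwartzMap.toLpCLM ℂ ℂ 2 (volume : Measure (Eu (d + 1)))).map_zero
      refine ⟨0, HasCompactSupport.zero, ?_, fun _ => h0⟩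
      rw [hk, hF.1, h0, sub_zero, sobSq_zero]
      exact zero_le
    · obtain ⟨χ, h1, h2⟩ := exists_testFunction_approx (by norm_num) (hF2 k) (hδ0 k).ne'
      exact ⟨χ, h1, h2.le, fun h => absurd h hk⟩
  choose χ hχ hχδ hχ0 using happ
  set Φ : L2 T (d + 1) := ∑ k ∈ S, mode k (toL2 (χ k)) with hΦ
  set G : L2 T d := ∑ k ∈ S, mode k (toL2 (slice 0 (∂_{normal d} (χ k)))) with hG
  have hcoeff : ∀ k, timeCoeff k (F - Φ) = if k ∈ S then timeCoeff k F - toL2 (χ k)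
      else timeCoeff k F := fun k => by
    rw [map_sub, hΦ, timeCoeff_sum_mode]
    split_ifs <;> simp
  have hX : ∑' k, sobSq 2 (timeCoeff k (F - Φ)) ≤ ε := by
    calc ∑' k, sobSq 2 (timeCoeff k (F - Φ))
        ≤ ∑' k, (δ k + {k | k ∉ S}.indicator (fun k => sobSq 2 (timeCoeff k F)) k) := by
          refine ENNReal.tsum_le_tsum fun k => ?_
          rw [hcoeff]
          split_ifs with hk
          · exact (hχδ k).trans le_self_add
          · rw [Set.indicator_of_mem (show k ∈ {k | k ∉ S} from hk)]
            exact le_add_self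
      _ = ∑' k, δ k + ∑' k : {k | k ∉ S}, sobSq 2 (timeCoeff k F) := by
          rw [ENNReal.tsum_add, tsum_subtype {k | k ∉ S} fun k => sobSq 2 (timeCoeff k F)]
      _ ≤ ε / 2 + ε / 2 := add_le_add hδ.le hS.le
      _ = ε := ENNReal.add_halves ε
  have hN : sobolevNormSq 0 2 (F - Φ) ≤ ENNReal.ofReal T * ε := by
    rw [sobolevNormSq_zero_left]
    exact mul_le_mul_right hX _
  refine ⟨_, Φ, isTestFunction_sum_fourier_mul S hχ, coeFn_sum_mode S χ,
    mem_sobolevPerp_iff.2 ⟨?_, hN.trans_lt (ENNReal.mul_lt_top ENNReal.ofReal_lt_top hεt)⟩, hN, ?_⟩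
  · rw [hcoeff, hF.1]
    split_ifs
    · rw [hχ0 0 rfl, sub_zero]
    · rfl
  have hGn : eLpNorm (fun q => g q - normalDeriv
      (fun p : Cyl T (d + 1) => ∑ k ∈ S, (fourier k p.1 : ℂ) * χ k p.2) (boundaryPoint q)) 2 volume =
      ‖g - G‖ₑ := by
    rw [Lp.enorm_def]
    refine eLpNorm_congr_ae ?_
    filter_upwards [Lp.coeFn_sub g G,
      coeFn_sum_mode (T := T) S fun k => slice 0 (∂_{normal d} (χ k))] with q h1 h2
    rw [h1, Pi.sub_apply, h2, normalDeriv_sum_fourier_mul S hχ]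
  rw [hGn, enorm_sq_eq_tsum_timeCoeff]
  refine mul_le_mul_right (le_trans (ENNReal.tsum_le_tsum fun k => ?_) hX) _
  have hFk1 : sobSq 1 (timeCoeff k F) < ⊤ := (sobSq_mono (by norm_num) _).trans_lt (hF2 k)
  obtain ⟨q, hq⟩ := exists_deriv (normal d) hFk1
  rw [hcoeff, map_sub, hG, timeCoeff_sum_mode]
  split_ifs
  · exact enorm_trace_normalDeriv_sq_le (hq.sub (isMul_lineDeriv (χ k) (normal d)))
      ((h k q hq).sub (sobSq_deriv_lt_top hq (by norm_num; exact hF2 k)) (sobSq_toL2_lt_top 1 _)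
        (isTrace_toL2 _))
  · rw [sub_zero]
    exact enorm_trace_normalDeriv_sq_le hq (h k q hq)

theorem halfSobolevNorm_le {s r : ℝ} {F : L2 T (d + 1)} (hF : F ∈ sobolevPerp T (d + 1) s r) :
    halfSobolevNorm s r (restrictHalf T d F) ≤ sobolevNorm s r F :=
  iInf₂_le F ⟨hF, rfl⟩

/-- Conversely to `HasNeumannTrace.isTrace`, the trace of the Fourier coefficients determines the
Neumann trace. -/
theorem hasNeumannTrace_of_modes {F : L2 T (d + 1)} (hF : F ∈ sobolevPerp T (d + 1) 0 2)
    {g : L2 T d} (h : ∀ k q, IsMul (derivSymbol (normal d)) (timeCoeff k F) q →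
      IsTrace q (timeCoeff k g)) : HasNeumannTrace (restrictHalf T d F) g := by
  have happ := fun j : ℕ => exists_testFunction_approx_neumann hF h
    (ε := ((j : ℝ≥0∞)⁻¹)) (ENNReal.inv_ne_zero.2 (ENNReal.natCast_ne_top j))
  choose φ Φ h1 h2 h3 h4 h5 using happ
  have hlim : Tendsto (fun j : ℕ => (ENNReal.ofReal T * (j : ℝ≥0∞)⁻¹) ^ (1 / 2 : ℝ)) atTop (𝓝 0) := by
    have := (ENNReal.Tendsto.const_mul ENNReal.tendsto_inv_nat_nhds_zero
      (Or.inr ENNReal.ofReal_ne_top) (a := ENNReal.ofReal T)).ennrpow_const (1 / 2 : ℝ)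
    simpa using this
  have hroot : ∀ {x y : ℝ≥0∞}, x ^ 2 ≤ y → x ≤ y ^ (1 / 2 : ℝ) := fun {x y} hxy => by
    have := ENNReal.rpow_le_rpow hxy (by norm_num : (0 : ℝ) ≤ 1 / 2)
    rwa [← ENNReal.rpow_natCast_mul, Nat.cast_ofNat, show (2 : ℝ) * (1 / 2) = 1 by norm_num,
      ENNReal.rpow_one] at this
  refine ⟨φ, fun j => restrictHalf T d (Φ j), h1, fun j => ?_, ?_, ?_⟩
  · filter_upwards [coeFn_restrictHalf (Φ j), ae_restrict_of_ae (h2 j)] with p e1 e2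
    rw [e1, e2]
  · refine tendsto_of_tendsto_of_tendsto_of_le_of_le tendsto_const_nhds hlim (fun _ => zero_le)
      fun j => ?_
    simp only
    rw [← map_sub]
    refine (halfSobolevNorm_le (h3 j)).trans (hroot ?_)
    rw [sobolevNorm_sq]
    exact h4 j
  · exact tendsto_of_tendsto_of_tendsto_of_le_of_le tendsto_const_nhds hlim (fun _ => zero_le)
      fun j => hroot (h5 j)

/-- The Neumann trace may be computed for each Fourier coefficient in time. This uses that traces
of functions in `H²` depend only on the restriction to the half space. -/
theorem HasNeumannTrace.isTrace {F : L2 T (d + 1)} (hF : F ∈ sobolevPerp T (d + 1) 0 2)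
    {g : L2 T d} (hg : HasNeumannTrace (restrictHalf T d F) g) (k : ℤ) {q : SpaceL2 (d + 1)}
    (hq : IsMul (derivSymbol (normal d)) (timeCoeff k F) q) : IsTrace q (timeCoeff k g) := by
  have hT : (0 : ℝ) < T := Fact.out
  obtain ⟨φ, Φ, h1, h2, h3, h4⟩ := hg
  rw [mem_sobolevPerp_iff] at hF
  have hq1 : sobSq 1 q < ⊤ :=
    sobSq_deriv_lt_top hq (by norm_num; exact sobSq_timeCoeff_lt_top hF.2 k)
  obtain ⟨h', hh'⟩ := exists_isTrace hq1
  -- Compare `F` with an approximating test function through an extension `H` of their difference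
  -- whose norm is less than `c`.
  have key : ∀ c : ℝ≥0∞, 0 < c → ENNReal.ofReal T * ‖timeCoeff k g - h'‖ₑ ^ 2 ≤ 4 * c ^ 2 := by
    intro c hc
    obtain ⟨j, ha, hb⟩ := ((h3.eventually (gt_mem_nhds hc)).and
      (h4.eventually (gt_mem_nhds hc))).exists
    unfold halfSobolevNorm at ha
    simp only [iInf_lt_iff] at ha
    obtain ⟨H, ⟨hH, hHr⟩, hHc⟩ := ha
    rw [mem_sobolevPerp_iff] at hH
    have hHk := sobSq_timeCoeff_lt_top hH.2 k
    obtain ⟨p, hp⟩ := exists_deriv (normal d) ((sobSq_mono (by norm_num) _).trans_lt hHk)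
    have hp1 : sobSq 1 p < ⊤ := sobSq_deriv_lt_top hp (by norm_num; exact hHk)
    obtain ⟨hHtr, hHt⟩ := exists_isTrace hp1
    have ht := h1 j
    -- `F - H` and the test function agree on the half space
    have hres : restrictHalf T d (F - H) = restrictHalf T d (ht.memLp.toLp (φ j)) := by
      rw [map_sub, hHr, sub_sub_cancel]
      refine Lp.ext ?_
      filter_upwards [h2 j, coeFn_restrictHalf (ht.memLp.toLp (φ j)),
        ae_restrict_of_ae ht.memLp.coeFn_toLp] with x e1 e2 e3
      rw [e1, e2, e3]
    have hresk := restrictHalf_eq_iff.1 hres k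
    rw [ht.timeCoeff_toLp, map_sub, ← sub_eq_zero, ← map_sub] at hresk
    have hD := (hq.sub hp).sub (isMul_lineDeriv (ht.coeff k) (normal d))
    have htr := trace_eq_zero_of_resHalf_eq_zero
      ((sobSq_sub_le 1 _ _).trans_lt (ENNReal.mul_lt_top (by norm_num) (ENNReal.add_lt_top.2
        ⟨(sobSq_sub_le 1 _ _).trans_lt (ENNReal.mul_lt_top (by norm_num)
          (ENNReal.add_lt_top.2 ⟨hq1, hp1⟩)), sobSq_toL2_lt_top 1 _⟩)))
      ((hh'.sub hq1 hp1 hHt).sub ((sobSq_sub_le 1 _ _).trans_lt (ENNReal.mul_lt_top (by norm_num)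
          (ENNReal.add_lt_top.2 ⟨hq1, hp1⟩))) (sobSq_toL2_lt_top 1 _) (isTrace_toL2 _))
      (resHalf_deriv_eq_zero hD hresk)
    have hbd := ht.normalDeriv.boundary
    have hGk : timeCoeff k (hbd.memLp.toLp _) = toL2 (slice 0 (∂_{normal d} (ht.coeff k))) := by
      rw [hbd.timeCoeff_toLp, ht.lineDeriv_coeff]
      congr 1
      ext x
      rw [hbd.coeff_apply, slice_apply, IsTestFunction.coeff_apply, ← normalDeriv_eq_dirDeriv]
      rfl
    set G : L2 T d := hbd.memLp.toLp _ with hG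
    have hGn : ‖g - G‖ₑ = eLpNorm (fun q => g q - normalDeriv (φ j) (boundaryPoint q)) 2 volume := by
      rw [Lp.enorm_def]
      refine eLpNorm_congr_ae ?_
      filter_upwards [Lp.coeFn_sub g G, hbd.memLp.coeFn_toLp] with x e1 e2
      rw [e1, Pi.sub_apply, hG, e2]
    have e : timeCoeff k g - h' = timeCoeff k (g - G) - hHtr := by
      rw [map_sub, hGk]
      rw [sub_sub, sub_eq_zero] at htr
      rw [htr]
      abel
    have hsq : ‖timeCoeff k (g - G) - hHtr‖ₑ ^ 2 ≤
        2 * (‖timeCoeff k (g - G)‖ₑ ^ 2 + ‖hHtr‖ₑ ^ 2) := by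
      rw [← sobSq_zero_order, ← sobSq_zero_order, ← sobSq_zero_order]
      exact sobSq_sub_le 0 _ _
    rw [e]
    calc ENNReal.ofReal T * ‖timeCoeff k (g - G) - hHtr‖ₑ ^ 2
        ≤ ENNReal.ofReal T * (2 * (‖timeCoeff k (g - G)‖ₑ ^ 2 + ‖hHtr‖ₑ ^ 2)) :=
          mul_le_mul_right hsq _
      _ = 2 * (ENNReal.ofReal T * ‖timeCoeff k (g - G)‖ₑ ^ 2 + ENNReal.ofReal T * ‖hHtr‖ₑ ^ 2) := by
          ring
      _ ≤ 2 * (c ^ 2 + c ^ 2) := by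
          refine mul_le_mul_right (add_le_add ?_ ?_) _
          · refine (enorm_timeCoeff_sq_le k _).trans ?_
            rw [hGn]
            exact pow_le_pow_left₀ zero_le hb.le 2
          · refine (mul_le_mul_right (enorm_trace_normalDeriv_sq_le hp hHt) _).trans ?_
            have := mode_le_sobolevNormSq 0 2 H k
            rw [Real.rpow_zero, ENNReal.ofReal_one, one_mul, ← sobolevNorm_sq] at this
            exact this.trans (pow_le_pow_left₀ zero_le hHc.le 2)
      _ = 4 * c ^ 2 := by ring
  have hlim : Tendsto (fun n : ℕ => 4 * ((n : ℝ≥0∞)⁻¹) ^ 2) atTop (𝓝 0) := by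
    have := ENNReal.Tendsto.const_mul ((ENNReal.continuous_pow 2).tendsto 0 |>.comp
      ENNReal.tendsto_inv_nat_nhds_zero) (Or.inr (by norm_num)) (a := (4 : ℝ≥0∞))
    simpa using this
  have h0 := ge_of_tendsto' hlim fun n => key _ (ENNReal.inv_pos.2 (ENNReal.natCast_ne_top n))
  have h5 : timeCoeff k g = h' := by
    have h6 : ‖timeCoeff k g - h'‖ₑ = 0 := by
      have := (mul_eq_zero.1 (le_antisymm h0 zero_le)).resolve_left (by simpa using hT)
      exact pow_eq_zero_iff (two_ne_zero) |>.1 this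
    rw [enorm_eq_zero, sub_eq_zero] at h6
    exact h6
  rwa [h5]

end NeumannTraceByModes

/-! ### The system in terms of Fourier coefficients in time -/

section SystemByModes

variable {T : ℝ} [Fact (0 < T)] {m d : ℕ}

theorem SolvesMode.add {τ : ℝ} {u₁ u₂ f₁ f₂ v₁ v₂ e₁ e₂ : SpaceL2 (d + 1)} {g₁ g₂ h₁ h₂ : SpaceL2 d}
    (hu : SolvesMode τ u₁ u₂ f₁ f₂ g₁ g₂) (hv : SolvesMode τ v₁ v₂ e₁ e₂ h₁ h₂)
    (hu₁ : sobSq 2 u₁ < ⊤) (hu₂ : sobSq 2 u₂ < ⊤) (hv₁ : sobSq 2 v₁ < ⊤) (hv₂ : sobSq 2 v₂ < ⊤) :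
    SolvesMode τ (u₁ + v₁) (u₂ + v₂) (f₁ + e₁) (f₂ + e₂) (g₁ + h₁) (g₂ + h₂) := by
  have trace : ∀ {a b : SpaceL2 (d + 1)} {g h : SpaceL2 d}, sobSq 2 a < ⊤ → sobSq 2 b < ⊤ →
      (∀ q, IsMul (derivSymbol (normal d)) a q → IsTrace q g) →
      (∀ q, IsMul (derivSymbol (normal d)) b q → IsTrace q h) →
      ∀ q, IsMul (derivSymbol (normal d)) (a + b) q → IsTrace q (g + h) := by
    intro a b g h ha hb hg hh q hq
    obtain ⟨p, hp⟩ := exists_deriv (normal d) ((sobSq_mono (by norm_num) a).trans_lt ha)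
    obtain ⟨p', hp'⟩ := exists_deriv (normal d) ((sobSq_mono (by norm_num) b).trans_lt hb)
    rw [hq.unique (hp.add hp')]
    exact (hg p hp).add (sobSq_deriv_lt_top hp (by norm_num; exact ha))
      (sobSq_deriv_lt_top hp' (by norm_num; exact hb)) (hh p' hp')
  refine ⟨fun L hL => ?_, fun L hL => ?_, trace hu₁ hv₁ hu.trace_one hv.trace_one,
    trace hu₂ hv₂ hu.trace_two hv.trace_two⟩
  · obtain ⟨L₁, hL₁⟩ := exists_lap hu₂
    obtain ⟨L₂, hL₂⟩ := exists_lap hv₂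
    rw [hL.unique (hL₁.add hL₂), map_add _ f₁, ← hu.eq_one L₁ hL₁, ← hv.eq_one L₂ hL₂, ← map_add]
    congr 1
    rw [smul_add]
    abel
  · obtain ⟨L₁, hL₁⟩ := exists_lap hu₁
    obtain ⟨L₂, hL₂⟩ := exists_lap hv₁
    rw [hL.unique (hL₁.add hL₂), map_add _ f₂, ← hu.eq_two L₁ hL₁, ← hv.eq_two L₂ hL₂, ← map_add]
    congr 1
    rw [smul_add]
    abel

theorem SolvesMode.smul {τ : ℝ} {u₁ u₂ f₁ f₂ : SpaceL2 (d + 1)} {g₁ g₂ : SpaceL2 d} (c : ℂ)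
    (hu : SolvesMode τ u₁ u₂ f₁ f₂ g₁ g₂) (hu₁ : sobSq 2 u₁ < ⊤) (hu₂ : sobSq 2 u₂ < ⊤) :
    SolvesMode τ (c • u₁) (c • u₂) (c • f₁) (c • f₂) (c • g₁) (c • g₂) := by
  have trace : ∀ {a : SpaceL2 (d + 1)} {g : SpaceL2 d}, sobSq 2 a < ⊤ →
      (∀ q, IsMul (derivSymbol (normal d)) a q → IsTrace q g) →
      ∀ q, IsMul (derivSymbol (normal d)) (c • a) q → IsTrace q (c • g) := by
    intro a g ha hg q hq
    obtain ⟨p, hp⟩ := exists_deriv (normal d) ((sobSq_mono (by norm_num) a).trans_lt ha)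
    rw [hq.unique (hp.smul c)]
    exact (hg p hp).smul c
  refine ⟨fun L hL => ?_, fun L hL => ?_, trace hu₁ hu.trace_one, trace hu₂ hu.trace_two⟩
  · obtain ⟨L₁, hL₁⟩ := exists_lap hu₂
    rw [hL.unique (hL₁.smul c), map_smul, ← hu.eq_one L₁ hL₁, ← map_smul, smul_sub, smul_comm]
  · obtain ⟨L₁, hL₁⟩ := exists_lap hu₁
    rw [hL.unique (hL₁.smul c), map_smul, ← hu.eq_two L₁ hL₁, ← map_smul, smul_add, smul_sub,
      smul_comm]

theorem SolvesMode.zero (τ : ℝ) : SolvesMode (d := d) τ 0 0 0 0 0 0 := by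
  have hz : sobSq 2 (0 : SpaceL2 (d + 1)) < ⊤ := by rw [sobSq_zero]; exact ENNReal.zero_lt_top
  have h := exists_data_of_mode (d := d) τ (u := 0) (u' := 0) (u₂ := 0) rfl
    (by rw [sobSq_zero]; exact ENNReal.zero_lt_top) (by rw [sobSq_zero]; exact ENNReal.zero_lt_top) hz
  obtain ⟨f₁, f₂, g₁, g₂, h, -⟩ := h
  simpa using h.smul 0 hz hz

theorem restrictHalf_integral_mul (F : L2 T (d + 1)) (ψ : Cyl T (d + 1) → ℂ) :
    ∫ p in upperHalf T d, restrictHalf T d F p * ψ p = ∫ p in upperHalf T d, F p * ψ p :=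
  integral_congr_ae ((coeFn_restrictHalf F).mono fun p hp => by simp only [hp])

/-- A function solves the system in the sense of distributions and traces iff each of its Fourier
coefficients in time solves the corresponding resolvent problem. -/
theorem isSolution_iff {F₁ F₂ Φ₁ Φ₂ : L2 T (d + 1)} {g : L2 T d × L2 T d}
    (hF₁ : F₁ ∈ sobolevPerp T (d + 1) 0 2) (hF₂ : F₂ ∈ sobolevPerp T (d + 1) 0 2) :
    IsSolution (restrictHalf T d F₁, restrictHalf T d F₂)
      (restrictHalf T d Φ₁, restrictHalf T d Φ₂) g ↔
    ∀ k, SolvesMode (freq T k) (timeCoeff k F₁) (timeCoeff k F₂) (timeCoeff k Φ₁) (timeCoeff k Φ₂)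
      (timeCoeff k g.1) (timeCoeff k g.2) := by
  have int : ∀ {ψ : Cyl T (d + 1) → ℂ}, IsTestFunction ψ → ∀ F : L2 T (d + 1),
      IntegrableOn (fun p => F p * ψ p) (upperHalf T d) := fun hψ F =>
    (hψ.integrable_mul F).integrableOn
  have int' : ∀ {ψ : Cyl T (d + 1) → ℂ}, IsTestFunction ψ → ∀ F : L2 T (d + 1),
      IntegrableOn (fun p => restrictHalf T d F p * ψ p) (upperHalf T d) := fun hψ F =>
    (int hψ F).congr ((coeFn_restrictHalf F).mono fun p hp => by simp only [hp])
  have split : ∀ {φ : Cyl T (d + 1) → ℂ}, IsTestFunction φ → ∀ A B C : L2 T (d + 1),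
      ∫ p in upperHalf T d, (A p * timeDeriv φ p + B p * spaceLaplacian φ p + C p * φ p) =
      (∫ p in upperHalf T d, A p * timeDeriv φ p) +
        (∫ p in upperHalf T d, B p * spaceLaplacian φ p) + ∫ p in upperHalf T d, C p * φ p := by
    intro φ hφ A B C
    have hA := int hφ.timeDeriv A
    have hB := int hφ.spaceLaplacian B
    have hC := int hφ C
    have := integral_add (hA.add hB) hC
    simp only [Pi.add_apply] at this
    rw [this, integral_add hA hB]
  have one : ∀ {φ : Cyl T (d + 1) → ℂ}, IsTestFunction φ →
      ((∫ p in upperHalf T d, (-(restrictHalf T d F₁ p * timeDeriv φ p) -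
        restrictHalf T d F₂ p * spaceLaplacian φ p) =
        ∫ p in upperHalf T d, restrictHalf T d Φ₁ p * φ p) ↔
      ∫ p in upperHalf T d, (F₁ p * timeDeriv φ p + F₂ p * spaceLaplacian φ p + Φ₁ p * φ p) = 0) := by
    intro φ hφ
    have := integral_sub (int' hφ.timeDeriv F₁).neg (int' hφ.spaceLaplacian F₂)
    simp only [Pi.neg_apply] at this
    rw [split hφ, this, integral_neg, restrictHalf_integral_mul, restrictHalf_integral_mul,
      restrictHalf_integral_mul]
    constructor <;> intro h <;> linear_combination -h
  have two : ∀ {φ : Cyl T (d + 1) → ℂ}, IsTestFunction φ →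
      ((∫ p in upperHalf T d, (restrictHalf T d F₁ p * spaceLaplacian φ p +
        restrictHalf T d F₁ p * timeDeriv φ p + restrictHalf T d F₂ p * φ p) =
        ∫ p in upperHalf T d, restrictHalf T d Φ₂ p * φ p) ↔
      ∫ p in upperHalf T d, (F₁ p * timeDeriv φ p + F₁ p * spaceLaplacian φ p +
        (F₂ - Φ₂ : L2 T (d + 1)) p * φ p) = 0) := by
    intro φ hφ
    have h1 := integral_add ((int' hφ.spaceLaplacian F₁).add (int' hφ.timeDeriv F₁)) (int' hφ F₂)
    simp only [Pi.add_apply] at h1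
    have h2 : ∫ p in upperHalf T d, (F₂ - Φ₂ : L2 T (d + 1)) p * φ p =
        (∫ p in upperHalf T d, F₂ p * φ p) - ∫ p in upperHalf T d, Φ₂ p * φ p := by
      rw [← integral_sub (int hφ F₂) (int hφ Φ₂)]
      refine integral_congr_ae ?_
      filter_upwards [ae_restrict_of_ae (Lp.coeFn_sub F₂ Φ₂)] with p hp
      rw [hp, Pi.sub_apply, sub_mul]
    rw [split hφ, h1, h2, integral_add (int' hφ.spaceLaplacian F₁) (int' hφ.timeDeriv F₁),
      restrictHalf_integral_mul, restrictHalf_integral_mul, restrictHalf_integral_mul,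
      restrictHalf_integral_mul]
    constructor <;> intro h <;> linear_combination h
  have hs₁ := fun k => sobSq_timeCoeff_lt_top (mem_sobolevPerp_iff.1 hF₁).2 k
  have hs₂ := fun k => sobSq_timeCoeff_lt_top (mem_sobolevPerp_iff.1 hF₂).2 k
  constructor
  · intro h k
    refine ⟨fun L hL => ?_, fun L hL => ?_, fun q hq => h.trace_one.isTrace hF₁ k hq,
      fun q hq => h.trace_two.isTrace hF₂ k hq⟩
    · have := modes_of_weak (fun φ hφ => (one hφ.toIsTestFunction).1 (h.eq_one φ hφ)) k hL
      rw [map_add, map_sub] at this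
      rw [map_sub]
      rw [eq_neg_of_add_eq_zero_right this, neg_sub]
    · have := modes_of_weak (fun φ hφ => (two hφ.toIsTestFunction).1 (h.eq_two φ hφ)) k hL
      rw [map_add, map_sub, map_sub, map_sub] at this
      rw [map_add, map_sub]
      rwa [← add_sub_assoc, sub_eq_zero] at this
  · intro h
    refine ⟨fun φ hφ => (one hφ.toIsTestFunction).2 (weak_of_modes hs₂ (fun k L hL => ?_) hφ),
      fun φ hφ => (two hφ.toIsTestFunction).2 (weak_of_modes hs₁ (fun k L hL => ?_) hφ),
      hasNeumannTrace_of_modes hF₁ fun k => (h k).trace_one,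
      hasNeumannTrace_of_modes hF₂ fun k => (h k).trace_two⟩
    · have := (h k).eq_one L hL
      rw [map_sub] at this
      rw [map_add, map_sub]
      rw [← this]
      abel
    · have := (h k).eq_two L hL
      rw [map_add, map_sub] at this
      rw [map_add, map_sub, map_sub, map_sub]
      rw [← this]
      abel

theorem sobolevPerp_mono {r r' : ℝ} (h : r ≤ r') : sobolevPerp T m 0 r' ≤ sobolevPerp T m 0 r := by
  intro F hF
  rw [mem_sobolevPerp_iff] at hF ⊢
  refine ⟨hF.1, lt_of_le_of_lt ?_ hF.2⟩
  rw [sobolevNormSq_zero_left, sobolevNormSq_zero_left]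
  gcongr
  exact sobSq_mono h _

theorem exists_of_mem_solutionSpace {u : L2Half T d × L2Half T d} (hu : u ∈ solutionSpace T d) :
    ∃ F₁ ∈ sobolevPerp T (d + 1) 0 2, ∃ F₂ ∈ sobolevPerp T (d + 1) 0 2,
      u = (restrictHalf T d F₁, restrictHalf T d F₂) := by
  obtain ⟨⟨-, F₁, h₁, e₁⟩, F₂, h₂, e₂⟩ := hu
  exact ⟨F₁, sobolevPerp_mono (by norm_num) h₁, F₂, h₂, Prod.ext e₁.symm e₂.symm⟩

theorem exists_of_mem_dataSpace {f : L2Half T d × L2Half T d} (hf : f ∈ dataSpace T d) :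
    ∃ Φ₁ ∈ sobolevPerp T (d + 1) 0 0, ∃ Φ₂ ∈ sobolevPerp T (d + 1) 0 1,
      f = (restrictHalf T d Φ₁, restrictHalf T d Φ₂) := by
  obtain ⟨⟨Φ₁, h₁, e₁⟩, Φ₂, h₂, e₂⟩ := hf
  exact ⟨Φ₁, h₁, Φ₂, h₂, Prod.ext e₁.symm e₂.symm⟩

theorem IsSolution.add {u v f e : L2Half T d × L2Half T d} {g h : L2 T d × L2 T d}
    (hu : u ∈ solutionSpace T d) (hv : v ∈ solutionSpace T d) (hf : f ∈ dataSpace T d)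
    (he : e ∈ dataSpace T d) (H : IsSolution u f g) (H' : IsSolution v e h) :
    IsSolution (u + v) (f + e) (g + h) := by
  obtain ⟨F₁, h₁, F₂, h₂, rfl⟩ := exists_of_mem_solutionSpace hu
  obtain ⟨G₁, k₁, G₂, k₂, rfl⟩ := exists_of_mem_solutionSpace hv
  obtain ⟨Φ₁, -, Φ₂, -, rfl⟩ := exists_of_mem_dataSpace hf
  obtain ⟨Ψ₁, -, Ψ₂, -, rfl⟩ := exists_of_mem_dataSpace he
  rw [isSolution_iff h₁ h₂] at H
  rw [isSolution_iff k₁ k₂] at H'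
  simp only [Prod.mk_add_mk, ← map_add]
  rw [isSolution_iff (add_mem h₁ k₁) (add_mem h₂ k₂)]
  intro k
  have fin : ∀ {F : L2 T (d + 1)}, F ∈ sobolevPerp T (d + 1) 0 2 → sobSq 2 (timeCoeff k F) < ⊤ :=
    fun hF => sobSq_timeCoeff_lt_top (mem_sobolevPerp_iff.1 hF).2 k
  simpa only [map_add, Prod.fst_add, Prod.snd_add] using
    (H k).add (H' k) (fin h₁) (fin h₂) (fin k₁) (fin k₂)

theorem IsSolution.smul (c : ℂ) {u f : L2Half T d × L2Half T d} {g : L2 T d × L2 T d}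
    (hu : u ∈ solutionSpace T d) (hf : f ∈ dataSpace T d) (H : IsSolution u f g) :
    IsSolution (c • u) (c • f) (c • g) := by
  obtain ⟨F₁, h₁, F₂, h₂, rfl⟩ := exists_of_mem_solutionSpace hu
  obtain ⟨Φ₁, -, Φ₂, -, rfl⟩ := exists_of_mem_dataSpace hf
  rw [isSolution_iff h₁ h₂] at H
  simp only [Prod.smul_mk, ← map_smul]
  rw [isSolution_iff (Submodule.smul_mem _ c h₁) (Submodule.smul_mem _ c h₂)]
  intro k
  have fin : ∀ {F : L2 T (d + 1)}, F ∈ sobolevPerp T (d + 1) 0 2 → sobSq 2 (timeCoeff k F) < ⊤ :=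
    fun hF => sobSq_timeCoeff_lt_top (mem_sobolevPerp_iff.1 hF).2 k
  simpa only [map_smul, Prod.smul_fst, Prod.smul_snd] using (H k).smul c (fin h₁) (fin h₂)

theorem IsSolution.sub {u v f e : L2Half T d × L2Half T d} {g h : L2 T d × L2 T d}
    (hu : u ∈ solutionSpace T d) (hv : v ∈ solutionSpace T d) (hf : f ∈ dataSpace T d)
    (he : e ∈ dataSpace T d) (H : IsSolution u f g) (H' : IsSolution v e h) :
    IsSolution (u - v) (f - e) (g - h) := by
  have := H.add hu (Submodule.smul_mem _ (-1 : ℂ) hv) hf (Submodule.smul_mem _ (-1 : ℂ) he)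
    (H'.smul (-1) hv he)
  simpa only [neg_one_smul, ← sub_eq_add_neg] using this

/-- Solutions in `𝔼` are unique. For the frequency zero, where the determinant of the symbol
degenerates, there is nothing to show, because the time average vanishes. -/
theorem IsSolution.eq_of_data_eq {u v f : L2Half T d × L2Half T d} {g : L2 T d × L2 T d}
    (hu : u ∈ solutionSpace T d) (hv : v ∈ solutionSpace T d) (hf : f ∈ dataSpace T d)
    (H : IsSolution u f g) (H' : IsSolution v f g) : u = v := by
  have h := H.sub hu hv hf hf H'
  rw [sub_self, sub_self] at h
  obtain ⟨F₁, h₁, F₂, h₂, e⟩ := exists_of_mem_solutionSpace (sub_mem hu hv)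
  rw [← sub_eq_zero, e]
  rw [e, show (0 : L2Half T d × L2Half T d) = (restrictHalf T d 0, restrictHalf T d 0) by
    rw [map_zero]; rfl, isSolution_iff h₁ h₂] at h
  rw [mem_sobolevPerp_iff] at h₁ h₂
  have hT : (0 : ℝ) < T := Fact.out
  have key : ∀ k, resHalf d (timeCoeff k F₁) = 0 ∧ resHalf d (timeCoeff k F₂) = 0 := by
    intro k
    by_cases hk : k = 0
    · rw [hk, h₁.1, h₂.1]
      exact ⟨map_zero _, map_zero _⟩
    · have hfr : freq T k ≠ 0 := by
        have := (div_pos Real.two_pi_pos hT).trans_le (le_abs_freq (T := T) hk)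
        exact abs_pos.1 this
      have h3 := h k
      simp only [map_zero, Prod.fst_zero, Prod.snd_zero] at h3
      exact h3.eq_zero hfr (map_zero _) (map_zero _) (sobSq_timeCoeff_lt_top h₁.2 k)
        (sobSq_timeCoeff_lt_top h₂.2 k)
  exact Prod.ext (restrictHalf_eq_zero_iff.2 fun k => (key k).1)
    (restrictHalf_eq_zero_iff.2 fun k => (key k).2)

/-- The data are determined by the solution. -/
theorem IsSolution.data_eq {u f e : L2Half T d × L2Half T d} {g h : L2 T d × L2 T d}
    (hu : u ∈ solutionSpace T d) (hf : f ∈ dataSpace T d) (he : e ∈ dataSpace T d)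
    (H : IsSolution u f g) (H' : IsSolution u e h) : f = e ∧ g = h := by
  have h := H.sub hu hu hf he H'
  rw [sub_self] at h
  obtain ⟨Φ₁, -, Φ₂, -, e⟩ := exists_of_mem_dataSpace (sub_mem hf he)
  rw [← sub_eq_zero (a := f), ← sub_eq_zero (a := g), e]
  rw [e, show (0 : L2Half T d × L2Half T d) = (restrictHalf T d 0, restrictHalf T d 0) by
    rw [map_zero]; rfl, isSolution_iff (zero_mem _) (zero_mem _)] at h
  simp only [map_zero] at h
  have zt : IsTrace (0 : SpaceL2 (d + 1)) (0 : SpaceL2 d) :=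
    (SolvesMode.zero (d := d) 0).trace_one 0 IsMul.zero
  refine ⟨Prod.ext (restrictHalf_eq_zero_iff.2 fun k => ?_)
    (restrictHalf_eq_zero_iff.2 fun k => ?_), Prod.ext (timeCoeff_injective fun k => ?_)
    (timeCoeff_injective fun k => ?_)⟩
  · simpa using ((h k).eq_one 0 IsMul.zero).symm
  · simpa using ((h k).eq_two 0 IsMul.zero).symm
  · rw [Prod.fst_zero, map_zero]
    exact ((h k).trace_one 0 IsMul.zero).unique zt
  · rw [Prod.snd_zero, map_zero]
    exact ((h k).trace_two 0 IsMul.zero).unique zt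

end SystemByModes

/-! ### The solution operator and its inverse -/

section SolutionOperator

variable {T : ℝ} [Fact (0 < T)] {m d : ℕ}

theorem le_mul_of_sq_le {a b : ℝ≥0∞} {C : ℝ≥0} (h : a ^ 2 ≤ C * b ^ 2) : a ≤ (C + 1) * b := by
  have h1 : (C : ℝ≥0∞) ≤ (C + 1) ^ 2 := by
    rw [add_sq, one_pow]
    calc (C : ℝ≥0∞) ≤ C + C := le_self_add
      _ ≤ C ^ 2 + 2 * C * 1 + 1 := by rw [mul_one, two_mul]; exact le_add_left le_rfl |>.trans le_self_add
  have h2 : a ^ 2 ≤ ((C + 1) * b) ^ 2 := by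
    rw [mul_pow]
    exact h.trans (mul_le_mul_left h1 _)
  exact (ENNReal.pow_le_pow_left_iff two_ne_zero).1 h2

theorem add_three_le_of_sq_le {a₁ a₂ a₃ b₁ b₂ b₃ b₄ b₅ : ℝ≥0∞} {C : ℝ≥0}
    (h : a₁ ^ 2 + a₂ ^ 2 + a₃ ^ 2 ≤ C * (b₁ ^ 2 + b₂ ^ 2 + (b₃ ^ 2 + b₄ ^ 2) + b₅ ^ 2)) :
    a₁ + a₂ + a₃ ≤ (3 * (C + 1) : ℝ≥0) * (b₁ + b₂ + (b₃ + b₄ + b₅)) := by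
  have hb : b₁ ^ 2 + b₂ ^ 2 + (b₃ ^ 2 + b₄ ^ 2) + b₅ ^ 2 ≤ (b₁ + b₂ + (b₃ + b₄ + b₅)) ^ 2 := by
    have key : ∀ x y : ℝ≥0∞, x ^ 2 + y ^ 2 ≤ (x + y) ^ 2 := fun x y => by
      rw [add_sq, add_right_comm]
      exact le_self_add
    rw [add_assoc (b₁ ^ 2 + b₂ ^ 2)]
    exact (add_le_add (key _ _) ((add_le_add_left (key _ _) _).trans (key _ _))).trans (key _ _)
  have h' := h.trans (mul_le_mul_right hb _)
  have e₁ := le_mul_of_sq_le ((le_self_add.trans le_self_add).trans h')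
  have e₂ := le_mul_of_sq_le ((le_add_self.trans le_self_add).trans h')
  have e₃ := le_mul_of_sq_le (le_add_self.trans h')
  refine (add_le_add (add_le_add e₁ e₂) e₃).trans (le_of_eq ?_)
  push_cast
  ring

theorem add_five_le_of_sq_le {a₁ a₂ a₃ b₁ b₂ b₃ b₄ b₅ : ℝ≥0∞} {C : ℝ≥0}
    (h : b₁ ^ 2 + b₂ ^ 2 + (b₃ ^ 2 + b₄ ^ 2) + b₅ ^ 2 ≤ C * (a₁ ^ 2 + a₂ ^ 2 + a₃ ^ 2)) :
    b₁ + b₂ + (b₃ + b₄ + b₅) ≤ (5 * (C + 1) : ℝ≥0) * (a₁ + a₂ + a₃) := by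
  have hb : a₁ ^ 2 + a₂ ^ 2 + a₃ ^ 2 ≤ (a₁ + a₂ + a₃) ^ 2 := by
    have key : ∀ x y : ℝ≥0∞, x ^ 2 + y ^ 2 ≤ (x + y) ^ 2 := fun x y => by
      rw [add_sq, add_right_comm]
      exact le_self_add
    exact (add_le_add_left (key _ _) _).trans (key _ _)
  have h' := h.trans (mul_le_mul_right hb _)
  have e₁ := le_mul_of_sq_le ((((le_self_add.trans le_self_add).trans le_self_add)).trans h')
  have e₂ := le_mul_of_sq_le (((le_add_self.trans le_self_add).trans le_self_add).trans h')
  have e₃ := le_mul_of_sq_le (((le_self_add.trans le_add_self).trans le_self_add).trans h')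
  have e₄ := le_mul_of_sq_le (((le_add_self.trans le_add_self).trans le_self_add).trans h')
  have e₅ := le_mul_of_sq_le (le_add_self.trans h')
  refine (add_le_add (add_le_add e₁ e₂) (add_le_add (add_le_add e₃ e₄) e₅)).trans (le_of_eq ?_)
  push_cast
  ring

theorem solution_normSq_eq (F F' F₂ : L2 T (d + 1)) :
    sobolevNormSq 1 1 F + sobolevNormSq 0 3 F' + sobolevNormSq 0 2 F₂ =
      ENNReal.ofReal T * ∑' k : ℤ, (ENNReal.ofReal (1 + freq T k ^ 2) * sobSq 1 (timeCoeff k F) +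
        sobSq 3 (timeCoeff k F') + sobSq 2 (timeCoeff k F₂)) := by
  rw [sobolevNormSq_eq 1, sobolevNormSq_zero_left, sobolevNormSq_zero_left, ENNReal.tsum_add,
    ENNReal.tsum_add, mul_add, mul_add]
  simp only [Real.rpow_one]

theorem data_normSq_eq (Φ₁ Φ₂ : L2 T (d + 1)) (g₁ g₂ : L2 T d) :
    sobolevNormSq 0 0 Φ₁ + sobolevNormSq 0 1 Φ₂ +
      (sobolevNormSq (3 / 4) 0 g₁ + sobolevNormSq 0 (3 / 2) g₁) + sobolevNormSq 0 (1 / 2) g₂ =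
    ENNReal.ofReal T * ∑' k : ℤ, (sobSq 0 (timeCoeff k Φ₁) + sobSq 1 (timeCoeff k Φ₂) +
      (ENNReal.ofReal ((1 + freq T k ^ 2) ^ (3 / 4 : ℝ)) * sobSq 0 (timeCoeff k g₁) +
        sobSq (3 / 2) (timeCoeff k g₁)) + sobSq (1 / 2) (timeCoeff k g₂)) := by
  rw [sobolevNormSq_eq (3 / 4), sobolevNormSq_zero_left, sobolevNormSq_zero_left,
    sobolevNormSq_zero_left, sobolevNormSq_zero_left, ENNReal.tsum_add,
    ENNReal.tsum_add, ENNReal.tsum_add, ENNReal.tsum_add]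
  ring

/-- The right inverse of the operator, for extended right-hand sides: sum the solutions for all
time frequencies. The frequencies other than zero stay away from zero by `2π / T`, which gives the
uniform constant; the coefficient with frequency zero is set to zero. -/
theorem exists_solution : ∃ C : ℝ≥0, ∀ Φ₁ ∈ sobolevPerp T (d + 1) 0 0,
    ∀ Φ₂ ∈ sobolevPerp T (d + 1) 0 1, ∀ g ∈ traceSpace T d, ∃ F₁ F₂ : L2 T (d + 1),
      F₁ ∈ sobolevPerp T (d + 1) 1 1 ∧ F₁ ∈ sobolevPerp T (d + 1) 0 3 ∧
      F₂ ∈ sobolevPerp T (d + 1) 0 2 ∧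
      IsSolution (restrictHalf T d F₁, restrictHalf T d F₂)
        (restrictHalf T d Φ₁, restrictHalf T d Φ₂) g ∧
      sobolevNorm 1 1 F₁ + sobolevNorm 0 3 F₁ + sobolevNorm 0 2 F₂ ≤
        C * (sobolevNorm 0 0 Φ₁ + sobolevNorm 0 1 Φ₂ + traceNorm g) := by
  have hT : (0 : ℝ) < T := Fact.out
  obtain ⟨C, hC⟩ := exists_solvesMode (d := d) (div_pos Real.two_pi_pos hT)
  refine ⟨3 * (C + 1), ?_⟩
  rintro Φ₁ hΦ₁ Φ₂ hΦ₂ ⟨g₁, g₂⟩ ⟨⟨hg₁, hg₁'⟩, hg₂⟩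
  simp only [SetLike.mem_coe, mem_sobolevPerp_iff] at hΦ₁ hΦ₂ hg₁ hg₁' hg₂
  have hmode : ∀ k, ∃ u₁ u₂ : SpaceL2 (d + 1), SolvesMode (freq T k) u₁ u₂ (timeCoeff k Φ₁)
      (timeCoeff k Φ₂) (timeCoeff k g₁) (timeCoeff k g₂) ∧ (k = 0 → u₁ = 0 ∧ u₂ = 0) ∧
      ENNReal.ofReal (1 + freq T k ^ 2) * sobSq 1 u₁ + sobSq 3 u₁ + sobSq 2 u₂ ≤
        C * (sobSq 0 (timeCoeff k Φ₁) + sobSq 1 (timeCoeff k Φ₂) +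
          (ENNReal.ofReal ((1 + freq T k ^ 2) ^ (3 / 4 : ℝ)) * sobSq 0 (timeCoeff k g₁) +
          sobSq (3 / 2) (timeCoeff k g₁)) + sobSq (1 / 2) (timeCoeff k g₂)) := by
    intro k
    by_cases hk : k = 0
    · refine ⟨0, 0, ?_, fun _ => ⟨rfl, rfl⟩, ?_⟩
      · rw [hk, hΦ₁.1, hΦ₂.1, hg₁.1, hg₂.1]
        exact SolvesMode.zero _
      · simp only [sobSq_zero, mul_zero, add_zero, zero_le]
    · obtain ⟨u₁, u₂, h1, h2⟩ := hC (freq T k) (le_abs_freq hk) (timeCoeff k Φ₁) (timeCoeff k Φ₂)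
        (timeCoeff k g₁) (timeCoeff k g₂) (sobSq_timeCoeff_lt_top hΦ₂.2 k)
        (sobSq_timeCoeff_lt_top hg₁'.2 k) (sobSq_timeCoeff_lt_top hg₂.2 k)
      exact ⟨u₁, u₂, h1, fun h => absurd h hk, h2⟩
  choose u₁ u₂ hu h0 hb using hmode
  have hdata := data_normSq_eq Φ₁ Φ₂ g₁ g₂
  have hfin : sobolevNormSq 0 0 Φ₁ + sobolevNormSq 0 1 Φ₂ +
      (sobolevNormSq (3 / 4) 0 g₁ + sobolevNormSq 0 (3 / 2) g₁) + sobolevNormSq 0 (1 / 2) g₂ < ⊤ := by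
    simp only [ENNReal.add_lt_top]
    exact ⟨⟨⟨hΦ₁.2, hΦ₂.2⟩, hg₁.2, hg₁'.2⟩, hg₂.2⟩
  have hsum := ENNReal.tsum_le_tsum hb
  rw [ENNReal.tsum_mul_left] at hsum
  have hsum' := mul_le_mul_right hsum (ENNReal.ofReal T)
  rw [mul_left_comm, ← hdata] at hsum'
  have hlt := hsum'.trans_lt (ENNReal.mul_lt_top ENNReal.coe_lt_top hfin)
  have hlt' : ∑' k : ℤ, (ENNReal.ofReal (1 + freq T k ^ 2) * sobSq 1 (u₁ k) + sobSq 3 (u₁ k) +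
      sobSq 2 (u₂ k)) ≠ ⊤ := by
    intro h
    rw [h, ENNReal.mul_top (by simpa using hT)] at hlt
    exact hlt.ne rfl
  obtain ⟨F₁, hF₁, -⟩ := exists_timeCoeff_eq (T := T) u₁ (ne_top_of_le_ne_top hlt'
    (ENNReal.tsum_le_tsum fun k => (enorm_sq_le_sobSq (by norm_num) _).trans
      (le_add_self.trans le_self_add)))
  obtain ⟨F₂, hF₂, -⟩ := exists_timeCoeff_eq (T := T) u₂ (ne_top_of_le_ne_top hlt'
    (ENNReal.tsum_le_tsum fun k => (enorm_sq_le_sobSq (by norm_num) _).trans le_add_self))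
  have hsol := solution_normSq_eq F₁ F₁ F₂
  simp only [hF₁, hF₂] at hsol
  rw [← hsol] at hlt hsum'
  simp only [ENNReal.add_lt_top] at hlt
  have m₁ : F₁ ∈ sobolevPerp T (d + 1) 1 1 :=
    mem_sobolevPerp_iff.2 ⟨(hF₁ 0).trans (h0 0 rfl).1, hlt.1.1⟩
  have m₁' : F₁ ∈ sobolevPerp T (d + 1) 0 3 :=
    mem_sobolevPerp_iff.2 ⟨(hF₁ 0).trans (h0 0 rfl).1, hlt.1.2⟩
  have m₂ : F₂ ∈ sobolevPerp T (d + 1) 0 2 :=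
    mem_sobolevPerp_iff.2 ⟨(hF₂ 0).trans (h0 0 rfl).2, hlt.2⟩
  refine ⟨F₁, F₂, m₁, m₁', m₂, ?_, add_three_le_of_sq_le ?_⟩
  · rw [isSolution_iff (sobolevPerp_mono (by norm_num) m₁') m₂]
    intro k
    rw [hF₁, hF₂]
    exact hu k
  · simpa only [sobolevNorm_sq] using hsum'

/-- The operator maps into the data space. The extensions `F` and `F'` of the same function attest
the two memberships of an element of `𝔼₁`; they need not coincide. -/
theorem exists_data {F F' F₂ : L2 T (d + 1)} (hF : F ∈ sobolevPerp T (d + 1) 1 1)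
    (hF' : F' ∈ sobolevPerp T (d + 1) 0 3) (hF₂ : F₂ ∈ sobolevPerp T (d + 1) 0 2)
    (h : restrictHalf T d F = restrictHalf T d F') : ∃ Φ₁ Φ₂ : L2 T (d + 1),
      Φ₁ ∈ sobolevPerp T (d + 1) 0 0 ∧ Φ₂ ∈ sobolevPerp T (d + 1) 0 1 ∧ ∃ g ∈ traceSpace T d,
      IsSolution (restrictHalf T d F', restrictHalf T d F₂)
        (restrictHalf T d Φ₁, restrictHalf T d Φ₂) g ∧
      sobolevNorm 0 0 Φ₁ + sobolevNorm 0 1 Φ₂ + traceNorm g ≤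
        (5 * (20 + 1) : ℝ≥0) * (sobolevNorm 1 1 F + sobolevNorm 0 3 F' + sobolevNorm 0 2 F₂) := by
  have hT : (0 : ℝ) < T := Fact.out
  have hF'2 := sobolevPerp_mono (by norm_num : (2 : ℝ) ≤ 3) hF'
  have hF₂' := hF₂
  rw [mem_sobolevPerp_iff] at hF hF' hF₂
  have hmode : ∀ k, ∃ (f₁ f₂ : SpaceL2 (d + 1)) (g₁ g₂ : SpaceL2 d),
      SolvesMode (freq T k) (timeCoeff k F') (timeCoeff k F₂) f₁ f₂ g₁ g₂ ∧
      (k = 0 → f₁ = 0 ∧ f₂ = 0 ∧ g₁ = 0 ∧ g₂ = 0) ∧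
      sobSq 0 f₁ + sobSq 1 f₂ + (ENNReal.ofReal ((1 + freq T k ^ 2) ^ (3 / 4 : ℝ)) * sobSq 0 g₁ +
        sobSq (3 / 2) g₁) + sobSq (1 / 2) g₂ ≤
      (20 : ℝ≥0) * (ENNReal.ofReal (1 + freq T k ^ 2) * sobSq 1 (timeCoeff k F) +
        sobSq 3 (timeCoeff k F') + sobSq 2 (timeCoeff k F₂)) := by
    intro k
    by_cases hk : k = 0
    · refine ⟨0, 0, 0, 0, ?_, fun _ => ⟨rfl, rfl, rfl, rfl⟩, ?_⟩
      · rw [hk, hF'.1, hF₂.1]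
        exact SolvesMode.zero _
      · simp only [sobSq_zero, mul_zero, add_zero, zero_le]
    · obtain ⟨f₁, f₂, g₁, g₂, h1, h2⟩ := exists_data_of_mode (freq T k)
        (restrictHalf_eq_iff.1 h k) (sobSq_timeCoeff_lt_top hF.2 k)
        (sobSq_timeCoeff_lt_top hF'.2 k) (sobSq_timeCoeff_lt_top hF₂.2 k)
      exact ⟨f₁, f₂, g₁, g₂, h1, fun h => absurd h hk, h2⟩
  choose f₁ f₂ g₁ g₂ hu h0 hb using hmode
  have hsol := solution_normSq_eq F F' F₂
  have hfin : sobolevNormSq 1 1 F + sobolevNormSq 0 3 F' + sobolevNormSq 0 2 F₂ < ⊤ := by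
    simp only [ENNReal.add_lt_top]
    exact ⟨⟨hF.2, hF'.2⟩, hF₂.2⟩
  have hsum := ENNReal.tsum_le_tsum hb
  rw [ENNReal.tsum_mul_left] at hsum
  have hsum' := mul_le_mul_right hsum (ENNReal.ofReal T)
  rw [mul_left_comm _ (((20 : ℝ≥0)) : ℝ≥0∞), ← hsol] at hsum'
  have hlt := hsum'.trans_lt (ENNReal.mul_lt_top ENNReal.coe_lt_top hfin)
  have hlt' : ∑' k : ℤ, (sobSq 0 (f₁ k) + sobSq 1 (f₂ k) +
      (ENNReal.ofReal ((1 + freq T k ^ 2) ^ (3 / 4 : ℝ)) * sobSq 0 (g₁ k) +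
        sobSq (3 / 2) (g₁ k)) + sobSq (1 / 2) (g₂ k)) ≠ ⊤ := by
    intro h
    rw [h, ENNReal.mul_top (by simpa using hT)] at hlt
    exact hlt.ne rfl
  obtain ⟨Φ₁, hΦ₁, -⟩ := exists_timeCoeff_eq (T := T) f₁ (ne_top_of_le_ne_top hlt'
    (ENNReal.tsum_le_tsum fun k => (enorm_sq_le_sobSq le_rfl _).trans
      ((le_self_add.trans le_self_add).trans le_self_add)))
  obtain ⟨Φ₂, hΦ₂, -⟩ := exists_timeCoeff_eq (T := T) f₂ (ne_top_of_le_ne_top hlt'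
    (ENNReal.tsum_le_tsum fun k => (enorm_sq_le_sobSq (by norm_num) _).trans
      ((le_add_self.trans le_self_add).trans le_self_add)))
  obtain ⟨G₁, hG₁, -⟩ := exists_timeCoeff_eq (T := T) g₁ (ne_top_of_le_ne_top hlt'
    (ENNReal.tsum_le_tsum fun k => (enorm_sq_le_sobSq (by norm_num) _).trans
      ((le_add_self.trans le_add_self).trans le_self_add)))
  obtain ⟨G₂, hG₂, -⟩ := exists_timeCoeff_eq (T := T) g₂ (ne_top_of_le_ne_top hlt'
    (ENNReal.tsum_le_tsum fun k => (enorm_sq_le_sobSq (by norm_num) _).trans le_add_self))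
  have hdata := data_normSq_eq Φ₁ Φ₂ G₁ G₂
  simp only [hΦ₁, hΦ₂, hG₁, hG₂] at hdata
  rw [← hdata] at hlt hsum'
  simp only [ENNReal.add_lt_top] at hlt
  obtain ⟨⟨⟨l₁, l₂⟩, l₃, l₄⟩, l₅⟩ := hlt
  obtain ⟨z₁, z₂, z₃, z₄⟩ := h0 0 rfl
  refine ⟨Φ₁, Φ₂, mem_sobolevPerp_iff.2 ⟨(hΦ₁ 0).trans z₁, l₁⟩,
    mem_sobolevPerp_iff.2 ⟨(hΦ₂ 0).trans z₂, l₂⟩, (G₁, G₂),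
    ⟨⟨mem_sobolevPerp_iff.2 ⟨(hG₁ 0).trans z₃, l₃⟩, mem_sobolevPerp_iff.2 ⟨(hG₁ 0).trans z₃, l₄⟩⟩,
      mem_sobolevPerp_iff.2 ⟨(hG₂ 0).trans z₄, l₅⟩⟩, ?_, add_five_le_of_sq_le ?_⟩
  · rw [isSolution_iff hF'2 hF₂']
    intro k
    rw [hΦ₁, hΦ₂, hG₁, hG₂]
    exact hu k
  · simpa only [sobolevNorm_sq] using hsum'

/-- An estimate by the quotient norm may be checked on all extensions. -/
theorem le_mul_halfSobolevNorm_add {s r : ℝ} {f : L2Half T d} {C : ℝ≥0} (hC : C ≠ 0)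
    {X t : ℝ≥0∞} (h : ∀ F ∈ sobolevPerp T (d + 1) s r, restrictHalf T d F = f →
      X ≤ C * (sobolevNorm s r F + t)) : X ≤ C * (halfSobolevNorm s r f + t) := by
  unfold halfSobolevNorm
  rw [iInf_subtype', ENNReal.iInf_add, ENNReal.mul_iInf_of_ne (by simpa using hC) ENNReal.coe_ne_top]
  exact le_iInf fun F => h F F.2.1 F.2.2

theorem exists_solution_bounded : ∃ C : ℝ≥0, ∀ f ∈ dataSpace T d, ∀ g ∈ traceSpace T d,
    ∃ u ∈ solutionSpace T d, IsSolution u f g ∧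
      solutionNorm u ≤ C * (dataNorm f + traceNorm g) := by
  obtain ⟨C, hC⟩ := exists_solution (T := T) (d := d)
  have key : ∀ Φ₁ ∈ sobolevPerp T (d + 1) 0 0, ∀ Φ₂ ∈ sobolevPerp T (d + 1) 0 1,
      ∀ g ∈ traceSpace T d, ∃ u ∈ solutionSpace T d,
      IsSolution u (restrictHalf T d Φ₁, restrictHalf T d Φ₂) g ∧ solutionNorm u ≤
        (C + 1 : ℝ≥0) * (sobolevNorm 0 0 Φ₁ + sobolevNorm 0 1 Φ₂ + traceNorm g) := by
    intro Φ₁ hΦ₁ Φ₂ hΦ₂ g hg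
    obtain ⟨F₁, F₂, m₁, m₁', m₂, hs, hb⟩ := hC Φ₁ hΦ₁ Φ₂ hΦ₂ g hg
    refine ⟨_, ⟨⟨⟨F₁, m₁, rfl⟩, F₁, m₁', rfl⟩, F₂, m₂, rfl⟩, hs, ?_⟩
    refine ((add_le_add (add_le_add (halfSobolevNorm_le m₁) (halfSobolevNorm_le m₁'))
      (halfSobolevNorm_le m₂)).trans hb).trans (mul_le_mul_left ?_ _)
    exact_mod_cast le_self_add
  refine ⟨C + 1, fun f hf g hg => ?_⟩
  obtain ⟨Φ₁, hΦ₁, Φ₂, hΦ₂, rfl⟩ := exists_of_mem_dataSpace hf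
  obtain ⟨u, hu, hs, -⟩ := key Φ₁ hΦ₁ Φ₂ hΦ₂ g hg
  refine ⟨u, hu, hs, ?_⟩
  have hC0 : C + 1 ≠ 0 := by positivity
  rw [dataNorm, add_assoc]
  refine le_mul_halfSobolevNorm_add hC0 fun Ψ₁ hΨ₁ e₁ => ?_
  rw [add_left_comm]
  refine le_mul_halfSobolevNorm_add hC0 fun Ψ₂ hΨ₂ e₂ => ?_
  -- other extensions of `f` lead to the same solution, by uniqueness
  obtain ⟨v, hv, hs', hb⟩ := key Ψ₁ hΨ₁ Ψ₂ hΨ₂ g hg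
  rw [e₁, e₂] at hs'
  rw [hs.eq_of_data_eq hu hv hf hs', add_left_comm, ← add_assoc]
  exact hb

theorem exists_data_bounded : ∃ C : ℝ≥0, ∀ u ∈ solutionSpace T d, ∃ f ∈ dataSpace T d,
    ∃ g ∈ traceSpace T d, IsSolution u f g ∧ dataNorm f + traceNorm g ≤ C * solutionNorm u := by
  refine ⟨5 * (20 + 1), ?_⟩
  rintro ⟨u₁, u₂⟩ hu
  have key : ∀ F ∈ sobolevPerp T (d + 1) 1 1, ∀ F' ∈ sobolevPerp T (d + 1) 0 3,
      ∀ F₂ ∈ sobolevPerp T (d + 1) 0 2, restrictHalf T d F = u₁ → restrictHalf T d F' = u₁ →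
      restrictHalf T d F₂ = u₂ → ∃ f ∈ dataSpace T d, ∃ g ∈ traceSpace T d,
      IsSolution (u₁, u₂) f g ∧ dataNorm f + traceNorm g ≤
        (5 * (20 + 1) : ℝ≥0) * (sobolevNorm 1 1 F + sobolevNorm 0 3 F' + sobolevNorm 0 2 F₂) := by
    rintro F hF F' hF' F₂ hF₂ e rfl rfl
    obtain ⟨Φ₁, Φ₂, m₁, m₂, g, hg, hs, hb⟩ := exists_data hF hF' hF₂ e
    exact ⟨_, ⟨⟨Φ₁, m₁, rfl⟩, Φ₂, m₂, rfl⟩, g, hg, hs, (add_le_add_left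
      (add_le_add (halfSobolevNorm_le m₁) (halfSobolevNorm_le m₂)) _).trans hb⟩
  obtain ⟨⟨⟨F, hF, e⟩, F', hF', e'⟩, F₂, hF₂, e₂⟩ := id hu
  obtain ⟨f, hf, g, hg, hs, -⟩ := key F hF F' hF' F₂ hF₂ e e' e₂
  refine ⟨f, hf, g, hg, hs, ?_⟩
  have hC0 : (5 * (20 + 1) : ℝ≥0) ≠ 0 := by positivity
  rw [solutionNorm, add_assoc]
  refine le_mul_halfSobolevNorm_add hC0 fun G hG k => ?_
  rw [add_left_comm]
  refine le_mul_halfSobolevNorm_add hC0 fun G' hG' k' => ?_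
  rw [← add_assoc, add_comm _ (halfSobolevNorm 0 2 _)]
  refine le_mul_halfSobolevNorm_add hC0 fun G₂ hG₂ k₂ => ?_
  obtain ⟨f', hf', g', hg', hs', hb⟩ := key G hG G' hG' G₂ hG₂ k k' k₂
  obtain ⟨rfl, rfl⟩ := hs.data_eq hu hf hf' hs'
  rwa [add_comm (sobolevNorm 0 2 G₂), add_comm (sobolevNorm 0 3 G')]

end SolutionOperator

end CahnHilliardGurtin

end

theorem theorem1p1 (d : ℕ) (T : ℝ) [Fact (0 < T)] :
    (∃ C : ℝ≥0, ∀ f ∈ dataSpace T d, ∀ g ∈ traceSpace T d,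
      ∃ u ∈ solutionSpace T d, IsSolution u f g ∧
        (∀ v ∈ solutionSpace T d, IsSolution v f g → v = u) ∧
        solutionNorm u ≤ C * (dataNorm f + traceNorm g)) ∧
    (∃ S : solutionSpace T d ≃ₗ[ℂ] dataSpace T d × traceSpace T d,
      (∀ (u : solutionSpace T d) (f : dataSpace T d) (g : traceSpace T d),
        S u = (f, g) ↔ IsSolution u.1 f.1 g.1) ∧
      ∃ C : ℝ≥0, ∀ u : solutionSpace T d,
        dataNorm (S u).1.1 + traceNorm (S u).2.1 ≤ C * solutionNorm u.1 ∧
        solutionNorm u.1 ≤ C * (dataNorm (S u).1.1 + traceNorm (S u).2.1)) := by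
  obtain ⟨C, hC⟩ := exists_solution_bounded (T := T) (d := d)
  obtain ⟨C', hC'⟩ := exists_data_bounded (T := T) (d := d)
  refine ⟨⟨C, fun f hf g hg => ?_⟩, ?_⟩
  · obtain ⟨u, hu, hs, hb⟩ := hC f hf g hg
    exact ⟨u, hu, hs, fun v hv h => h.eq_of_data_eq hv hu hf hs, hb⟩
  choose f hf g hg hs hb using hC'
  -- the graph of `S` is the set of triples `(u, f, g)` with `IsSolution u f g`
  have graph : ∀ (u : solutionSpace T d) (f' : dataSpace T d) (g' : traceSpace T d),
      ((⟨f u.1 u.2, hf u.1 u.2⟩, ⟨g u.1 u.2, hg u.1 u.2⟩) : dataSpace T d × traceSpace T d) =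
        (f', g') ↔ IsSolution u.1 f'.1 g'.1 := by
    intro u f' g'
    constructor
    · intro h
      obtain ⟨rfl, rfl⟩ := Prod.mk.inj h
      exact hs u.1 u.2
    · intro h
      obtain ⟨h1, h2⟩ := (hs u.1 u.2).data_eq u.2 (hf u.1 u.2) f'.2 h
      exact Prod.ext (Subtype.ext h1) (Subtype.ext h2)
  let S : solutionSpace T d →ₗ[ℂ] dataSpace T d × traceSpace T d :=
    { toFun := fun u => (⟨f u.1 u.2, hf u.1 u.2⟩, ⟨g u.1 u.2, hg u.1 u.2⟩)
      map_add' := fun u v => (graph (u + v) _ _).2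
        ((hs u.1 u.2).add u.2 v.2 (hf u.1 u.2) (hf v.1 v.2) (hs v.1 v.2))
      map_smul' := fun c u => (graph (c • u) _ _).2 ((hs u.1 u.2).smul c u.2 (hf u.1 u.2)) }
  have hS : Function.Bijective S := by
    constructor
    · intro u v h
      have h1 : IsSolution u.1 (S v).1.1 (S v).2.1 := (graph u _ _).1 h
      exact Subtype.ext (h1.eq_of_data_eq u.2 v.2 (hf v.1 v.2) (hs v.1 v.2))
    · rintro ⟨f', g'⟩
      obtain ⟨u, hu, h, -⟩ := hC f'.1 f'.2 g'.1 g'.2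
      exact ⟨⟨u, hu⟩, (graph ⟨u, hu⟩ f' g').2 h⟩
  refine ⟨LinearEquiv.ofBijective S hS, graph, C + C', fun u => ⟨?_, ?_⟩⟩
  · refine (hb u.1 u.2).trans (mul_le_mul_left ?_ _)
    exact_mod_cast le_add_self
  · obtain ⟨v, hv, h, hbd⟩ := hC _ (hf u.1 u.2) _ (hg u.1 u.2)
    rw [← (hs u.1 u.2).eq_of_data_eq u.2 hv (hf u.1 u.2) h] at hbd
    refine hbd.trans (mul_le_mul_left ?_ _)
    exact_mod_cast le_self_add
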